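/- **Setting.** Let $d\ge 2$, $m\ge 1$ be integers, $Y=(-\tfrac12,\tfrac12)^d$, and let $\mathbb T^d$ be the flat torus with unit cell $Y$. Let $\omega\subset Y$ be a (nonempty, open, connected) domain with Lipschitz boundary, $\mathrm{dist}(\omega,\partial Y)>0$, whose background $Y\setminus\overline\omega$ is connected. Let $\mu>0$ and let $A=(a_{ij}^{\alpha\beta}(y))$, $1\le i,j\le d$, $1\le\alpha,\beta\le m$, be measurable real coefficients on $\mathbb R^d$ that are symmetric ($a_{ij}^{\alpha\beta}=a_{ji}^{\beta\alpha}$), $\mathbb Z^d$-periodic and strongly elliptic: $\mu|\xi|^2\le a_{ij}^{\alpha\beta}(y)\xi_i^\alpha\xi_j^\beta\le\mu^{-1}|\xi|^2$ for all $y\in\mathbb R^d$, $\xi\in\mathbb R^{dm}$. Write $\mathcal L=-\mathrm{div}(A\nabla)$, i.e. $(\mathcal Lu)^\alpha=-\partial_i(a_{ij}^{\alpha\beta}\partial_ju^\beta)$, $e^\alpha$ for the standard basis of $\mathbb R^m$, and $\Lambda_\delta=\delta\,\mathbf 1_\omega+\mathbf 1_{Y\setminus\overline\omega}$. For $\delta\in(0,\infty)$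 the corrector $\chi^\alpha_{\delta,i}\in H^1(\mathbb T^d;\mathbb R^m)$ is the mean-zero weak solution on $\mathbb T^d$ of $-\mathrm{div}\big[\Lambda_\delta A\nabla(\chi^\alpha_{\delta,i}+y_ie^\alpha)\big]=0$. **Layer potentials.** $H^{1/2}(\partial\omega)$ is the space of traces on $\partial\omega$ of functions in $H^1(\mathbb T^d;\mathbb R^m)$, $H^{-1/2}(\partial\omega)$ its dual, and $H_0^{-1/2}(\partial\omega)$ the subspace of functionals that annihilate constants. With $\nu$ the normal pointing out of $\omega$, conormal derivatives $\frac{\partial w}{\partial\nu}\big|_\pm=\nu\cdot A\nabla w|_\pm\in H^{-1/2}(\partial\omega)$ from outside ($+$) and inside ($-$) $\omega$ are given by Green's formulas $\langle\frac{\partial w}{\partial\nu}|_-,v\rangle=\int_\omega A\nabla w\cdot\nabla v$ and $\langle\frac{\partial w}{\partial\nu}|_+,v\rangle=-\int_{Y\setminus\overline\omega}A\nabla w\cdot\nabla v$, $v\in H^1(\mathbb T^d;\mathbb R^m)$. For $\psi\in H_0^{-1/2}(\partial\omega)$, the single-layer potential $\mathcal S\psi\in H^1(\mathbb T^d;\mathbb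 R^m)$ is the mean-zero solution of $\int_YA\nabla\mathcal S\psi\cdot\nabla v\,dy+\langle\psi,v\rangle=0$ for all $v\in H^1(\mathbb T^d;\mathbb R^m)$, and the Neumann–Poincaré operator is $\mathcal K^*\psi=\frac{\partial\mathcal S\psi}{\partial\nu}\big|_+-\tfrac12\psi$. Put $\phi_i^\alpha=\frac{\partial}{\partial\nu}\big|_\pm(y_ie^\alpha+\chi_{1,i}^\alpha)\in H^{-1/2}_0(\partial\omega)$ (both sides agree) and define $$\chi_{0,i}^\alpha=\chi_{1,i}^\alpha+\mathcal S\big(-\tfrac12I-\mathcal K^*\big)^{-1}\phi_i^\alpha-q_{0,i}^\alpha,\qquad \chi_{\infty,i}^\alpha=\chi_{1,i}^\alpha+\mathcal S\big(\tfrac12I-\mathcal K^*\big)^{-1}\phi_i^\alpha-q_{\infty,i}^\alpha,$$ where the constant vectors $q_{0,i}^\alpha$, $q_{\infty,i}^\alpha$ are the integrals over $Y$ of the preceding single-layer potentials. **Theorem.** There is a constant $C<\infty$, depending only on $d,m,\mu,\omega$, such that for all $A$ as above and all $1\le i\le d$, $1\le\alpha\le m$ the following hold. The corrector $\chi_{\delta,i}^\alpha$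 (for each $\delta\in(0,\infty)$) and the functions $\chi_{0,i}^\alpha$, $\chi_{\infty,i}^\alpha$ are well defined (they exist and are unique). 1. $\chi_{0,i}^\alpha$ is the unique $\chi\in H^1(\mathbb T^d;\mathbb R^m)$ solving the soft problem: $\mathcal L(\chi+y_ie^\alpha)=0$ in $\mathbb T^d\setminus\partial\omega$, $\ \frac{\partial}{\partial\nu}(\chi+y_ie^\alpha)\big|_+=0$ on $\partial\omega$, $\ \int_Y\chi\,dy=0$. 2. $\chi_{\infty,i}^\alpha$ is the unique $\chi\in H^1(\mathbb T^d;\mathbb R^m)$ solving the stiff problem: $\mathcal L(\chi+y_ie^\alpha)=0$ in $\mathbb T^d\setminus\partial\omega$, $\ \frac{\partial}{\partial\nu}(\chi+y_ie^\alpha)\big|_-=0$ on $\partial\omega$, $\ \int_Y\chi\,dy=0$. 3. For all $\delta\in(0,\infty)$, $$\|\chi_{\delta,i}^\alpha-\chi_{0,i}^\alpha\|_{H^1(Y)}\le C\delta,\qquad \|\chi_{\delta,i}^\alpha-\chi_{\infty,i}^\alpha\|_{H^1(Y)}\le C\delta^{-1},\qquad \|\chi_{\delta,i}^\alpha\|_{H^1(Y)}\le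 C.$$ -/

import Mathlib

open MeasureTheory Set
open scoped NNReal

namespace HighContrast

/-- Euclidean space `ℝ^d`. -/
abbrev E (d : ℕ) : Type := EuclideanSpace ℝ (Fin d)

/-- The space `ℝ^{d × m}` of gradients of `ℝ^m`-valued functions, with the Euclidean norm;
the entry `(i, β)` stands for `∂_i u^β`. -/
abbrev Grad (d m : ℕ) : Type := EuclideanSpace ℝ (Fin d × Fin m)

/-- The unit cell `Y = (-1/2, 1/2)^d`. -/
def unitCell (d : ℕ) : Set (E d) := {y | ∀ i, y i ∈ Ioo (-(1 / 2 : ℝ)) (1 / 2)}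

/-- The `ℤ^d`-periodic functions on `ℝ^d`. -/
def IsPeriodic {d : ℕ} {V : Type*} (f : E d → V) : Prop :=
  ∀ (n : Fin d → ℤ) (y : E d), f (y + WithLp.toLp 2 (fun i => (n i : ℝ))) = f y

/-- Lebesgue measure on the unit cell, that is, on the flat torus. -/
noncomputable abbrev cellMeasure (d : ℕ) : Measure (E d) := volume.restrict (unitCell d)

/-- `L²(Y; ℝ^m)`. -/
abbrev L2 (d m : ℕ) : Type := Lp (E m) 2 (cellMeasure d)

/-- `L²(Y; ℝ^{d × m})`. -/
abbrev L2Grad (d m : ℕ) : Type := Lp (Grad d m) 2 (cellMeasure d)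

/-- `G` is the weak gradient of `u` on the torus: the test functions are the smooth
periodic functions (so periodicity of `u` across the faces of `Y` is part of the condition). -/
def IsWeakGrad {d m : ℕ} (u : E d → E m) (G : E d → Grad d m) : Prop :=
  ∀ ϕ : E d → ℝ, ContDiff ℝ ((⊤ : ℕ∞) : WithTop ℕ∞) ϕ → IsPeriodic ϕ → ∀ (i : Fin d) (β : Fin m),
    ∫ y in unitCell d, u y β * fderiv ℝ ϕ y (EuclideanSpace.single i 1) =
      - ∫ y in unitCell d, G y (i, β) * ϕ y

theorem unitCell_subset_closedBall (d : ℕ) :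
    unitCell d ⊆ Metric.closedBall (0 : E d) (Real.sqrt d) := by
  intro y hy
  rw [mem_closedBall_zero_iff, EuclideanSpace.norm_eq]
  apply Real.sqrt_le_sqrt
  calc ∑ i, ‖y i‖ ^ 2 ≤ ∑ _i : Fin d, (1 : ℝ) := by
        refine Finset.sum_le_sum fun i _ => ?_
        have h := hy i
        rw [Real.norm_eq_abs, sq_abs]
        nlinarith [h.1, h.2]
    _ = d := by simp

theorem integrable_coord_mul {d : ℕ} {ι : Type*} [Fintype ι]
    (u : Lp (EuclideanSpace ℝ ι) 2 (cellMeasure d)) (k : ι)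
    {f : E d → ℝ} (hf : Continuous f) :
    Integrable (fun y => u y k * f y) (cellMeasure d) := by
  have hfin : IsFiniteMeasure (cellMeasure d) := by
    refine ⟨?_⟩
    rw [Measure.restrict_apply_univ]
    exact (measure_mono (unitCell_subset_closedBall d)).trans_lt measure_closedBall_lt_top
  obtain ⟨C, hC⟩ := (isCompact_closedBall (0 : E d) (Real.sqrt d)).exists_bound_of_continuousOn
    hf.continuousOn
  have hmeas : MeasurableSet (unitCell d) := by
    have : IsOpen (unitCell d) := by
      have h : unitCell d = ⋂ i : Fin d, (fun y : E d => y i) ⁻¹' Ioo (-(1 / 2 : ℝ)) (1 / 2) := by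
        ext y; simp [unitCell]
      rw [h]
      exact isOpen_iInter_of_finite fun i => isOpen_Ioo.preimage (by fun_prop)
    exact this.measurableSet
  have hu : Integrable (fun y => u y k) (cellMeasure d) :=
    ((EuclideanSpace.proj k : EuclideanSpace ℝ ι →L[ℝ] ℝ).integrable_comp
      ((Lp.memLp u).integrable (by norm_num)))
  refine hu.mul_bdd (c := C) hf.aestronglyMeasurable ?_
  exact (ae_restrict_iff' hmeas).2
    (Filter.Eventually.of_forall fun y hy => hC y (unitCell_subset_closedBall d hy))

/-- The pairs `(u, ∇u)` with `u ∈ H¹(𝕋^d; ℝ^m)`, as a subspace of `L² × L²`. -/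
noncomputable def H1Submodule (d m : ℕ) : Submodule ℝ (WithLp 2 (L2 d m × L2Grad d m)) where
  carrier := {p | IsWeakGrad p.fst p.snd}
  zero_mem' := by
    intro ϕ _ _ i β
    have h1 : ∀ᵐ y ∂(cellMeasure d), (0 : L2 d m) y = 0 := Lp.coeFn_zero _ _ _
    have h2 : ∀ᵐ y ∂(cellMeasure d), (0 : L2Grad d m) y = 0 := Lp.coeFn_zero _ _ _
    rw [integral_eq_zero_of_ae, integral_eq_zero_of_ae, neg_zero]
    · filter_upwards [h2] with y hy
      rw [WithLp.zero_snd, hy]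
      simp
    · filter_upwards [h1] with y hy
      rw [WithLp.zero_fst, hy]
      simp
  add_mem' := by
    intro p q hp hq ϕ hϕ hper i β
    have hd : Continuous fun y => fderiv ℝ ϕ y (EuclideanSpace.single i 1) :=
      (hϕ.continuous_fderiv (by simp)).clm_apply continuous_const
    have h1 := Lp.coeFn_add p.fst q.fst
    have h2 := Lp.coeFn_add p.snd q.snd
    have e1 : ∫ y in unitCell d, (p + q).fst y β * fderiv ℝ ϕ y (EuclideanSpace.single i 1) =
        ∫ y in unitCell d, (p.fst y β * fderiv ℝ ϕ y (EuclideanSpace.single i 1) +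
          q.fst y β * fderiv ℝ ϕ y (EuclideanSpace.single i 1)) := by
      refine integral_congr_ae ?_
      filter_upwards [h1] with y hy
      rw [WithLp.add_fst, hy]
      simp [add_mul]
    have e2 : ∫ y in unitCell d, (p + q).snd y (i, β) * ϕ y =
        ∫ y in unitCell d, (p.snd y (i, β) * ϕ y + q.snd y (i, β) * ϕ y) := by
      refine integral_congr_ae ?_
      filter_upwards [h2] with y hy
      rw [WithLp.add_snd, hy]
      simp [add_mul]
    rw [e1, e2, integral_add (integrable_coord_mul _ _ hd) (integrable_coord_mul _ _ hd),
      integral_add (integrable_coord_mul _ _ hϕ.continuous)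
        (integrable_coord_mul _ _ hϕ.continuous), hp ϕ hϕ hper i β, hq ϕ hϕ hper i β]
    ring
  smul_mem' := by
    intro c p hp ϕ hϕ hper i β
    have h1 := Lp.coeFn_smul c p.fst
    have h2 := Lp.coeFn_smul c p.snd
    have e1 : ∫ y in unitCell d, (c • p).fst y β * fderiv ℝ ϕ y (EuclideanSpace.single i 1) =
        ∫ y in unitCell d, c * (p.fst y β * fderiv ℝ ϕ y (EuclideanSpace.single i 1)) := by
      refine integral_congr_ae ?_
      filter_upwards [h1] with y hy
      rw [WithLp.smul_fst, hy]
      simp [mul_assoc]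
    have e2 : ∫ y in unitCell d, (c • p).snd y (i, β) * ϕ y =
        ∫ y in unitCell d, c * (p.snd y (i, β) * ϕ y) := by
      refine integral_congr_ae ?_
      filter_upwards [h2] with y hy
      rw [WithLp.smul_snd, hy]
      simp [mul_assoc]
    rw [e1, e2, integral_const_mul, integral_const_mul, hp ϕ hϕ hper i β]
    ring

/-- `H¹(𝕋^d; ℝ^m)`, with the norm `(‖u‖²_{L²(Y)} + ‖∇u‖²_{L²(Y)})^{1/2}`. -/
abbrev H1 (d m : ℕ) : Type := H1Submodule d m

/-- The function underlying an element of `H¹(𝕋^d; ℝ^m)` (defined a.e. on `Y`). -/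
noncomputable def H1.fn {d m : ℕ} (u : H1 d m) : E d → E m := u.1.fst

/-- The weak gradient of an element of `H¹(𝕋^d; ℝ^m)`. -/
noncomputable def H1.grad {d m : ℕ} (u : H1 d m) : E d → Grad d m := u.1.snd

/-- `∫_Y u = 0`. -/
def H1.MeanZero {d m : ℕ} (u : H1 d m) : Prop := ∫ y in unitCell d, u.fn y = 0

/-! ### Geometry and coefficients -/

/-- Lipschitz boundary: near each boundary point the set is, in suitable orthonormal
coordinates with last axis `n`, the part above the graph of a Lipschitz function of the
remaining coordinates. -/
def HasLipschitzBoundary {d : ℕ} (ω : Set (E d)) : Prop :=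
  ∀ x ∈ frontier ω, ∃ r > 0, ∃ n : E d, ‖n‖ = 1 ∧
    ∃ (L : ℝ≥0) (g : (Submodule.span ℝ {n})ᗮ → ℝ), LipschitzWith L g ∧
      ∀ y ∈ Metric.ball x r,
        (y ∈ ω ↔ g ((Submodule.span ℝ {n})ᗮ.orthogonalProjectionOnto y) < inner ℝ n y)

/-- The inclusion: a domain `ω ⊂ Y` with Lipschitz boundary, at positive distance from `∂Y`,
without holes (the background `Y \ ω̄` is connected). -/
structure IsInclusion {d : ℕ} (ω : Set (E d)) : Prop where
  isOpen : IsOpen ω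
  isConnected : IsConnected ω
  subset : ω ⊆ unitCell d
  dist_pos : ∃ r > 0, ∀ x ∈ ω, ∀ y ∈ frontier (unitCell d), r ≤ dist x y
  lipschitz : HasLipschitzBoundary ω
  background_connected : IsConnected (unitCell d \ closure ω)

/-- Coefficient tensors: `A y i j α β` is `a_{ij}^{αβ}(y)`. -/
abbrev Coeff (d m : ℕ) : Type := E d → Fin d → Fin d → Fin m → Fin m → ℝ

/-- Symmetric, strongly elliptic (with constant `μ`), periodic, measurable coefficients. -/
structure IsAdmissible {d m : ℕ} (μ : ℝ) (A : Coeff d m) : Prop where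
  measurable : ∀ i j α β, Measurable fun y => A y i j α β
  symm : ∀ y i j α β, A y i j α β = A y j i β α
  elliptic_lower : ∀ (y : E d) (ξ : Fin d → Fin m → ℝ),
    μ * ∑ i, ∑ α, ξ i α ^ 2 ≤ ∑ i, ∑ j, ∑ α, ∑ β, A y i j α β * ξ i α * ξ j β
  elliptic_upper : ∀ (y : E d) (ξ : Fin d → Fin m → ℝ),
    ∑ i, ∑ j, ∑ α, ∑ β, A y i j α β * ξ i α * ξ j β ≤ μ⁻¹ * ∑ i, ∑ α, ξ i α ^ 2
  periodic : IsPeriodic A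

/-- `A P · Q = a_{ij}^{αβ} P_j^β Q_i^α` at the point `y`. -/
def pairing {d m : ℕ} (A : Coeff d m) (y : E d) (P Q : Grad d m) : ℝ :=
  ∑ i, ∑ j, ∑ α, ∑ β, A y i j α β * P (j, β) * Q (i, α)

/-- The gradient of `u + y_i e^α`, for `u ∈ H¹(𝕋^d; ℝ^m)`. -/
noncomputable def correctedGrad {d m : ℕ} (i : Fin d) (α : Fin m) (u : H1 d m) : E d → Grad d m :=
  fun y => u.grad y + EuclideanSpace.single (i, α) 1

/-- The contrast function `Λ_δ = δ 1_ω + 1_{Y \ ω̄}` on the unit cell. -/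
noncomputable def contrast {d : ℕ} (ω : Set (E d)) (δ : ℝ) : E d → ℝ :=
  fun y => ω.indicator (fun _ => δ) y + (unitCell d \ closure ω).indicator (fun _ => 1) y

/-- The cell problem: `-div [Λ_δ A ∇(χ + y_i e^α)] = 0` weakly on the torus, `χ ∈ H¹(𝕋^d; ℝ^m)`
of mean zero. -/
def IsCellSolution {d m : ℕ} (A : Coeff d m) (ω : Set (E d)) (δ : ℝ) (i : Fin d) (α : Fin m)
    (χ : H1 d m) : Prop :=
  (∀ v : H1 d m,
    ∫ y in unitCell d, contrast ω δ y * pairing A y (correctedGrad i α χ y) (v.grad y) = 0) ∧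
  χ.MeanZero

/-! ### Traces on `∂ω` and conormal derivatives -/

/-- Smooth periodic functions that vanish near `∂ω`, that is, `C_c^∞(𝕋^d \ ∂ω; ℝ^m)`. -/
def IsTestOff {d m : ℕ} (ω : Set (E d)) (ϕ : E d → E m) : Prop :=
  ContDiff ℝ ((⊤ : ℕ∞) : WithTop ℕ∞) ϕ ∧ IsPeriodic ϕ ∧ Disjoint (tsupport ϕ) (frontier ω)

/-- The functions in `H¹(𝕋^d; ℝ^m)` with zero trace on `∂ω`: the closure in `H¹` of
`C_c^∞(𝕋^d \ ∂ω; ℝ^m)`. -/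
noncomputable def zeroTrace {d : ℕ} (m : ℕ) (ω : Set (E d)) : Submodule ℝ (H1 d m) :=
  (Submodule.span ℝ
    {v : H1 d m | ∃ ϕ, IsTestOff ω ϕ ∧ v.fn =ᵐ[cellMeasure d] ϕ}).topologicalClosure

/-- The trace space `H^{1/2}(∂ω; ℝ^m)`, with its quotient norm. -/
abbrev HHalf {d : ℕ} (m : ℕ) (ω : Set (E d)) : Type := H1 d m ⧸ zeroTrace m ω

/-- The trace on `∂ω`. -/
noncomputable def trace {d m : ℕ} (ω : Set (E d)) (v : H1 d m) : HHalf m ω :=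
  (zeroTrace m ω).mkQ v

/-- `H^{-1/2}(∂ω; ℝ^m)`, the continuous dual of `H^{1/2}(∂ω; ℝ^m)`. -/
abbrev HNegHalf {d : ℕ} (m : ℕ) (ω : Set (E d)) : Type := StrongDual ℝ (HHalf m ω)

/-- `ψ ∈ H_0^{-1/2}(∂ω; ℝ^m)`: `ψ` annihilates the constant vectors. -/
def IsZeroMean {d m : ℕ} {ω : Set (E d)} (ψ : HNegHalf m ω) : Prop :=
  ∀ (v : H1 d m) (c : E m), (v.fn =ᵐ[cellMeasure d] fun _ => c) → ψ (trace ω v) = 0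

/-- `ψ = (ν · A P)|_-` on `∂ω`, the trace from inside `ω` of the conormal component of the flux
`A P`, with `ν` the normal pointing out of `ω`; it is defined by Green's formula
`⟨ψ, v⟩ = ∫_ω A P · ∇v`. For `P = ∇w` this is `∂w/∂ν|_-`. -/
def IsConormalMinus {d m : ℕ} (A : Coeff d m) (ω : Set (E d)) (P : E d → Grad d m)
    (ψ : HNegHalf m ω) : Prop :=
  ∀ v : H1 d m, ψ (trace ω v) = ∫ y in ω, pairing A y (P y) (v.grad y)

/-- `ψ = (ν · A P)|_+` on `∂ω`, the trace from outside `ω`, with the same normal `ν`; it is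
defined by Green's formula `⟨ψ, v⟩ = - ∫_{Y \ ω̄} A P · ∇v`. -/
def IsConormalPlus {d m : ℕ} (A : Coeff d m) (ω : Set (E d)) (P : E d → Grad d m)
    (ψ : HNegHalf m ω) : Prop :=
  ∀ v : H1 d m,
    ψ (trace ω v) = - ∫ y in unitCell d \ closure ω, pairing A y (P y) (v.grad y)

/-! ### Layer potentials -/

/-- `u = 𝒮ψ`, the single-layer potential of `ψ`: the mean-zero `u ∈ H¹(𝕋^d; ℝ^m)` with
`∫_Y A ∇u · ∇v + ⟨ψ, v⟩ = 0` for all `v ∈ H¹(𝕋^d; ℝ^m)`. -/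
def IsSingleLayer {d m : ℕ} (A : Coeff d m) (ω : Set (E d)) (ψ : HNegHalf m ω) (u : H1 d m) :
    Prop :=
  (∀ v : H1 d m,
    (∫ y in unitCell d, pairing A y (u.grad y) (v.grad y)) + ψ (trace ω v) = 0) ∧
  u.MeanZero

/-- `κ = 𝒦*ψ`, the Neumann–Poincaré operator: `𝒦*ψ = ∂(𝒮ψ)/∂ν|_+ - ψ/2`. -/
def IsNeumannPoincare {d m : ℕ} (A : Coeff d m) (ω : Set (E d)) (ψ κ : HNegHalf m ω) : Prop :=
  ∃ u : H1 d m, IsSingleLayer A ω ψ u ∧ IsConormalPlus A ω u.grad (κ + (1 / 2 : ℝ) • ψ)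

/-- `ψ = (t I - 𝒦*)⁻¹ φ` in `H_0^{-1/2}(∂ω; ℝ^m)`. -/
def IsResolvent {d m : ℕ} (A : Coeff d m) (ω : Set (E d)) (t : ℝ) (φ ψ : HNegHalf m ω) : Prop :=
  IsZeroMean ψ ∧ ∃ κ : HNegHalf m ω, IsNeumannPoincare A ω ψ κ ∧ t • ψ - κ = φ

/-- `χ = χ_1 + 𝒮 (t I - 𝒦*)⁻¹ φ - q` with `χ_1` the solution of the cell problem without
contrast (`δ = 1`), `φ = ∂(y_i e^α + χ_1)/∂ν|_± ∈ H_0^{-1/2}(∂ω; ℝ^m)` and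
`q = ∫_Y 𝒮 (t I - 𝒦*)⁻¹ φ`. The choice `t = -1/2` gives `χ_0`, and `t = 1/2` gives `χ_∞`. -/
def IsLayerCorrector {d m : ℕ} (A : Coeff d m) (ω : Set (E d)) (t : ℝ) (i : Fin d) (α : Fin m)
    (χ : H1 d m) : Prop :=
  ∃ (χ₁ : H1 d m) (φ ψ : HNegHalf m ω) (u : H1 d m),
    IsCellSolution A ω 1 i α χ₁ ∧
    IsZeroMean φ ∧
    IsConormalPlus A ω (correctedGrad i α χ₁) φ ∧
    IsConormalMinus A ω (correctedGrad i α χ₁) φ ∧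
    IsResolvent A ω t φ ψ ∧
    IsSingleLayer A ω ψ u ∧
    χ.fn =ᵐ[cellMeasure d] fun y => χ₁.fn y + u.fn y - ∫ z in unitCell d, u.fn z

/-! ### The limit cell problems -/

/-- `-div [A ∇(χ + y_i e^α)] = 0` in `𝕋^d \ ∂ω`, in the sense of distributions. -/
def SolvesOff {d m : ℕ} (A : Coeff d m) (ω : Set (E d)) (i : Fin d) (α : Fin m) (χ : H1 d m) :
    Prop :=
  ∀ ϕ : E d → E m, IsTestOff ω ϕ →
    ∫ y in unitCell d, pairing A y (correctedGrad i α χ y)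
      (WithLp.toLp 2 fun p : Fin d × Fin m =>
        fderiv ℝ ϕ y (EuclideanSpace.single p.1 1) p.2) = 0

/-- The soft cell problem: `ℒ(χ + y_i e^α) = 0` in `𝕋^d \ ∂ω`, `∂(χ + y_i e^α)/∂ν|_+ = 0` on
`∂ω`, and `∫_Y χ = 0`. -/
def IsSoftSolution {d m : ℕ} (A : Coeff d m) (ω : Set (E d)) (i : Fin d) (α : Fin m)
    (χ : H1 d m) : Prop :=
  SolvesOff A ω i α χ ∧
  IsConormalPlus A ω (correctedGrad i α χ) (0 : HNegHalf m ω) ∧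
  χ.MeanZero

/-- The stiff cell problem: `ℒ(χ + y_i e^α) = 0` in `𝕋^d \ ∂ω`, `∂(χ + y_i e^α)/∂ν|_- = 0` on
`∂ω`, and `∫_Y χ = 0`. -/
def IsStiffSolution {d m : ℕ} (A : Coeff d m) (ω : Set (E d)) (i : Fin d) (α : Fin m)
    (χ : H1 d m) : Prop :=
  SolvesOff A ω i α χ ∧
  IsConormalMinus A ω (correctedGrad i α χ) (0 : HNegHalf m ω) ∧
  χ.MeanZero

end HighContrast

/-!
Each phase `S` (`ω` or the background `Y \ ω̄`) carries the energy `a_S(u, v) = ∫_S A∇u · ∇v`, and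
`∂ω` is a null set, so the corrector equation reads
`a_B(χ + y_i e^α, v) + δ a_ω(χ + y_i e^α, v) = 0` with `B = Y \ ω̄`. Dividing by `δ` exchanges the
roles of the phases and replaces `δ` by `δ⁻¹` (`isCellSolution_iff_inv`): the stiff limit is the soft
limit with `ω` and `B` interchanged, and one argument treats both.

The layer potentials disappear by unwinding their definitions. With `χ = χ₁ + 𝒮ψ`, the equation
`(t - 𝒦*)ψ = φ` says that the energy of `χ + y_i e^α` in `B`, as a functional of the test function,
is `t + 1/2` times the total energy functional (`isLayerCorrector_iff`). For `t = -1/2` the flux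
into `B` vanishes, which is the soft problem; for `t = 1/2` the flux into `ω` vanishes, which is the
stiff problem. No inverse of `±1/2 - 𝒦*` has to be constructed beforehand: its existence and
uniqueness are equivalent to those for the limit problem.

The contrast estimate is a fact about Hilbert spaces (`IsTwoPhase`). Let `B₁ + s B₂` be the energy on
mean-zero functions and `K` the space of functions with `∇u = 0` on the first phase. The difference
`w` of the solution with contrast `s` and the limit is `B₂`-orthogonal to `K`. Hence `‖w‖` is
controlled by the distance from `w` to `K`, and that distance by the energy `B₁ w w`, which the
equation bounds by `s` times a multiple of `‖w‖` (`IsTwoPhase.norm_sub_le_of_isLimitSolution`). The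
limit is obtained by solving first on `Kᗮ` and then on `K`. The uniform bound on `χ_δ` follows from
the soft estimate if `δ ≤ 1` and from the stiff one if `δ ≥ 1`.

The analytic input does not involve `A`, so that `C` depends on `d`, `m`, `μ`, `ω` only: for each
phase `S`,

* the distance in `H¹(𝕋^d)` from `u` to the functions with vanishing gradient on `S` is at most
  `C ‖∇u‖_{L²(S)}` (`exists_norm_sub_le_resG`);
* such functions have constant trace on `∂ω` (`exists_sub_const_mem_zeroTrace`), because `S` is
  connected (`H1.exists_eq_const_of_grad_eq_zero`).

The first point rests on an extension from `S` to the torus: a smooth function is changed, by a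
function of zero trace that vanishes on `S`, into one whose `H¹` norm is controlled by its norm on
`S` (`exists_extension_of_smooth`). Locally this is reflection across a Lipschitz graph; that the
correction has zero trace uses that Lipschitz functions vanishing on `∂ω` are limits of smooth
functions vanishing near `∂ω` (`ofLipschitz_mem_zeroTrace`). Density of smooth functions
(`topologicalClosure_smoothH1`), Poincaré's inequality (`norm_fnL_le_of_meanZero`) and the compactness
of `H¹ → L²`, in the form of finitely many functionals that control the `L²` norm up to a small
multiple of the `H¹` norm (`exists_finite_functionals`), come from Fourier series on the cell. The compactness turns
the extension estimate into the Poincaré-type inequality (`exists_norm_sub_le_of_ker`).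
-/

namespace HighContrast

open Filter Topology WithLp
open scoped ENNReal Convolution

/-- The Haar measure of mass one on the circle, the normalization used for Fourier series on
`UnitAddTorus`. -/
noncomputable local instance unitCircleMeasureSpace : MeasureSpace UnitAddCircle :=
  ⟨AddCircle.haarAddCircle⟩

/-! ### Periodic functions on the cell -/

theorem mem_unitCell_iff {d : ℕ} {y : E d} : y ∈ unitCell d ↔ ‖ofLp y‖ < 1 / 2 := by
  rw [pi_norm_lt_iff (by norm_num)]
  simp only [unitCell, mem_ofPred_eq, mem_Ioo, Real.norm_eq_abs, abs_lt]

theorem isOpen_unitCell (d : ℕ) : IsOpen (unitCell d) := by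
  have : unitCell d = (fun y : E d => ‖ofLp y‖) ⁻¹' Iio (1 / 2) := by
    ext y
    rw [mem_unitCell_iff]
    rfl
  rw [this]
  exact isOpen_Iio.preimage (by fun_prop)

theorem measurableSet_unitCell (d : ℕ) : MeasurableSet (unitCell d) :=
  (isOpen_unitCell d).measurableSet

instance isFiniteMeasure_cellMeasure (d : ℕ) : IsFiniteMeasure (cellMeasure d) :=
  ⟨by
    rw [Measure.restrict_apply_univ]
    exact (measure_mono (unitCell_subset_closedBall d)).trans_lt measure_closedBall_lt_top⟩

/-- The half-open unit cube with lower corner `a`. -/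
def cube {d : ℕ} (a : Fin d → ℝ) : Set (E d) := {y | ∀ i, y i ∈ Ioc (a i) (a i + 1)}

theorem unitCell_ae_eq_cube (d : ℕ) :
    unitCell d =ᵐ[volume] cube (fun _ : Fin d => -(1 / 2 : ℝ)) := by
  have h1 : unitCell d = ofLp ⁻¹' (univ.pi fun _ : Fin d => Ioo (-(1 / 2 : ℝ)) (1 / 2)) := by
    ext y; simp [unitCell]
  have h2 : cube (fun _ : Fin d => -(1 / 2 : ℝ)) =
      ofLp ⁻¹' (univ.pi fun _ : Fin d => Ioc (-(1 / 2 : ℝ)) (1 / 2)) := by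
    ext y
    have h : -(1 / 2) + 1 = (1 / 2 : ℝ) := by norm_num
    simp only [cube, h, mem_ofPred_eq, mem_preimage, mem_univ_pi]
  rw [h1, h2]
  exact (PiLp.volume_preserving_ofLp (Fin d)).quasiMeasurePreserving.preimage_ae_eq
    Measure.univ_pi_Ioo_ae_eq_Icc |>.trans
      ((PiLp.volume_preserving_ofLp (Fin d)).quasiMeasurePreserving.preimage_ae_eq
    Measure.univ_pi_Ioc_ae_eq_Icc).symm

/-- The vector of integers `n`, as a point of `ℝ^d`. -/
def shift {d : ℕ} (n : Fin d → ℤ) : E d := toLp 2 fun i => (n i : ℝ)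

@[simp] theorem shift_apply {d : ℕ} (n : Fin d → ℤ) (i : Fin d) : shift n i = n i := rfl

/-- The nearest lattice point. -/
noncomputable def latticePt {d : ℕ} (y : E d) : Fin d → ℤ := fun i => round (y i)

/-- The representative of `y` modulo `ℤ^d` in the half-open cell `[-1/2, 1/2)^d`. -/
noncomputable def cellRep {d : ℕ} (y : E d) : E d := y - shift (latticePt y)

theorem cellRep_add_shift {d : ℕ} (y : E d) (n : Fin d → ℤ) :
    cellRep (y + shift n) = cellRep y := by
  ext i
  simp [cellRep, latticePt]

theorem IsPeriodic.apply_cellRep {d : ℕ} {V : Type*} {f : E d → V} (hf : IsPeriodic f) (y : E d) :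
    f (cellRep y) = f y := by
  have := hf (latticePt y) (cellRep y)
  rw [← this]
  congr 1
  simp [cellRep, shift]

theorem norm_ofLp_cellRep_le {d : ℕ} (y : E d) : ‖ofLp (cellRep y)‖ ≤ 1 / 2 := by
  rw [pi_norm_le_iff_of_nonneg (by norm_num)]
  intro i
  exact abs_sub_round (y i)

theorem norm_cellRep_le {d : ℕ} (y : E d) : ‖cellRep y‖ ≤ Real.sqrt d := by
  rw [EuclideanSpace.norm_eq]
  apply Real.sqrt_le_sqrt
  calc ∑ i, ‖cellRep y i‖ ^ 2 ≤ ∑ _i : Fin d, (1 : ℝ) := by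
        refine Finset.sum_le_sum fun i _ => ?_
        have h := (norm_le_pi_norm (ofLp (cellRep y)) i).trans (norm_ofLp_cellRep_le y)
        have h0 := norm_nonneg (cellRep y i)
        nlinarith
    _ = d := by simp

theorem cellRep_eq_self {d : ℕ} {y : E d} (hy : y ∈ unitCell d) : cellRep y = y := by
  have : latticePt y = 0 := by
    ext i
    exact round_eq_zero_iff.2 ⟨(hy i).1.le, (hy i).2⟩
  ext i
  simp [cellRep, this]

/-- A continuous periodic function is bounded. -/
theorem IsPeriodic.exists_bound {d : ℕ} {V : Type*} [NormedAddCommGroup V] {f : E d → V}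
    (hf : IsPeriodic f) (hc : Continuous f) : ∃ C, 0 ≤ C ∧ ∀ y, ‖f y‖ ≤ C := by
  obtain ⟨C, hC⟩ := (isCompact_closedBall (0 : E d) (Real.sqrt d)).exists_bound_of_continuousOn
    hc.continuousOn
  refine ⟨C, (norm_nonneg _).trans (hC 0 (by simp)), fun y => ?_⟩
  rw [← hf.apply_cellRep y]
  exact hC _ (by simpa using norm_cellRep_le y)

theorem isPeriodic_fderiv {d : ℕ} {V : Type*} [NormedAddCommGroup V] [NormedSpace ℝ V]
    {f : E d → V} (hf : IsPeriodic f) : IsPeriodic (fderiv ℝ f) := by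
  intro n y
  rw [← fderiv_comp_add_right]
  congr 1
  funext z
  exact hf n z

theorem IsPeriodic.exists_lipschitzWith {d : ℕ} {V : Type*} [NormedAddCommGroup V]
    [NormedSpace ℝ V] {f : E d → V} (hf : IsPeriodic f) (hc : ContDiff ℝ 1 f) :
    ∃ C : ℝ≥0, LipschitzWith C f := by
  obtain ⟨C, hC0, hC⟩ := (isPeriodic_fderiv hf).exists_bound (hc.continuous_fderiv (by simp))
  exact ⟨⟨C, hC0⟩, lipschitzWith_of_nnnorm_fderiv_le (hc.differentiable (by simp)) hC⟩

/-- The integral of a periodic function over a unit cube does not depend on the cube. -/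
theorem IsPeriodic.setIntegral_cube {d : ℕ} {V : Type*} [NormedAddCommGroup V] [NormedSpace ℝ V]
    {f : E d → V} (hf : IsPeriodic f) (a : Fin d → ℝ) :
    ∫ y in cube a, f y = ∫ y in unitCell d, f y := by
  have key : ∀ b : Fin d → ℝ, ∫ y in cube b, f y =
      ∫ x : UnitAddTorus (Fin d), f (toLp 2 fun i => (AddCircle.equivIoc 1 0 (x i)).1) := by
    intro b
    have h0 := UnitAddTorus.integral_preimage
      (fun x => f (toLp 2 fun i => (AddCircle.equivIoc 1 0 (x i)).1)) b
    rw [h0]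
    have h1 := (PiLp.volume_preserving_ofLp (Fin d)).setIntegral_preimage_emb
      (MeasurableEquiv.toLp 2 (Fin d → ℝ)).symm.measurableEmbedding
      (fun x => f (toLp 2 x)) {x : Fin d → ℝ | ∀ i, x i ∈ Ioc (b i) (b i + 1)}
    have h2 : ∫ y in cube b, f y = ∫ x in {x : Fin d → ℝ | ∀ i, x i ∈ Ioc (b i) (b i + 1)},
        f (toLp 2 x) := h1
    rw [h2]
    congr 1
    funext x
    have hx : ∀ i, ∃ n : ℤ, (AddCircle.equivIoc (1 : ℝ) 0 ((x i : ℝ) : UnitAddCircle)).1 =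
        x i + n := by
      intro i
      have := (AddCircle.coe_eq_coe_iff_of_mem_Ioc
        (p := (1 : ℝ)) (a := 0) (x := toIocMod one_pos 0 (x i))
        (y := (AddCircle.equivIoc (1 : ℝ) 0 ((x i : ℝ) : UnitAddCircle)).1)
        (by simpa using toIocMod_mem_Ioc one_pos (0 : ℝ) (x i)) (by
          simpa using (AddCircle.equivIoc (1 : ℝ) 0 ((x i : ℝ) : UnitAddCircle)).2)).1 (by
          rw [AddCircle.coe_equivIoc]
          rw [← self_sub_toIocDiv_zsmul]
          simp)
      rw [← this]
      refine ⟨-toIocDiv one_pos 0 (x i), ?_⟩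
      rw [← self_sub_toIocDiv_zsmul]
      simp [sub_eq_add_neg]
    choose n hn using hx
    rw [← hf n (toLp 2 x)]
    congr 1
    ext i
    simp [hn]
  rw [key a, ← key (fun _ => -(1 / 2)), setIntegral_congr_set (unitCell_ae_eq_cube d)]

/-- Integrals over the cell are invariant under translation of a periodic function. -/
theorem IsPeriodic.setIntegral_add {d : ℕ} {V : Type*} [NormedAddCommGroup V] [NormedSpace ℝ V]
    {f : E d → V} (hf : IsPeriodic f) (h : E d) :
    ∫ y in unitCell d, f (y + h) = ∫ y in unitCell d, f y := by
  rw [setIntegral_congr_set (unitCell_ae_eq_cube d)]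
  have h1 := (measurePreserving_add_right (volume : Measure (E d)) h).setIntegral_preimage_emb
    (MeasurableEquiv.addRight h).measurableEmbedding f (cube fun i => -(1 / 2) + h i)
  have h2 : (fun y => y + h) ⁻¹' (cube fun i => -(1 / 2) + h i) =
      cube (fun _ : Fin d => -(1 / 2 : ℝ)) := by
    ext y
    simp only [cube, mem_preimage, mem_ofPred_eq, PiLp.add_apply, mem_Ioc]
    refine forall_congr' fun i => ⟨fun H => ⟨?_, ?_⟩, fun H => ⟨?_, ?_⟩⟩ <;> linarith [H.1, H.2]
  rw [← h2, h1, hf.setIntegral_cube]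

/-- The derivatives of a periodic function have mean zero. -/
theorem IsPeriodic.setIntegral_fderiv {d : ℕ} {f : E d → ℝ} (hf : IsPeriodic f)
    (hc : ContDiff ℝ 1 f) (e : E d) : ∫ y in unitCell d, fderiv ℝ f y e = 0 := by
  obtain ⟨C, hC0, hC⟩ := (isPeriodic_fderiv hf).exists_bound (hc.continuous_fderiv (by simp))
  have hd := hasDerivAt_integral_of_dominated_loc_of_deriv_le (μ := cellMeasure d) (𝕜 := ℝ)
    (F := fun t y => f (y + t • e)) (F' := fun t y => fderiv ℝ f (y + t • e) e)
    (x₀ := 0) (s := univ) (bound := fun _ => C * ‖e‖) univ_mem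
    (Eventually.of_forall fun t => by
      have := hc.continuous
      exact Continuous.aestronglyMeasurable (by fun_prop))
    (by
      obtain ⟨B, _, hB⟩ := hf.exists_bound hc.continuous
      have := hc.continuous
      exact Integrable.of_bound (Continuous.aestronglyMeasurable (by fun_prop)) B
        (Eventually.of_forall fun y => hB _))
    (by
      have := hc.continuous_fderiv (by simp)
      exact Continuous.aestronglyMeasurable (by fun_prop))
    (Eventually.of_forall fun y t _ => ContinuousLinearMap.le_of_opNorm_le _ (hC _) _)
    (integrable_const _)
    (Eventually.of_forall fun y t _ => by
      have h1 : HasFDerivAt f (fderiv ℝ f (y + t • e)) (y + t • e) :=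
        (hc.differentiable (by simp) _).hasFDerivAt
      have h2 : HasDerivAt (fun t : ℝ => y + t • e) e t := by
        simpa using ((hasDerivAt_id t).smul_const e).const_add y
      exact h1.comp_hasDerivAt t h2)
  have h3 : (fun t : ℝ => ∫ y in unitCell d, f (y + t • e)) = fun _ => ∫ y in unitCell d, f y :=
    funext fun t => hf.setIntegral_add _
  have := hd.2
  rw [h3] at this
  simpa using this.unique (hasDerivAt_const _ _)

/-! ### Periodization -/

/-- The periodic function that agrees with `f` on the cell. -/
noncomputable def periodize {d : ℕ} {V : Type*} (f : E d → V) : E d → V := fun y => f (cellRep y)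

theorem isPeriodic_periodize {d : ℕ} {V : Type*} (f : E d → V) : IsPeriodic (periodize f) :=
  fun n y => congrArg f (cellRep_add_shift y n)

theorem periodize_eq {d : ℕ} {V : Type*} (f : E d → V) {y : E d} (hy : y ∈ unitCell d) :
    periodize f y = f y := by
  rw [periodize, cellRep_eq_self hy]

theorem continuous_norm_cellRep_apply {d : ℕ} (i : Fin d) :
    Continuous fun y : E d => ‖cellRep y i‖ := by
  have : (fun y : E d => ‖cellRep y i‖) = fun y : E d => ‖((y i : ℝ) : UnitAddCircle)‖ := by
    funext y
    rw [UnitAddCircle.norm_eq]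
    rfl
  rw [this]
  exact continuous_norm.comp (AddCircle.continuous_mk' 1 |>.comp (by fun_prop))

theorem cellRep_eventuallyEq {d : ℕ} {y : E d} (hy : ∀ i, ‖cellRep y i‖ < 1 / 2) :
    ∀ᶠ z in 𝓝 y, cellRep z = z - shift (latticePt y) := by
  have h1 : ∀ᶠ z in 𝓝 y, ∀ i, |z i - (latticePt y i : ℝ)| < 1 / 2 := by
    refine eventually_all.2 fun i => ?_
    have hc : Continuous fun z : E d => |z i - (latticePt y i : ℝ)| := by fun_prop
    exact hc.continuousAt.eventually_lt continuousAt_const (hy i)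
  filter_upwards [h1] with z hz
  have : latticePt z = latticePt y := by
    ext i
    have h := abs_lt.1 (hz i)
    exact round_eq_iff.2 ⟨by linarith, by linarith⟩
  rw [cellRep, this]

/-- Periodization preserves smoothness: as the support of `f` stays away from the boundary of the
cell, the periodization vanishes near every translate of that boundary. -/
theorem contDiff_periodize {d : ℕ} {V : Type*} [NormedAddCommGroup V] [NormedSpace ℝ V]
    {f : E d → V} {k : WithTop ℕ∞} (hf : ContDiff ℝ k f) (hK : HasCompactSupport f)
    (hs : tsupport f ⊆ unitCell d) : ContDiff ℝ k (periodize f) := by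
  obtain ⟨r, hr, hKr⟩ := IsCompact.exists_forall_le' hK (f := fun y : E d => -‖ofLp y‖)
    (a := -(1 / 2)) (by fun_prop) (fun y hy => neg_lt_neg (mem_unitCell_iff.1 (hs hy)))
  rw [contDiff_iff_contDiffAt]
  intro y
  by_cases hy : ∀ i, ‖cellRep y i‖ < 1 / 2
  · have h1 : periodize f =ᶠ[𝓝 y] fun z => f (z - shift (latticePt y)) := by
      filter_upwards [cellRep_eventuallyEq hy] with z hz
      rw [periodize, hz]
    refine ContDiffAt.congr_of_eventuallyEq ?_ h1
    exact (hf.comp (contDiff_id.sub contDiff_const)).contDiffAt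
  · push Not at hy
    obtain ⟨i, hi⟩ := hy
    have h1 : periodize f =ᶠ[𝓝 y] fun _ => 0 := by
      filter_upwards [(continuous_const (y := -r)).continuousAt.eventually_lt
        (continuous_norm_cellRep_apply i).continuousAt (lt_of_lt_of_le (by linarith) hi)] with z hz
      by_contra hne
      have h2 := hKr _ (subset_tsupport f hne)
      have h3 := norm_le_pi_norm (ofLp (cellRep z)) i
      linarith
    exact contDiffAt_const.congr_of_eventuallyEq h1

/-! ### The space `H¹(𝕋^d; ℝ^m)` -/

/-- The matrix of partial derivatives of `f`, as an element of `ℝ^{d × m}`. -/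
noncomputable def gradOf {d m : ℕ} (f : E d → E m) : E d → Grad d m :=
  fun y => toLp 2 fun p : Fin d × Fin m => fderiv ℝ f y (EuclideanSpace.single p.1 1) p.2

theorem gradOf_apply {d m : ℕ} (f : E d → E m) (y : E d) (i : Fin d) (β : Fin m) :
    gradOf f y (i, β) = fderiv ℝ f y (EuclideanSpace.single i 1) β := rfl

theorem norm_gradOf_le {d m : ℕ} (f : E d → E m) (y : E d) :
    ‖gradOf f y‖ ^ 2 ≤ (d * m : ℕ) * ‖fderiv ℝ f y‖ ^ 2 := by
  rw [EuclideanSpace.norm_sq_eq]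
  calc ∑ p, ‖gradOf f y p‖ ^ 2 ≤ ∑ _p : Fin d × Fin m, ‖fderiv ℝ f y‖ ^ 2 := by
        refine Finset.sum_le_sum fun p _ => ?_
        have h1 := PiLp.norm_apply_le (fderiv ℝ f y (EuclideanSpace.single p.1 1)) p.2
        have h2 := (fderiv ℝ f y).le_opNorm (EuclideanSpace.single p.1 1)
        simp only [PiLp.norm_single, norm_one, mul_one] at h2
        exact pow_le_pow_left₀ (norm_nonneg _) (h1.trans h2) 2
    _ = _ := by simp

theorem norm_fderiv_le_gradOf {d m : ℕ} (f : E d → E m) (y : E d) :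
    ‖fderiv ℝ f y‖ ≤ ‖gradOf f y‖ := by
  refine ContinuousLinearMap.opNorm_le_bound _ (norm_nonneg _) fun v => ?_
  have hv : v = ∑ i, v i • EuclideanSpace.single i (1 : ℝ) := by
    ext j
    simp [Pi.single_apply]
  have h1 : ∀ β, fderiv ℝ f y v β = ∑ i, v i * gradOf f y (i, β) := by
    intro β
    conv_lhs => rw [hv]
    simp [gradOf_apply]
  have h2 : ‖fderiv ℝ f y v‖ ^ 2 ≤ (‖gradOf f y‖ * ‖v‖) ^ 2 := by
    rw [mul_pow, EuclideanSpace.norm_sq_eq, EuclideanSpace.norm_sq_eq, EuclideanSpace.norm_sq_eq,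
      Fintype.sum_prod_type_right, Finset.sum_mul]
    refine Finset.sum_le_sum fun β _ => ?_
    rw [h1 β, Real.norm_eq_abs, sq_abs, mul_comm]
    simp only [Real.norm_eq_abs, sq_abs]
    exact Finset.sum_mul_sq_le_sq_mul_sq _ _ _
  exact (sq_le_sq₀ (norm_nonneg _) (by positivity)).1 h2

theorem continuous_gradOf {d m : ℕ} {f : E d → E m} (hf : ContDiff ℝ 1 f) :
    Continuous (gradOf f) := by
  have h := hf.continuous_fderiv (by simp)
  refine (PiLp.continuous_toLp 2 _).comp (continuous_pi fun p => ?_)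
  have : Continuous fun y => fderiv ℝ f y (EuclideanSpace.single p.1 1) := by fun_prop
  fun_prop

theorem measurable_gradOf {d m : ℕ} (f : E d → E m) : Measurable (gradOf f) := by
  refine (WithLp.measurable_toLp 2 _).comp (measurable_pi_lambda _ fun p => ?_)
  have h := measurable_fderiv_apply_const ℝ f (EuclideanSpace.single p.1 1)
  exact (EuclideanSpace.proj (𝕜 := ℝ) p.2).continuous.measurable.comp h

theorem isWeakGrad_congr {d m : ℕ} {u v : E d → E m} {F G : E d → Grad d m}
    (huv : u =ᵐ[cellMeasure d] v) (hFG : F =ᵐ[cellMeasure d] G) (h : IsWeakGrad u F) :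
    IsWeakGrad v G := by
  intro ϕ hϕ hp i β
  have e1 : ∫ y in unitCell d, v y β * fderiv ℝ ϕ y (EuclideanSpace.single i 1) =
      ∫ y in unitCell d, u y β * fderiv ℝ ϕ y (EuclideanSpace.single i 1) :=
    integral_congr_ae (by filter_upwards [huv] with y hy; rw [hy])
  have e2 : ∫ y in unitCell d, G y (i, β) * ϕ y = ∫ y in unitCell d, F y (i, β) * ϕ y :=
    integral_congr_ae (by filter_upwards [hFG] with y hy; rw [hy])
  rw [e1, e2]
  exact h ϕ hϕ hp i β

namespace H1

variable {d m : ℕ}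

/-- The element of `H¹(𝕋^d; ℝ^m)` given by a function and its weak gradient. -/
noncomputable def mk (u : E d → E m) (G : E d → Grad d m) (hu : MemLp u 2 (cellMeasure d))
    (hG : MemLp G 2 (cellMeasure d)) (h : IsWeakGrad u G) : H1 d m :=
  ⟨toLp 2 (hu.toLp u, hG.toLp G), isWeakGrad_congr hu.coeFn_toLp.symm hG.coeFn_toLp.symm h⟩

theorem fn_mk {u : E d → E m} {G : E d → Grad d m} (hu : MemLp u 2 (cellMeasure d))
    (hG : MemLp G 2 (cellMeasure d)) (h : IsWeakGrad u G) :
    (mk u G hu hG h).fn =ᵐ[cellMeasure d] u := hu.coeFn_toLp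

theorem grad_mk {u : E d → E m} {G : E d → Grad d m} (hu : MemLp u 2 (cellMeasure d))
    (hG : MemLp G 2 (cellMeasure d)) (h : IsWeakGrad u G) :
    (mk u G hu hG h).grad =ᵐ[cellMeasure d] G := hG.coeFn_toLp

theorem isWeakGrad (u : H1 d m) : IsWeakGrad u.fn u.grad := u.2

theorem memLp_fn (u : H1 d m) : MemLp u.fn 2 (cellMeasure d) := Lp.memLp _

theorem memLp_grad (u : H1 d m) : MemLp u.grad 2 (cellMeasure d) := Lp.memLp _

theorem fn_add (u v : H1 d m) : (u + v).fn =ᵐ[cellMeasure d] u.fn + v.fn := Lp.coeFn_add _ _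
theorem fn_sub (u v : H1 d m) : (u - v).fn =ᵐ[cellMeasure d] u.fn - v.fn := Lp.coeFn_sub _ _
theorem fn_smul (c : ℝ) (u : H1 d m) : (c • u).fn =ᵐ[cellMeasure d] c • u.fn := Lp.coeFn_smul _ _
theorem fn_zero : (0 : H1 d m).fn =ᵐ[cellMeasure d] 0 := Lp.coeFn_zero _ _ _
theorem grad_add (u v : H1 d m) : (u + v).grad =ᵐ[cellMeasure d] u.grad + v.grad :=
  Lp.coeFn_add _ _
theorem grad_sub (u v : H1 d m) : (u - v).grad =ᵐ[cellMeasure d] u.grad - v.grad :=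
  Lp.coeFn_sub _ _

/-- The inclusion `H¹ → L²`. -/
noncomputable def fnL : H1 d m →L[ℝ] L2 d m :=
  (WithLp.fstL 2 ℝ (L2 d m) (L2Grad d m)).comp (H1Submodule d m).subtypeL

/-- The weak gradient `H¹ → L²`. -/
noncomputable def gradL : H1 d m →L[ℝ] L2Grad d m :=
  (WithLp.sndL 2 ℝ (L2 d m) (L2Grad d m)).comp (H1Submodule d m).subtypeL

theorem coe_fnL (u : H1 d m) : (fnL u : E d → E m) = u.fn := rfl
theorem coe_gradL (u : H1 d m) : (gradL u : E d → Grad d m) = u.grad := rfl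

theorem inner_eq (u v : H1 d m) :
    inner ℝ u v = inner ℝ (fnL u) (fnL v) + inner ℝ (gradL u) (gradL v) := rfl

theorem norm_sq_eq (u : H1 d m) : ‖u‖ ^ 2 = ‖fnL u‖ ^ 2 + ‖gradL u‖ ^ 2 := by
  simp only [← real_inner_self_eq_norm_sq]
  exact inner_eq u u

end H1

/-- A continuous function times a basis vector, as an element of `L²` of the cell; the inner product
with it is a weighted mean of a coordinate. -/
noncomputable def testElem {d : ℕ} {ι : Type*} [Fintype ι] [DecidableEq ι] (f : E d → ℝ)
    (hf : Continuous f) (k : ι) : Lp (EuclideanSpace ℝ ι) 2 (cellMeasure d) :=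
  MemLp.toLp (fun y => f y • EuclideanSpace.single k (1 : ℝ)) (by
    obtain ⟨C, hC⟩ := (isCompact_closedBall (0 : E d) (Real.sqrt d)).exists_bound_of_continuousOn
      hf.continuousOn
    refine MemLp.of_bound (Continuous.aestronglyMeasurable (by fun_prop)) C ?_
    filter_upwards [ae_restrict_mem (measurableSet_unitCell d)] with y hy
    simpa [norm_smul] using hC y (unitCell_subset_closedBall d hy))

theorem inner_testElem {d : ℕ} {ι : Type*} [Fintype ι] [DecidableEq ι] (f : E d → ℝ)
    (hf : Continuous f) (k : ι) (u : Lp (EuclideanSpace ℝ ι) 2 (cellMeasure d)) :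
    inner ℝ (testElem f hf k) u = ∫ y in unitCell d, u y k * f y := by
  rw [L2.inner_def]
  refine integral_congr_ae ?_
  filter_upwards [MemLp.coeFn_toLp (μ := cellMeasure d) (p := 2)
    (f := fun y => f y • EuclideanSpace.single k (1 : ℝ)) _] with y hy
  rw [testElem, hy, inner_smul_left, EuclideanSpace.inner_single_left]
  simp [mul_comm]

theorem isClosed_H1Submodule (d m : ℕ) :
    IsClosed (H1Submodule d m : Set (WithLp 2 (L2 d m × L2Grad d m))) := by
  have : (H1Submodule d m : Set (WithLp 2 (L2 d m × L2Grad d m))) =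
      ⋂ (ϕ : E d → ℝ) (hϕ : ContDiff ℝ ((⊤ : ℕ∞) : WithTop ℕ∞) ϕ) (_ : IsPeriodic ϕ) (i : Fin d)
        (β : Fin m), {p | inner ℝ (testElem (fun y => fderiv ℝ ϕ y (EuclideanSpace.single i 1))
          ((hϕ.continuous_fderiv (by simp)).clm_apply continuous_const) β) p.fst =
            - inner ℝ (testElem ϕ hϕ.continuous (i, β)) p.snd} := by
    ext p
    simp only [mem_iInter, mem_ofPred_eq, inner_testElem]
    rfl
  rw [this]
  refine isClosed_iInter fun ϕ => isClosed_iInter fun hϕ => isClosed_iInter fun _ =>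
    isClosed_iInter fun i => isClosed_iInter fun β => isClosed_eq ?_ ?_
  · exact continuous_const.inner (WithLp.fstL 2 ℝ (L2 d m) (L2Grad d m)).continuous
  · exact (continuous_const.inner (WithLp.sndL 2 ℝ (L2 d m) (L2Grad d m)).continuous).neg

instance completeSpace_H1 (d m : ℕ) : CompleteSpace (H1 d m) :=
  (isClosed_H1Submodule d m).completeSpace_coe

/-- A function with zero averages against smooth compactly supported functions in the cell
vanishes; this is where periodization turns compactly supported test functions into periodic
ones. -/
theorem ae_eq_zero_of_forall_periodic {d : ℕ} {f : E d → ℝ} {U : Set (E d)} (hU : IsOpen U)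
    (hUY : U ⊆ unitCell d) (hf : Integrable f (cellMeasure d))
    (h : ∀ ϕ : E d → ℝ, ContDiff ℝ ((⊤ : ℕ∞) : WithTop ℕ∞) ϕ → IsPeriodic ϕ →
      (∀ y ∈ unitCell d, y ∉ U → ϕ y = 0) → ∫ y in unitCell d, f y * ϕ y = 0) :
    ∀ᵐ y ∂(volume : Measure (E d)), y ∈ U → f y = 0 := by
  refine hU.ae_eq_zero_of_integral_contDiff_smul_eq_zero
    ((IntegrableOn.mono_set hf hUY).locallyIntegrableOn) fun g hg hgK hgU => ?_
  have h1 : ∫ x, g x • f x = ∫ y in unitCell d, g y • f y := by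
    symm
    refine setIntegral_eq_integral_of_forall_compl_eq_zero fun y hy => ?_
    rw [image_eq_zero_of_notMem_tsupport fun h => hy (hUY (hgU h)), zero_smul]
  rw [h1, ← h (periodize g) (contDiff_periodize hg hgK (hgU.trans hUY)) (isPeriodic_periodize g)
    fun y hy hyU => by
      rw [periodize_eq g hy, image_eq_zero_of_notMem_tsupport fun h => hyU (hgU h)]]
  refine setIntegral_congr_fun (measurableSet_unitCell d) fun y hy => ?_
  simp only [periodize_eq g hy, smul_eq_mul, mul_comm]

theorem integrable_apply_of_memLp {d : ℕ} {ι : Type*} [Fintype ι]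
    {u : E d → EuclideanSpace ℝ ι} (hu : MemLp u 2 (cellMeasure d)) (k : ι) :
    Integrable (fun y => u y k) (cellMeasure d) :=
  (EuclideanSpace.proj k : EuclideanSpace ℝ ι →L[ℝ] ℝ).integrable_comp (hu.integrable (by norm_num))

/-- Two weak gradients of the same function agree. -/
theorem isWeakGrad_unique {d m : ℕ} {u : E d → E m} {F G : E d → Grad d m}
    (hF : MemLp F 2 (cellMeasure d)) (hG : MemLp G 2 (cellMeasure d))
    (h1 : IsWeakGrad u F) (h2 : IsWeakGrad u G) : F =ᵐ[cellMeasure d] G := by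
  have key : ∀ p : Fin d × Fin m, ∀ᵐ y ∂cellMeasure d, F y p = G y p := by
    rintro ⟨i, β⟩
    have hint := (integrable_apply_of_memLp hF (i, β)).sub (integrable_apply_of_memLp hG (i, β))
    have := ae_eq_zero_of_forall_periodic (isOpen_unitCell d) subset_rfl hint
      fun ϕ hϕ hp _ => ?_
    · filter_upwards [(ae_restrict_iff' (measurableSet_unitCell d)).2 this] with y hy
      exact sub_eq_zero.1 hy
    · have e := (h1 ϕ hϕ hp i β).symm.trans (h2 ϕ hϕ hp i β)
      have i1 := integrable_coord_mul (hF.toLp F) (i, β) hϕ.continuous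
      have i2 := integrable_coord_mul (hG.toLp G) (i, β) hϕ.continuous
      have i1' : Integrable (fun y => F y (i, β) * ϕ y) (cellMeasure d) :=
        i1.congr (by filter_upwards [hF.coeFn_toLp] with y hy; rw [hy])
      have i2' : Integrable (fun y => G y (i, β) * ϕ y) (cellMeasure d) :=
        i2.congr (by filter_upwards [hG.coeFn_toLp] with y hy; rw [hy])
      simp only [Pi.sub_apply, sub_mul]
      rw [integral_sub i1' i2', neg_injective e, sub_self]
  filter_upwards [ae_all_iff.2 key] with y hy
  ext p
  exact hy p

theorem H1.ext_fn {d m : ℕ} {u v : H1 d m} (h : u.fn =ᵐ[cellMeasure d] v.fn) : u = v := by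
  have hg : u.grad =ᵐ[cellMeasure d] v.grad :=
    isWeakGrad_unique u.memLp_grad v.memLp_grad
      (isWeakGrad_congr h (ae_eq_refl _) u.isWeakGrad) v.isWeakGrad
  have h1 : fnL u = fnL v := Lp.ext h
  have h2 : gradL u = gradL v := Lp.ext hg
  have : ‖u - v‖ ^ 2 = 0 := by
    rw [norm_sq_eq, map_sub, map_sub, h1, h2]
    simp
  exact sub_eq_zero.1 (norm_eq_zero.1 (by simpa using this))

/-! ### Smooth periodic functions and Lipschitz functions in `H¹` -/

theorem memLp_of_bound {d : ℕ} {V : Type*} [NormedAddCommGroup V] {f : E d → V}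
    (hf : AEStronglyMeasurable f (cellMeasure d)) {C : ℝ} (hC : ∀ y, ‖f y‖ ≤ C) :
    MemLp f 2 (cellMeasure d) :=
  MemLp.of_bound hf C (Eventually.of_forall hC)

theorem isPeriodic_gradOf {d m : ℕ} {f : E d → E m} (hf : IsPeriodic f) :
    IsPeriodic (gradOf f) := by
  intro n y
  ext p
  have := isPeriodic_fderiv hf n y
  simp only [gradOf, this]

theorem fderiv_coord {d m : ℕ} {f : E d → E m} {y : E d} (hf : DifferentiableAt ℝ f y) (e : E d)
    (β : Fin m) : fderiv ℝ (fun z => f z β) y e = fderiv ℝ f y e β := by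
  have := ((EuclideanSpace.proj (𝕜 := ℝ) β).hasFDerivAt.comp y hf.hasFDerivAt).fderiv
  have h2 : (fun z => f z β) = (EuclideanSpace.proj (𝕜 := ℝ) β) ∘ f := rfl
  rw [h2, this]
  rfl

theorem isWeakGrad_gradOf_of_isPeriodic {d m : ℕ} {f : E d → E m} (hf : IsPeriodic f)
    (hc : ContDiff ℝ 1 f) : IsWeakGrad f (gradOf f) := by
  intro ϕ hϕ hp i β
  have hc' : ContDiff ℝ 1 fun y => f y β := (EuclideanSpace.proj (𝕜 := ℝ) β).contDiff.comp hc
  have hϕ1 : ContDiff ℝ 1 ϕ := hϕ.of_le (by exact_mod_cast le_top)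
  have hper : IsPeriodic fun y => f y β * ϕ y := fun n y => by
    simp only [hf n y, hp n y]
  have h0 := hper.setIntegral_fderiv (hc'.mul hϕ1) (EuclideanSpace.single i 1)
  have hcu := hc.continuous_fderiv (by simp)
  have hcϕ := hϕ1.continuous_fderiv (by simp)
  have hfc := hc'.continuous
  have hϕc := hϕ1.continuous
  have e : ∀ y, fderiv ℝ (fun y => f y β * ϕ y) y (EuclideanSpace.single i 1) =
      f y β * fderiv ℝ ϕ y (EuclideanSpace.single i 1) + gradOf f y (i, β) * ϕ y := by
    intro y
    rw [fderiv_fun_mul (hc'.differentiable (by simp) y) (hϕ1.differentiable (by simp) y), gradOf_apply,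
      ← fderiv_coord (hc.differentiable (by simp) y)]
    simp [mul_comm]
  simp only [e] at h0
  have b1 : IsPeriodic fun y => f y β * fderiv ℝ ϕ y (EuclideanSpace.single i 1) := fun n y => by
    simp only [hf n y, isPeriodic_fderiv hp n y]
  have b2 : IsPeriodic fun y => gradOf f y (i, β) * ϕ y := fun n y => by
    simp only [isPeriodic_gradOf hf n y, hp n y]
  have c1 : Continuous fun y => f y β * fderiv ℝ ϕ y (EuclideanSpace.single i 1) := by fun_prop
  have c2 : Continuous fun y => gradOf f y (i, β) * ϕ y := by
    have := continuous_gradOf hc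
    fun_prop
  obtain ⟨B1, _, hB1⟩ := b1.exists_bound c1
  obtain ⟨B2, _, hB2⟩ := b2.exists_bound c2
  rw [integral_add (Integrable.of_bound c1.aestronglyMeasurable B1 (Eventually.of_forall hB1))
    (Integrable.of_bound c2.aestronglyMeasurable B2 (Eventually.of_forall hB2))] at h0
  linarith

/-- A `C¹` periodic function as an element of `H¹`. -/
noncomputable def H1.ofPeriodic {d m : ℕ} (f : E d → E m) (hf : IsPeriodic f)
    (hc : ContDiff ℝ 1 f) : H1 d m :=
  H1.mk f (gradOf f)
    (memLp_of_bound hc.continuous.aestronglyMeasurable (hf.exists_bound hc.continuous).choose_spec.2)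
    (memLp_of_bound (continuous_gradOf hc).aestronglyMeasurable
      ((isPeriodic_gradOf hf).exists_bound (continuous_gradOf hc)).choose_spec.2)
    (isWeakGrad_gradOf_of_isPeriodic hf hc)

theorem H1.fn_ofPeriodic {d m : ℕ} {f : E d → E m} (hf : IsPeriodic f) (hc : ContDiff ℝ 1 f) :
    (H1.ofPeriodic f hf hc).fn =ᵐ[cellMeasure d] f := H1.fn_mk _ _ _

theorem H1.grad_ofPeriodic {d m : ℕ} {f : E d → E m} (hf : IsPeriodic f) (hc : ContDiff ℝ 1 f) :
    (H1.ofPeriodic f hf hc).grad =ᵐ[cellMeasure d] gradOf f := H1.grad_mk _ _ _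

/-- By Rademacher's theorem, a Lipschitz function supported in the open cell has its pointwise
gradient as weak gradient. -/
theorem isWeakGrad_gradOf_of_lipschitz {d m : ℕ} {f : E d → E m} {C : ℝ≥0}
    (hf : LipschitzWith C f) (hK : HasCompactSupport f) (hs : tsupport f ⊆ unitCell d) :
    IsWeakGrad f (gradOf f) := by
  intro ϕ hϕ hp i β
  have hϕ1 : ContDiff ℝ 1 ϕ := hϕ.of_le (by exact_mod_cast le_top)
  obtain ⟨D, hD⟩ := hp.exists_lipschitzWith hϕ1
  have hsub : tsupport (fun y => f y β) ⊆ tsupport f :=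
    closure_mono fun y hy h => hy (by simp [h])
  have hβ : LipschitzWith C fun y => f y β := fun x y => by
    refine le_trans ?_ (hf x y)
    rw [edist_dist, edist_dist]
    apply ENNReal.ofReal_le_ofReal
    rw [dist_eq_norm, dist_eq_norm]
    exact PiLp.norm_apply_le (f x - f y) β
  have hKβ : HasCompactSupport fun y => f y β := hK.mono' (subset_tsupport _ |>.trans hsub)
  have h := LipschitzWith.integral_lineDeriv_mul_eq (μ := volume) hD hβ hKβ
    (EuclideanSpace.single i 1)
  have e1 : ∫ y in unitCell d, f y β * fderiv ℝ ϕ y (EuclideanSpace.single i 1) =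
      ∫ y, lineDeriv ℝ ϕ y (EuclideanSpace.single i 1) * f y β := by
    rw [setIntegral_eq_integral_of_forall_compl_eq_zero fun y hy => ?_]
    · refine integral_congr_ae (Eventually.of_forall fun y => ?_)
      simp only
      rw [(hϕ1.differentiable (by simp) y).lineDeriv_eq_fderiv, mul_comm]
    · rw [image_eq_zero_of_notMem_tsupport (fun h => hy (hs h))]
      simp
  have e2 : ∫ y in unitCell d, gradOf f y (i, β) * ϕ y =
      - ∫ y, lineDeriv ℝ (fun y => f y β) y (-EuclideanSpace.single i 1) * ϕ y := by
    rw [setIntegral_eq_integral_of_forall_compl_eq_zero fun y hy => ?_, ← integral_neg]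
    · refine integral_congr_ae ?_
      filter_upwards [hf.ae_differentiableAt] with y hy
      rw [lineDeriv_neg, gradOf_apply, ← fderiv_coord hy, DifferentiableAt.lineDeriv_eq_fderiv]
      · ring
      · exact (EuclideanSpace.proj (𝕜 := ℝ) β).differentiableAt.comp y hy
    · have : fderiv ℝ f y = 0 := by
        by_contra hne
        exact hy (hs (support_fderiv_subset ℝ hne))
      simp [gradOf_apply, this]
  rw [e1, h, e2, neg_neg]

/-- A Lipschitz function supported in the open cell, as an element of `H¹`. -/
noncomputable def H1.ofLipschitz {d m : ℕ} (f : E d → E m) (hf : ∃ C, LipschitzWith C f)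
    (hK : HasCompactSupport f) (hs : tsupport f ⊆ unitCell d) : H1 d m :=
  H1.mk f (gradOf f)
    (memLp_of_bound hf.choose_spec.continuous.aestronglyMeasurable
      (hK.exists_bound_of_continuous hf.choose_spec.continuous).choose_spec)
    (memLp_of_bound (C := Real.sqrt ((d * m : ℕ) * hf.choose ^ 2))
      (measurable_gradOf f).aestronglyMeasurable fun y =>
        Real.le_sqrt_of_sq_le ((norm_gradOf_le f y).trans (by
          have := norm_fderiv_le_of_lipschitz ℝ (x₀ := y) hf.choose_spec
          gcongr)))
    (isWeakGrad_gradOf_of_lipschitz hf.choose_spec hK hs)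

theorem H1.fn_ofLipschitz {d m : ℕ} {f : E d → E m} (hf : ∃ C, LipschitzWith C f)
    (hK : HasCompactSupport f) (hs : tsupport f ⊆ unitCell d) :
    (H1.ofLipschitz f hf hK hs).fn =ᵐ[cellMeasure d] f := H1.fn_mk _ _ _

theorem H1.grad_ofLipschitz {d m : ℕ} {f : E d → E m} (hf : ∃ C, LipschitzWith C f)
    (hK : HasCompactSupport f) (hs : tsupport f ⊆ unitCell d) :
    (H1.ofLipschitz f hf hK hs).grad =ᵐ[cellMeasure d] gradOf f := H1.grad_mk _ _ _

/-! ### Fourier series on the cell -/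

/-- The phase `2π k · y`. -/
noncomputable def phase {d : ℕ} (k : Fin d → ℤ) (y : E d) : ℝ := 2 * Real.pi * ∑ i, k i * y i

theorem contDiff_phase {d : ℕ} (k : Fin d → ℤ) {n : WithTop ℕ∞} : ContDiff ℝ n (phase k) := by
  unfold phase
  fun_prop

theorem phase_add_shift {d : ℕ} (k n : Fin d → ℤ) (y : E d) :
    phase k (y + shift n) = phase k y + (∑ i, k i * n i : ℤ) * (2 * Real.pi) := by
  simp only [phase, PiLp.add_apply, shift_apply, mul_add, Finset.sum_add_distrib]
  push_cast
  ring

theorem isPeriodic_cos_phase {d : ℕ} (k : Fin d → ℤ) :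
    IsPeriodic fun y : E d => Real.cos (phase k y) := fun n y => by
  change Real.cos (phase k (y + shift n)) = _
  rw [phase_add_shift, Real.cos_add_int_mul_two_pi]

theorem isPeriodic_sin_phase {d : ℕ} (k : Fin d → ℤ) :
    IsPeriodic fun y : E d => Real.sin (phase k y) := fun n y => by
  change Real.sin (phase k (y + shift n)) = _
  rw [phase_add_shift, Real.sin_add_int_mul_two_pi]

theorem hasFDerivAt_phase {d : ℕ} (k : Fin d → ℤ) (y : E d) :
    HasFDerivAt (phase k) ((2 * Real.pi) • ∑ i, (k i : ℝ) • EuclideanSpace.proj (𝕜 := ℝ) i) y := by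
  have : phase k = ((2 * Real.pi) • ∑ i, (k i : ℝ) • EuclideanSpace.proj (𝕜 := ℝ) i :
      E d →L[ℝ] ℝ) := by
    funext z
    simp [phase]
  rw [this]
  exact ContinuousLinearMap.hasFDerivAt _

theorem fderiv_cos_phase {d : ℕ} (k : Fin d → ℤ) (y : E d) (i : Fin d) :
    fderiv ℝ (fun y : E d => Real.cos (phase k y)) y (EuclideanSpace.single i 1) =
      -(2 * Real.pi * k i) * Real.sin (phase k y) := by
  rw [(hasFDerivAt_phase k y).cos.fderiv]
  simp
  ring

theorem fderiv_sin_phase {d : ℕ} (k : Fin d → ℤ) (y : E d) (i : Fin d) :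
    fderiv ℝ (fun y : E d => Real.sin (phase k y)) y (EuclideanSpace.single i 1) =
      (2 * Real.pi * k i) * Real.cos (phase k y) := by
  rw [(hasFDerivAt_phase k y).sin.fderiv]
  simp
  ring

theorem mFourier_neg_apply {d : ℕ} (k : Fin d → ℤ) (y : E d) :
    UnitAddTorus.mFourier (-k) (fun i => (y i : UnitAddCircle)) =
      Real.cos (phase k y) - Real.sin (phase k y) * Complex.I := by
  have : UnitAddTorus.mFourier (-k) (fun i => (y i : UnitAddCircle)) =
      Complex.exp ((-phase k y : ℝ) * Complex.I) := by
    simp only [UnitAddTorus.mFourier, ContinuousMap.coe_mk, fourier_coe_apply, phase,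
      ← Complex.exp_sum]
    congr 1
    push_cast
    rw [Finset.mul_sum, ← Finset.sum_neg_distrib, Finset.sum_mul]
    refine Finset.sum_congr rfl fun i _ => ?_
    simp
    ring
  rw [this, Complex.exp_mul_I, ← Complex.ofReal_cos, ← Complex.ofReal_sin, Real.cos_neg,
    Real.sin_neg]
  push_cast
  ring

/-- The squared modulus of the `k`-th Fourier coefficient of `f`. -/
noncomputable def fourierSq {d : ℕ} (f : E d → ℝ) (k : Fin d → ℤ) : ℝ :=
  (∫ y in unitCell d, f y * Real.cos (phase k y)) ^ 2 +
    (∫ y in unitCell d, f y * Real.sin (phase k y)) ^ 2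

theorem fourierSq_nonneg {d : ℕ} (f : E d → ℝ) (k : Fin d → ℤ) : 0 ≤ fourierSq f k := by
  unfold fourierSq; positivity

/-- The point of the cell representing a point of the torus. -/
noncomputable def torusSection {d : ℕ} (x : UnitAddTorus (Fin d)) : E d :=
  toLp 2 fun i => (AddCircle.equivIoc 1 (-(1 / 2)) (x i)).1

theorem measurePreserving_torusSection (d : ℕ) :
    MeasurePreserving (torusSection (d := d)) volume (cellMeasure d) := by
  have h1 := UnitAddTorus.measurePreserving_equivPiIoc (d := Fin d) (fun _ => -(1 / 2 : ℝ))
  have h2 : MeasurableSet {x : Fin d → ℝ | ∀ i, x i ∈ Ioc (-(1 / 2 : ℝ)) (-(1 / 2) + 1)} :=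
    MeasurableSet.univ_pi' fun _ => measurableSet_Ioc
  have h3 := measurePreserving_subtype_coe (μa := volume) h2
  have h4 := (PiLp.volume_preserving_toLp (Fin d)).restrict_preimage
    (s := cube fun _ : Fin d => -(1 / 2 : ℝ))
    (((PiLp.volume_preserving_ofLp (Fin d)).measurable h2))
  rw [← Measure.restrict_congr_set (unitCell_ae_eq_cube d)] at h4
  exact h4.comp (h3.comp h1)

theorem coe_torusSection {d : ℕ} (x : UnitAddTorus (Fin d)) :
    (fun i => (torusSection x i : UnitAddCircle)) = x := by
  funext i
  exact AddCircle.coe_equivIoc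

theorem integral_torusSection {d : ℕ} {V : Type*} [NormedAddCommGroup V] [NormedSpace ℝ V]
    {g : E d → V} (hg : AEStronglyMeasurable g (cellMeasure d)) :
    ∫ x, g (torusSection x) = ∫ y in unitCell d, g y := by
  have hs := measurePreserving_torusSection d
  rw [← integral_map hs.measurable.aemeasurable (by rwa [hs.map_eq]), hs.map_eq]

/-- **Parseval's identity** on the cell. -/
theorem hasSum_fourierSq {d : ℕ} {f : E d → ℝ} (hf : MemLp f 2 (cellMeasure d)) :
    HasSum (fourierSq f) (∫ y in unitCell d, f y ^ 2) := by
  have hs := measurePreserving_torusSection d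
  have hfc : MemLp (fun y => (f y : ℂ)) 2 (cellMeasure d) := hf.ofReal
  have hF : MemLp (fun x => (f (torusSection x) : ℂ)) 2 volume :=
    hfc.comp_measurePreserving hs
  have h := UnitAddTorus.hasSum_sq_mFourierCoeff (hF.toLp _)
  have e1 : ∫ t, ‖hF.toLp _ t‖ ^ 2 = ∫ y in unitCell d, f y ^ 2 := by
    have h1 : ∫ t, ‖hF.toLp _ t‖ ^ 2 = ∫ t, f (torusSection t) ^ 2 := by
      refine integral_congr_ae ?_
      filter_upwards [hF.coeFn_toLp] with t ht
      rw [ht]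
      simp
    rw [h1]
    exact integral_torusSection (g := fun y => f y ^ 2) (hf.1.pow 2)
  have e2 : ∀ k, ‖UnitAddTorus.mFourierCoeff (hF.toLp _) k‖ ^ 2 = fourierSq f k := by
    intro k
    have hint : Integrable f (cellMeasure d) := hf.integrable (by norm_num)
    have hc := (contDiff_phase (n := 0) k).continuous
    have i1 : Integrable (fun y => f y * Real.cos (phase k y)) (cellMeasure d) :=
      hint.mul_bdd (c := 1) (Continuous.aestronglyMeasurable (by fun_prop))
        (Eventually.of_forall fun y => by simpa using Real.abs_cos_le_one _)
    have i2 : Integrable (fun y => f y * Real.sin (phase k y)) (cellMeasure d) :=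
      hint.mul_bdd (c := 1) (Continuous.aestronglyMeasurable (by fun_prop))
        (Eventually.of_forall fun y => by simpa using Real.abs_sin_le_one _)
    have h1 : UnitAddTorus.mFourierCoeff (hF.toLp _) k =
        ∫ x : UnitAddTorus (Fin d), (fun y => ((f y * Real.cos (phase k y) : ℝ) : ℂ) -
          ((f y * Real.sin (phase k y) : ℝ) : ℂ) * Complex.I) (torusSection x) := by
      refine integral_congr_ae ?_
      filter_upwards [hF.coeFn_toLp] with x hx
      have h0 := mFourier_neg_apply k (torusSection x)
      rw [coe_torusSection] at h0
      rw [hx, h0, smul_eq_mul]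
      push_cast
      ring
    have j1 : Integrable (fun y => ((f y * Real.cos (phase k y) : ℝ) : ℂ)) (cellMeasure d) :=
      i1.ofReal
    have j2 : Integrable (fun y => ((f y * Real.sin (phase k y) : ℝ) : ℂ) * Complex.I)
      (cellMeasure d) := i2.ofReal.mul_const _
    rw [h1.trans (integral_torusSection (j1.sub j2).1)]
    simp only [Pi.sub_apply]
    rw [integral_sub j1 j2, integral_mul_const, integral_complex_ofReal, integral_complex_ofReal,
      Complex.sq_norm, Complex.normSq_apply]
    simp [fourierSq]
    ring
  rw [e1] at h
  simpa only [e2] using h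

/-- The weak derivative in the direction `i` multiplies the Fourier coefficients by `2πi k_i`. -/
theorem fourierSq_grad {d m : ℕ} {u : E d → E m} {G : E d → Grad d m} (h : IsWeakGrad u G)
    (k : Fin d → ℤ) (i : Fin d) (β : Fin m) :
    fourierSq (fun y => G y (i, β)) k = (2 * Real.pi * k i) ^ 2 * fourierSq (fun y => u y β) k := by
  have h1 := h _ (Real.contDiff_cos.comp (contDiff_phase k)) (isPeriodic_cos_phase k) i β
  have h2 := h _ (Real.contDiff_sin.comp (contDiff_phase k)) (isPeriodic_sin_phase k) i β
  simp only [Function.comp_def, fderiv_cos_phase, fderiv_sin_phase] at h1 h2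
  have e1 : ∫ y in unitCell d, u y β * (-(2 * Real.pi * k i) * Real.sin (phase k y)) =
      -(2 * Real.pi * k i) * ∫ y in unitCell d, u y β * Real.sin (phase k y) := by
    rw [← integral_const_mul]
    congr 1; funext y; ring
  have e2 : ∫ y in unitCell d, u y β * (2 * Real.pi * k i * Real.cos (phase k y)) =
      (2 * Real.pi * k i) * ∫ y in unitCell d, u y β * Real.cos (phase k y) := by
    rw [← integral_const_mul]
    congr 1; funext y; ring
  rw [e1] at h1
  rw [e2] at h2
  have h1' := neg_eq_iff_eq_neg.2 h1
  have h2' := neg_eq_iff_eq_neg.2 h2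
  simp only [fourierSq]
  rw [← neg_neg (∫ y in unitCell d, G y (i, β) * Real.cos (phase k y)), ← h1,
    ← neg_neg (∫ y in unitCell d, G y (i, β) * Real.sin (phase k y)), ← h2]
  ring

theorem memLp_apply {d : ℕ} {ι : Type*} [Fintype ι]
    {u : E d → EuclideanSpace ℝ ι} (hu : MemLp u 2 (cellMeasure d)) (k : ι) :
    MemLp (fun y => u y k) 2 (cellMeasure d) :=
  (EuclideanSpace.proj k : EuclideanSpace ℝ ι →L[ℝ] ℝ).comp_memLp' hu

theorem norm_sq_L2 {d : ℕ} {ι : Type*} [Fintype ι]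
    (u : Lp (EuclideanSpace ℝ ι) 2 (cellMeasure d)) :
    ‖u‖ ^ 2 = ∑ k, ∫ y in unitCell d, u y k ^ 2 := by
  rw [← real_inner_self_eq_norm_sq, L2.inner_def, ← integral_finsetSum]
  · refine integral_congr_ae (Eventually.of_forall fun y => ?_)
    simp only
    rw [real_inner_self_eq_norm_sq, EuclideanSpace.real_norm_sq_eq]
  · intro k _
    exact (memLp_apply (Lp.memLp u) k).integrable_sq

/-- A quantitative form of the Rellich theorem on the torus: the part of the `L²` norm carried by
the frequencies outside a finite set is controlled by the gradient. -/
theorem norm_fnL_sq_le {d m : ℕ} (u : H1 d m) (F : Finset (Fin d → ℤ)) {ε : ℝ} (hε : 0 ≤ ε)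
    (hF : ∀ k ∉ F, 1 ≤ ε * ∑ i, (2 * Real.pi * k i) ^ 2) :
    ‖H1.fnL u‖ ^ 2 ≤ ∑ β, ∑ k ∈ F, fourierSq (fun y => u.fn y β) k + ε * ‖H1.gradL u‖ ^ 2 := by
  rw [norm_sq_L2, norm_sq_L2, Fintype.sum_prod_type_right, Finset.mul_sum, ← Finset.sum_add_distrib]
  refine Finset.sum_le_sum fun β _ => ?_
  have h1 := hasSum_fourierSq (memLp_apply u.memLp_fn β)
  have h2 : HasSum (fun k => ε * ∑ i, fourierSq (fun y => u.grad y (i, β)) k)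
      (ε * ∑ i, ∫ y in unitCell d, u.grad y (i, β) ^ 2) :=
    (hasSum_sum fun i _ => hasSum_fourierSq (memLp_apply u.memLp_grad (i, β))).mul_left ε
  have h3 : HasSum (fun k => if k ∈ F then fourierSq (fun y => u.fn y β) k else 0)
      (∑ k ∈ F, fourierSq (fun y => u.fn y β) k) := by
    rw [← Finset.sum_congr rfl fun k (hk : k ∈ F) =>
      if_pos (α := ℝ) (t := fourierSq (fun y => u.fn y β) k) (e := 0) hk]
    exact hasSum_sum_of_ne_finset_zero fun k hk => if_neg hk
  refine hasSum_le (fun k => ?_) h1 (h3.add h2)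
  have hnn := fourierSq_nonneg (fun y => u.fn y β) k
  have e : ε * ∑ i, fourierSq (fun y => u.grad y (i, β)) k =
      (ε * ∑ i, (2 * Real.pi * k i) ^ 2) * fourierSq (fun y => u.fn y β) k := by
    rw [mul_assoc, Finset.sum_mul]
    simp only [fourierSq_grad u.isWeakGrad]
  rw [e]
  by_cases hk : k ∈ F
  · simp only [hk, if_true]
    have : 0 ≤ ε * ∑ i, (2 * Real.pi * (k i : ℝ)) ^ 2 := by positivity
    nlinarith
  · simp only [hk, if_false, zero_add]
    nlinarith [hF k hk]

theorem sq_le_sum_sq_frequency {d : ℕ} {k : Fin d → ℤ} {N : ℕ} {i : Fin d} (hi : (N : ℤ) < |k i|) :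
    ((N : ℝ) + 1) ^ 2 ≤ ∑ i, (2 * Real.pi * k i) ^ 2 := by
  have h1 : (N : ℝ) + 1 ≤ |(k i : ℝ)| := by exact_mod_cast hi
  have hpi := Real.pi_gt_three
  calc ((N : ℝ) + 1) ^ 2 ≤ (2 * Real.pi * k i) ^ 2 := by
        rw [sq_le_sq, abs_mul, abs_of_pos (by positivity : (0 : ℝ) < 2 * Real.pi),
          abs_of_pos (by positivity : (0 : ℝ) < (N : ℝ) + 1)]
        nlinarith [abs_nonneg (k i : ℝ)]
    _ ≤ _ := Finset.single_le_sum (f := fun i => (2 * Real.pi * (k i : ℝ)) ^ 2)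
        (fun j _ => sq_nonneg _) (Finset.mem_univ i)

/-- **Poincaré's inequality** on the torus. -/
theorem norm_fnL_le_of_meanZero {d m : ℕ} (u : H1 d m) (hu : u.MeanZero) :
    ‖H1.fnL u‖ ^ 2 ≤ ‖H1.gradL u‖ ^ 2 := by
  have h := norm_fnL_sq_le u {0} zero_le_one fun k hk => by
    have : k ≠ 0 := by simpa using hk
    obtain ⟨i, hi⟩ := Function.ne_iff.1 this
    have := sq_le_sum_sq_frequency (k := k) (N := 0) (i := i) (by simpa using hi)
    simpa using this
  have h0 : ∀ β, ∫ y in unitCell d, u.fn y β = 0 := fun β => by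
    have h1 := (EuclideanSpace.proj (𝕜 := ℝ) β).integral_comp_comm
      (u.memLp_fn.integrable (by norm_num) : Integrable u.fn (cellMeasure d))
    have h2 : ∫ y in unitCell d, u.fn y = 0 := hu
    rw [h2, map_zero] at h1
    exact h1
  simpa [fourierSq, phase, h0] using h

/-- The inclusion `H¹ → L²` is compact, in the following form: up to a small multiple of the `H¹`
norm, the `L²` norm is controlled by finitely many linear functionals. -/
theorem exists_finite_functionals (d m : ℕ) {ε : ℝ} (hε : 0 < ε) :
    ∃ (n : ℕ) (l : H1 d m →L[ℝ] EuclideanSpace ℝ (Fin n)),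
      ∀ u, ‖H1.fnL u‖ ^ 2 ≤ ε * ‖u‖ ^ 2 + ‖l u‖ ^ 2 := by
  obtain ⟨N, hN⟩ := exists_nat_gt (1 / ε)
  let F : Finset (Fin d → ℤ) := Fintype.piFinset fun _ => Finset.Icc (-(N : ℤ)) N
  let ι := Fin m × F × Bool
  let f : ι → E d → ℝ := fun p => if p.2.2 then fun y => Real.cos (phase p.2.1 y) else
    fun y => Real.sin (phase p.2.1 y)
  have hf : ∀ p, Continuous (f p) := fun p => by
    have := (contDiff_phase (n := 0) p.2.1.1).continuous
    simp only [f]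
    split_ifs <;> fun_prop
  let l0 : ι → H1 d m →L[ℝ] ℝ := fun p =>
    (innerSL ℝ (testElem (f p) (hf p) p.1)).comp H1.fnL
  let e := Fintype.equivFin ι
  refine ⟨Fintype.card ι, (EuclideanSpace.equiv (Fin (Fintype.card ι)) ℝ).symm.toContinuousLinearMap.comp
    (ContinuousLinearMap.pi fun j => l0 (e.symm j)), fun u => ?_⟩
  have hl : ‖((EuclideanSpace.equiv (Fin (Fintype.card ι)) ℝ).symm.toContinuousLinearMap.comp
      (ContinuousLinearMap.pi fun j => l0 (e.symm j))) u‖ ^ 2 =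
      ∑ β, ∑ k ∈ F, fourierSq (fun y => u.fn y β) k := by
    rw [EuclideanSpace.real_norm_sq_eq]
    have : ∀ j, (((EuclideanSpace.equiv (Fin (Fintype.card ι)) ℝ).symm.toContinuousLinearMap.comp
      (ContinuousLinearMap.pi fun j => l0 (e.symm j))) u) j = l0 (e.symm j) u := fun j => rfl
    simp only [this]
    rw [Equiv.sum_comp e.symm (fun p => l0 p u ^ 2), Fintype.sum_prod_type]
    refine Finset.sum_congr rfl fun β _ => ?_
    rw [Fintype.sum_prod_type, ← Finset.sum_coe_sort F]
    refine Finset.sum_congr rfl fun k _ => ?_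
    rw [Fintype.sum_bool, fourierSq]
    congr 2
    · exact inner_testElem _ _ _ _
    · exact inner_testElem _ _ _ _
  rw [hl, add_comm]
  have h := norm_fnL_sq_le u F hε.le fun k hk => by
    have : ∃ i, (N : ℤ) < |k i| := by
      by_contra hcon
      push Not at hcon
      exact hk (Fintype.mem_piFinset.2 fun i => Finset.mem_Icc.2 (abs_le.1 (hcon i)))
    obtain ⟨i, hi⟩ := this
    have h1 := sq_le_sum_sq_frequency hi
    have h2 : 1 < N * ε := (div_lt_iff₀ hε).1 hN
    have h3 : (0 : ℝ) ≤ N := Nat.cast_nonneg N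
    nlinarith [mul_nonneg hε.le (sq_nonneg (N : ℝ)), mul_le_mul_of_nonneg_left h1 hε.le]
  refine h.trans (add_le_add le_rfl (mul_le_mul_of_nonneg_left ?_ hε.le))
  rw [H1.norm_sq_eq]
  nlinarith [sq_nonneg ‖H1.fnL u‖]

/-! ### Density of smooth functions -/

theorem inner_ofPeriodic_smul_single {d m : ℕ} (u : H1 d m) {f : E d → ℝ}
    (hc : ContDiff ℝ 1 f) (β : Fin m)
    (hf' : IsPeriodic fun y => f y • EuclideanSpace.single β (1 : ℝ))
    (hc' : ContDiff ℝ 1 fun y => f y • EuclideanSpace.single β (1 : ℝ)) :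
    inner ℝ (H1.ofPeriodic _ hf' hc') u = (∫ y in unitCell d, u.fn y β * f y) +
      ∑ i, ∫ y in unitCell d, u.grad y (i, β) * fderiv ℝ f y (EuclideanSpace.single i 1) := by
  have hcf := hc.continuous_fderiv (by simp)
  have e1 : H1.fnL (H1.ofPeriodic _ hf' hc') = testElem f hc.continuous β :=
    Lp.ext ((H1.fn_ofPeriodic hf' hc').trans (MemLp.coeFn_toLp _).symm)
  have e2 : H1.gradL (H1.ofPeriodic _ hf' hc') =
      ∑ i, testElem (fun y => fderiv ℝ f y (EuclideanSpace.single i 1)) (by fun_prop) (i, β) := by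
    refine Lp.ext ((H1.grad_ofPeriodic hf' hc').trans ?_)
    refine EventuallyEq.trans ?_ (Lp.coeFn_finsetSum _ _).symm
    have : ∀ i : Fin d, testElem (fun y => fderiv ℝ f y (EuclideanSpace.single i 1))
        (by fun_prop) (i, β) =ᵐ[cellMeasure d] fun y => fderiv ℝ f y (EuclideanSpace.single i 1) •
          EuclideanSpace.single (i, β) (1 : ℝ) := fun i => MemLp.coeFn_toLp _
    filter_upwards [ae_all_iff.2 this] with y hy
    simp only [Finset.sum_apply, hy]
    ext ⟨j, γ⟩
    rw [gradOf_apply, fderiv_smul_const (hc.differentiable (by simp) y)]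
    by_cases hγ : γ = β
    · subst hγ
      simp [Pi.single_apply, Prod.ext_iff]
    · simp [hγ]
  rw [H1.inner_eq, e1, e2, sum_inner, inner_testElem]
  simp only [inner_testElem]
  rfl

/-- The smooth periodic functions, as a subspace of `H¹`. -/
noncomputable def smoothH1 (d m : ℕ) : Submodule ℝ (H1 d m) where
  carrier := {u | ∃ f : E d → E m, ContDiff ℝ ((⊤ : ℕ∞) : WithTop ℕ∞) f ∧ IsPeriodic f ∧
    u.fn =ᵐ[cellMeasure d] f}
  zero_mem' := ⟨0, contDiff_const, fun _ _ => rfl, H1.fn_zero⟩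
  add_mem' := by
    rintro u v ⟨f, hf, hfp, hu⟩ ⟨g, hg, hgp, hv⟩
    exact ⟨f + g, hf.add hg, fun n y => by simp only [Pi.add_apply, hfp n y, hgp n y],
      (H1.fn_add u v).trans (hu.add hv)⟩
  smul_mem' := by
    rintro c u ⟨f, hf, hfp, hu⟩
    exact ⟨c • f, contDiff_const.smul hf, fun n y => by simp only [Pi.smul_apply, hfp n y],
      (H1.fn_smul c u).trans (hu.const_smul c)⟩

/-- Smooth periodic functions are dense in `H¹`: a function orthogonal to all of them satisfies
`(1 + |2πk|²) û(k) = 0` for all frequencies. -/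
theorem topologicalClosure_smoothH1 (d m : ℕ) : (smoothH1 d m).topologicalClosure = ⊤ := by
  rw [Submodule.topologicalClosure_eq_top_iff, Submodule.eq_bot_iff]
  intro u hu
  have hzero : ∀ β k, fourierSq (fun y => u.fn y β) k = 0 := by
    intro β k
    have hcos : ContDiff ℝ ((⊤ : ℕ∞) : WithTop ℕ∞) fun y : E d => Real.cos (phase k y) :=
      Real.contDiff_cos.comp (contDiff_phase k)
    have hsin : ContDiff ℝ ((⊤ : ℕ∞) : WithTop ℕ∞) fun y : E d => Real.sin (phase k y) :=
      Real.contDiff_sin.comp (contDiff_phase k)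
    have c1 := u.isWeakGrad _ hcos (isPeriodic_cos_phase k)
    have c2 := u.isWeakGrad _ hsin (isPeriodic_sin_phase k)
    have key : ∀ f : E d → ℝ, ContDiff ℝ ((⊤ : ℕ∞) : WithTop ℕ∞) f → IsPeriodic f →
        (∫ y in unitCell d, u.fn y β * f y) +
          ∑ i, ∫ y in unitCell d, u.grad y (i, β) * fderiv ℝ f y (EuclideanSpace.single i 1)
          = 0 := by
      intro f hf hp
      have hf1 : ContDiff ℝ 1 f := hf.of_le (by exact_mod_cast le_top)
      have hp' : IsPeriodic fun y => f y • EuclideanSpace.single β (1 : ℝ) := fun n y => by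
        simp only [hp n y]
      rw [← inner_ofPeriodic_smul_single u hf1 β hp' (hf1.smul contDiff_const)]
      exact hu _ ⟨_, hf.smul contDiff_const, hp', H1.fn_ofPeriodic _ _⟩
    have k1 := key _ hcos (isPeriodic_cos_phase k)
    have k2 := key _ hsin (isPeriodic_sin_phase k)
    simp only [fderiv_cos_phase, fderiv_sin_phase] at c1 c2 k1 k2
    have pull : ∀ (a : ℝ) (g h : E d → ℝ), ∫ y in unitCell d, g y * (a * h y) =
        a * ∫ y in unitCell d, g y * h y := fun a g h => by
      rw [← integral_const_mul]
      congr 1; funext y; ring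
    simp only [pull] at c1 c2 k1 k2
    have s1 : (1 + ∑ i, (2 * Real.pi * k i) ^ 2) *
        ∫ y in unitCell d, u.fn y β * Real.cos (phase k y) = 0 := by
      rw [← k1, add_mul, one_mul, Finset.sum_mul]
      congr 1
      refine Finset.sum_congr rfl fun i _ => ?_
      have := c2 i β
      linear_combination (2 * Real.pi * k i) * this
    have s2 : (1 + ∑ i, (2 * Real.pi * k i) ^ 2) *
        ∫ y in unitCell d, u.fn y β * Real.sin (phase k y) = 0 := by
      rw [← k2, add_mul, one_mul, Finset.sum_mul]
      congr 1
      refine Finset.sum_congr rfl fun i _ => ?_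
      have := c1 i β
      linear_combination -(2 * Real.pi * k i) * this
    have hpos : (1 + ∑ i, (2 * Real.pi * (k i : ℝ)) ^ 2) ≠ 0 := by positivity
    rw [fourierSq, (mul_eq_zero.1 s1).resolve_left hpos, (mul_eq_zero.1 s2).resolve_left hpos]
    simp
  have h1 : ‖H1.fnL u‖ ^ 2 = 0 := by
    rw [norm_sq_L2]
    refine Finset.sum_eq_zero fun β _ => ?_
    have h := hasSum_fourierSq (memLp_apply u.memLp_fn β)
    have h' : HasSum (fourierSq fun y => u.fn y β) 0 := by
      rw [show (fourierSq fun y => u.fn y β) = fun _ => 0 from funext (hzero β)]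
      exact hasSum_zero
    exact h.unique h'
  have h2 : H1.fnL u = 0 := by simpa using h1
  refine H1.ext_fn ?_
  have h3 : u.fn =ᵐ[cellMeasure d] 0 := by
    rw [← H1.coe_fnL, h2]
    exact Lp.coeFn_zero _ _ _
  exact h3.trans H1.fn_zero.symm

/-! ### Functions with vanishing weak gradient -/

/-- The bump functions used for mollification, with radius `r / (n + 1)`. -/
noncomputable def mollifier (d : ℕ) {r : ℝ} (hr : 0 < r) (n : ℕ) : ContDiffBump (0 : E d) where
  rIn := r / (n + 1) / 2
  rOut := r / (n + 1)
  rIn_pos := by positivity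
  rIn_lt_rOut := half_lt_self (by positivity)

theorem tendsto_mollifier_rOut (d : ℕ) {r : ℝ} (hr : 0 < r) :
    Tendsto (fun n => (mollifier d hr n).rOut) atTop (𝓝 0) :=
  by simpa [mollifier, div_eq_mul_inv] using
    (tendsto_one_div_add_atTop_nhds_zero_nat (𝕜 := ℝ)).const_mul r

theorem mollifier_rOut_le (d : ℕ) {r : ℝ} (hr : 0 < r) (n : ℕ) : (mollifier d hr n).rOut ≤ r :=
  div_le_self hr.le (by linarith [Nat.cast_nonneg (α := ℝ) n])

/-- If the weak gradient of `f` vanishes in the ball of radius `2r`, the gradient of a mollification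
at scale at most `r` vanishes in the ball of radius `r`. -/
theorem fderiv_mollify_eq_zero {d : ℕ} {f : E d → ℝ} (hf : LocallyIntegrable f volume) {x : E d}
    {r : ℝ} (φ : ContDiffBump (0 : E d)) (hφ : φ.rOut ≤ r)
    (h : ∀ ϕ : E d → ℝ, ContDiff ℝ ((⊤ : ℕ∞) : WithTop ℕ∞) ϕ → HasCompactSupport ϕ →
      tsupport ϕ ⊆ Metric.ball x (2 * r) → ∀ i,
        ∫ y, f y * fderiv ℝ ϕ y (EuclideanSpace.single i 1) = 0)
    {z : E d} (hz : z ∈ Metric.ball x r) :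
    fderiv ℝ (φ.normed volume ⋆[ContinuousLinearMap.lsmul ℝ ℝ, volume] f) z = 0 := by
  set g := φ.normed (volume : Measure (E d)) with hg
  have hgc : ContDiff ℝ ((⊤ : ℕ∞) : WithTop ℕ∞) g := φ.contDiff_normed
  have hg1 : ContDiff ℝ 1 g := φ.contDiff_normed
  have hgK : HasCompactSupport g := φ.hasCompactSupport_normed
  rw [(hgK.hasFDerivAt_convolution_left (ContinuousLinearMap.lsmul ℝ ℝ) hg1 hf z).fderiv]
  have hbasis : ∀ i, ((fderiv ℝ g ⋆[(ContinuousLinearMap.lsmul ℝ ℝ).precompL (E d), volume] f) z)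
      (EuclideanSpace.single i 1) = 0 := by
    intro i
    have hex : ConvolutionExistsAt (fderiv ℝ g) f z
        ((ContinuousLinearMap.lsmul ℝ ℝ).precompL (E d)) volume :=
      (hgK.fderiv ℝ).convolutionExists_left _ (hg1.continuous_fderiv (by simp)) hf z
    rw [convolution_eq_swap, ContinuousLinearMap.integral_apply
      (by simpa using hex.integrable_swap)]
    have hϕ : ContDiff ℝ ((⊤ : ℕ∞) : WithTop ℕ∞) fun y => g (z - y) :=
      hgc.comp (contDiff_const.sub contDiff_id)
    have hsupp : tsupport (fun y => g (z - y)) ⊆ Metric.closedBall z r := by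
      refine closure_minimal (fun y hy => ?_) Metric.isClosed_closedBall
      have : z - y ∈ Function.support g := hy
      rw [hg, φ.support_normed_eq, mem_ball_zero_iff] at this
      rw [Metric.mem_closedBall, dist_comm, dist_eq_norm]
      linarith
    have hK : HasCompactSupport fun y => g (z - y) :=
      HasCompactSupport.of_support_subset_isCompact (isCompact_closedBall z r)
        ((subset_tsupport _).trans hsupp)
    have hsub : tsupport (fun y => g (z - y)) ⊆ Metric.ball x (2 * r) := by
      refine hsupp.trans fun y hy => ?_
      rw [Metric.mem_ball] at hz ⊢
      rw [Metric.mem_closedBall] at hy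
      linarith [dist_triangle y z x]
    have h1 := h _ hϕ hK hsub i
    have e : ∀ y, fderiv ℝ (fun y => g (z - y)) y (EuclideanSpace.single i 1) =
        -(fderiv ℝ g (z - y) (EuclideanSpace.single i 1)) := by
      intro y
      have h2 := (hg1.differentiable (by simp) (z - y)).hasFDerivAt.comp y
        ((hasFDerivAt_id y).const_sub z)
      have h3 : fderiv ℝ (fun y => g (z - y)) y = _ := h2.fderiv
      rw [h3]
      simp
    simp only [e, mul_neg, integral_neg, neg_eq_zero] at h1
    rw [← h1]
    congr 1
    funext y
    simp [ContinuousLinearMap.precompL_apply, mul_comm]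
  ext v
  have hv : v = ∑ i, v i • EuclideanSpace.single i (1 : ℝ) := by
    ext j
    simp [Pi.single_apply]
  rw [hv, map_sum]
  simp only [map_smul, hbasis]
  simp

/-- A function with vanishing weak gradient in a ball is constant in the concentric ball of half the
radius: its mollifications are constant there and converge almost everywhere. -/
theorem exists_ae_eq_const_ball {d : ℕ} {f : E d → ℝ} (hf : LocallyIntegrable f volume) {x : E d}
    {r : ℝ} (hr : 0 < r)
    (h : ∀ ϕ : E d → ℝ, ContDiff ℝ ((⊤ : ℕ∞) : WithTop ℕ∞) ϕ → HasCompactSupport ϕ →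
      tsupport ϕ ⊆ Metric.ball x (2 * r) → ∀ i,
        ∫ y, f y * fderiv ℝ ϕ y (EuclideanSpace.single i 1) = 0) :
    ∃ c, ∀ᵐ y ∂volume, y ∈ Metric.ball x r → f y = c := by
  have hlim := ContDiffBump.ae_convolution_tendsto_right_of_locallyIntegrable (K := 2)
    (φ := mollifier d hr) (tendsto_mollifier_rOut d hr) (Eventually.of_forall fun n => by
      simp only [mollifier]; linarith) hf
  have hconst : ∀ n, ∀ y ∈ Metric.ball x r,
      ((mollifier d hr n).normed volume ⋆[ContinuousLinearMap.lsmul ℝ ℝ, volume] f) y =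
        ((mollifier d hr n).normed volume ⋆[ContinuousLinearMap.lsmul ℝ ℝ, volume] f) x := by
    intro n y hy
    have hd : ContDiff ℝ 1 ((mollifier d hr n).normed volume ⋆[ContinuousLinearMap.lsmul ℝ ℝ,
        volume] f) :=
      (mollifier d hr n).hasCompactSupport_normed.contDiff_convolution_left _
        (mollifier d hr n).contDiff_normed hf
    exact Metric.isOpen_ball.is_const_of_fderiv_eq_zero (convex_ball x r).isPreconnected
      (hd.differentiable (by simp)).differentiableOn
      (fun z hz => fderiv_mollify_eq_zero hf _ (mollifier_rOut_le d hr n) h hz) hy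
      (Metric.mem_ball_self hr)
  have hlim' := (ae_restrict_iff' (μ := volume) (measurableSet_ball (x := x) (ε := r))).2
    (hlim.mono fun y hy _ => hy)
  have hne : (ae ((volume : Measure (E d)).restrict (Metric.ball x r))).NeBot := by
    rw [ae_neBot, Ne, Measure.restrict_eq_zero]
    exact (Metric.measure_ball_pos volume x hr).ne'
  obtain ⟨z, hz, hzb⟩ := (hlim'.and (ae_restrict_mem measurableSet_ball)).exists
  refine ⟨f z, ?_⟩
  filter_upwards [hlim] with y hy hyb
  refine tendsto_nhds_unique hy (hz.congr fun n => ?_)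
  rw [hconst n z hzb, hconst n y hyb]

/-- On a connected open set, a locally constant measurable function is constant. -/
theorem exists_ae_eq_const_of_locally {d : ℕ} {V : Type*} [Nonempty V] {f : E d → V} {U : Set (E d)}
    (hUc : IsPreconnected U) (hne : U.Nonempty)
    (h : ∀ x ∈ U, ∃ r > 0, ∃ c, ∀ᵐ y ∂volume, y ∈ Metric.ball x r → f y = c) :
    ∃ c, ∀ᵐ y ∂volume, y ∈ U → f y = c := by
  choose! r hr c hc using h
  have hloc : IsLocallyConstant fun x : U => c x := by
    rw [IsLocallyConstant.iff_eventually_eq]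
    rintro ⟨x, hx⟩
    have hb : Metric.ball x (r x) ∈ 𝓝 x := Metric.ball_mem_nhds x (hr x hx)
    filter_upwards [continuous_subtype_val.continuousAt.preimage_mem_nhds hb]
    rintro ⟨y, hy⟩ hyx
    have hopen : IsOpen (Metric.ball x (r x) ∩ Metric.ball y (r y)) :=
      Metric.isOpen_ball.inter Metric.isOpen_ball
    have hpos : (volume : Measure (E d)) (Metric.ball x (r x) ∩ Metric.ball y (r y)) ≠ 0 :=
      (hopen.measure_pos volume ⟨y, hyx, Metric.mem_ball_self (hr y hy)⟩).ne'
    have hne : (ae ((volume : Measure (E d)).restrict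
        (Metric.ball x (r x) ∩ Metric.ball y (r y)))).NeBot := by
      rwa [ae_neBot, Ne, Measure.restrict_eq_zero]
    obtain ⟨z, ⟨hz1, hz2⟩, hz3⟩ := (((ae_restrict_of_ae (hc x hx)).and
      (ae_restrict_of_ae (hc y hy))).and (ae_restrict_mem hopen.measurableSet)).exists
    exact (hz2 hz3.2).symm.trans (hz1 hz3.1)
  have := isPreconnected_iff_preconnectedSpace.1 hUc
  obtain ⟨x₀, hx₀⟩ := hne
  refine ⟨c x₀, ?_⟩
  have hall : ∀ x ∈ U, c x = c x₀ := fun x hx =>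
    hloc.apply_eq_of_preconnectedSpace ⟨x, hx⟩ ⟨x₀, hx₀⟩
  have hnull : (volume : Measure (E d)) {y | y ∈ U ∧ f y ≠ c x₀} = 0 := by
    refine measure_null_of_locally_null _ fun x hx => ?_
    refine ⟨Metric.ball x (r x) ∩ {y | y ∈ U ∧ f y ≠ c x₀},
      mem_nhdsWithin.2 ⟨_, Metric.isOpen_ball, Metric.mem_ball_self (hr x hx.1), subset_rfl⟩, ?_⟩
    refine measure_mono_null (fun y hy => ?_) (ae_iff.1 (hc x hx.1))
    simp only [mem_ofPred_eq, Classical.not_imp]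
    refine ⟨hy.1, fun h => hy.2.2 ?_⟩
    rw [h, hall x hx.1]
  refine ae_iff.2 (measure_mono_null (fun y hy => ?_) hnull)
  simpa using hy

/-- An `H¹` function whose weak gradient vanishes on a connected open set is constant there. -/
theorem H1.exists_eq_const_of_grad_eq_zero {d m : ℕ} (u : H1 d m) {U : Set (E d)} (hU : IsOpen U)
    (hUY : U ⊆ unitCell d) (hUc : IsConnected U)
    (h : ∀ᵐ y ∂volume, y ∈ U → u.grad y = 0) :
    ∃ c, ∀ᵐ y ∂volume, y ∈ U → u.fn y = c := by
  have key : ∀ β : Fin m, ∃ c, ∀ᵐ y ∂volume, y ∈ U → u.fn y β = c := by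
    intro β
    have hint : Integrable (fun y => u.fn y β) (cellMeasure d) :=
      integrable_apply_of_memLp u.memLp_fn β
    have hloc : LocallyIntegrable ((unitCell d).indicator fun y => u.fn y β) volume :=
      ((integrable_indicator_iff (measurableSet_unitCell d)).2 hint).locallyIntegrable
    refine exists_ae_eq_const_of_locally hUc.isPreconnected hUc.nonempty fun x hx => ?_
    obtain ⟨r, hr, hrU⟩ := Metric.isOpen_iff.1 hU x hx
    suffices hball : ∃ c, ∀ᵐ y ∂volume, y ∈ Metric.ball x (r / 2) →
        (unitCell d).indicator (fun y => u.fn y β) y = c by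
      obtain ⟨c, hc⟩ := hball
      refine ⟨r / 2, half_pos hr, c, ?_⟩
      filter_upwards [hc] with y hy hyb
      rw [← hy hyb, indicator_of_mem (hUY (hrU (Metric.ball_subset_ball (by linarith) hyb)))]
    · refine exists_ae_eq_const_ball hloc (half_pos hr) fun ϕ hϕ hK hs i => ?_
      rw [mul_div_cancel₀ _ (two_ne_zero)] at hs
      have hsY := (hs.trans hrU).trans hUY
      have h1 := u.isWeakGrad (periodize ϕ) (contDiff_periodize hϕ hK hsY)
        (isPeriodic_periodize ϕ) i β
      have e1 : ∫ y in unitCell d, u.grad y (i, β) * periodize ϕ y = 0 := by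
        refine integral_eq_zero_of_ae ((ae_restrict_iff' (measurableSet_unitCell d)).2 ?_)
        filter_upwards [h] with y hy hyY
        by_cases hyU : y ∈ U
        · simp [hy hyU]
        · rw [periodize_eq ϕ hyY, image_eq_zero_of_notMem_tsupport fun h => hyU (hrU (hs h))]
          simp
      rw [e1, neg_zero] at h1
      rw [← h1, ← integral_indicator (measurableSet_unitCell d)]
      congr 1
      funext y
      by_cases hy : y ∈ unitCell d
      · rw [indicator_of_mem hy, indicator_of_mem hy]
        congr 2
        refine Filter.EventuallyEq.fderiv_eq ?_
        filter_upwards [(isOpen_unitCell d).mem_nhds hy] with z hz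
        exact (periodize_eq ϕ hz).symm
      · rw [indicator_of_notMem hy, indicator_of_notMem hy, zero_mul]
  choose c hc using key
  refine ⟨toLp 2 c, ?_⟩
  filter_upwards [ae_all_iff.2 hc] with y hy hyU
  ext β
  exact hy β hyU

/-! ### Lipschitz functions with zero trace -/

theorem H1.norm_le {d m : ℕ} (u : H1 d m) : ‖u‖ ≤ ‖H1.fnL u‖ + ‖H1.gradL u‖ := by
  refine (sq_le_sq₀ (norm_nonneg _) (by positivity)).1 ?_
  rw [H1.norm_sq_eq]
  nlinarith [norm_nonneg (H1.fnL u), norm_nonneg (H1.gradL u)]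

theorem H1.norm_gradL_le {d m : ℕ} (u : H1 d m) : ‖H1.gradL u‖ ≤ ‖u‖ := by
  refine (sq_le_sq₀ (norm_nonneg _) (norm_nonneg _)).1 ?_
  rw [H1.norm_sq_eq]
  nlinarith [sq_nonneg ‖H1.fnL u‖]

/-- For a smooth function `q`, the `H¹` inner product with `q` is continuous in the `L²` norm. -/
theorem exists_inner_eq_inner_fnL {d m : ℕ} {q : H1 d m} (hq : q ∈ smoothH1 d m) :
    ∃ h : L2 d m, ∀ w : H1 d m, inner ℝ q w = inner ℝ h (H1.fnL w) := by
  obtain ⟨f, hf, hfp, hqf⟩ := hq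
  have hfβ : ∀ β : Fin m, ContDiff ℝ ((⊤ : ℕ∞) : WithTop ℕ∞) fun y => f y β := fun β =>
    (EuclideanSpace.proj (𝕜 := ℝ) β).contDiff.comp hf
  have hfβ1 : ∀ β : Fin m, ContDiff ℝ 1 fun y => f y β := fun β =>
    (hfβ β).of_le (by exact_mod_cast le_top)
  have hper : ∀ β : Fin m, IsPeriodic fun y => f y β • EuclideanSpace.single β (1 : ℝ) :=
    fun β n y => by simp only [hfp n y]
  have hc : ∀ β : Fin m, ContDiff ℝ 1 fun y => f y β • EuclideanSpace.single β (1 : ℝ) :=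
    fun β => (hfβ1 β).smul contDiff_const
  have hsum : q = ∑ β, H1.ofPeriodic _ (hper β) (hc β) := by
    refine H1.ext_fn (hqf.trans ?_)
    rw [← H1.coe_fnL, map_sum]
    refine EventuallyEq.trans ?_ (Lp.coeFn_finsetSum _ _).symm
    filter_upwards [ae_all_iff.2 fun β => H1.fn_ofPeriodic (hper β) (hc β)] with y hy
    simp only [Finset.sum_apply, H1.coe_fnL, hy]
    ext β
    simp [Pi.single_apply]
  have hD : ∀ (β : Fin m) (i : Fin d), ContDiff ℝ ((⊤ : ℕ∞) : WithTop ℕ∞)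
      fun y => fderiv ℝ (fun y => f y β) y (EuclideanSpace.single i 1) := fun β i =>
    ((hfβ β).fderiv_right (m := ((⊤ : ℕ∞) : WithTop ℕ∞)) (by simp)).clm_apply contDiff_const
  have hDp : ∀ (β : Fin m) (i : Fin d), IsPeriodic
      fun y => fderiv ℝ (fun y => f y β) y (EuclideanSpace.single i 1) := fun β i n y => by
    have : IsPeriodic fun y => f y β := fun n y => by simp only [hfp n y]
    simp only [isPeriodic_fderiv this n y]
  have hDD : ∀ (β : Fin m) (i : Fin d), Continuous fun y => fderiv ℝ
      (fun y => fderiv ℝ (fun y => f y β) y (EuclideanSpace.single i 1)) y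
        (EuclideanSpace.single i 1) := fun β i =>
    ((hD β i).continuous_fderiv (by simp)).clm_apply continuous_const
  refine ⟨∑ β, (testElem _ (hfβ1 β).continuous β - ∑ i, testElem _ (hDD β i) β), fun w => ?_⟩
  rw [hsum, sum_inner, sum_inner]
  refine Finset.sum_congr rfl fun β _ => ?_
  rw [inner_ofPeriodic_smul_single w (hfβ1 β), inner_sub_left, sum_inner, sub_eq_add_neg,
    ← Finset.sum_neg_distrib, inner_testElem]
  congr 1
  refine Finset.sum_congr rfl fun i _ => ?_
  rw [inner_testElem, eq_neg_iff_add_eq_zero, add_comm, ← eq_neg_iff_add_eq_zero]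
  exact w.isWeakGrad _ (hD β i) (hDp β i) i β

/-- A closed subspace of `H¹` contains the `L²` limits of its bounded sequences: these sequences
converge weakly in `H¹`, since inner products with smooth functions are `L²` inner products. -/
theorem mem_of_tendsto_fnL {d m : ℕ} {Z : Submodule ℝ (H1 d m)}
    (hZ : IsClosed (Z : Set (H1 d m))) {v : ℕ → H1 d m} {v₀ : H1 d m} (hv : ∀ n, v n ∈ Z) {B : ℝ}
    (hB : ∀ n, ‖v n‖ ≤ B) (hlim : Tendsto (fun n => H1.fnL (v n)) atTop (𝓝 (H1.fnL v₀))) :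
    v₀ ∈ Z := by
  have : CompleteSpace Z := hZ.completeSpace_coe
  have hweak : ∀ q : H1 d m, Tendsto (fun n => inner ℝ q (v n)) atTop (𝓝 (inner ℝ q v₀)) := by
    intro q
    have hB0 : 0 ≤ B := (norm_nonneg _).trans (hB 0)
    rw [Metric.tendsto_atTop]
    intro ε hε
    have hq : q ∈ closure (smoothH1 d m : Set (H1 d m)) := by
      rw [← Submodule.topologicalClosure_coe, topologicalClosure_smoothH1]
      trivial
    obtain ⟨q', hq', hqq⟩ := Metric.mem_closure_iff.1 hq (ε / (2 * (B + ‖v₀‖ + 1)))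
      (by positivity)
    obtain ⟨h, hh⟩ := exists_inner_eq_inner_fnL hq'
    have ht : Tendsto (fun n => inner ℝ q' (v n)) atTop (𝓝 (inner ℝ q' v₀)) := by
      simp only [hh]
      exact tendsto_const_nhds.inner hlim
    obtain ⟨N, hN⟩ := Metric.tendsto_atTop.1 ht (ε / 2) (half_pos hε)
    refine ⟨N, fun n hn => ?_⟩
    have h1 := hN n hn
    rw [Real.dist_eq, ← inner_sub_right] at h1 ⊢
    have e : inner ℝ q (v n - v₀) = inner ℝ (q - q') (v n - v₀) + inner ℝ q' (v n - v₀) := by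
      rw [← inner_add_left, sub_add_cancel]
    rw [e]
    have h2 := abs_real_inner_le_norm (q - q') (v n - v₀)
    have h3 : ‖v n - v₀‖ ≤ B + ‖v₀‖ + 1 := (norm_sub_le _ _).trans (by linarith [hB n])
    rw [dist_eq_norm] at hqq
    have h4 : ‖q - q'‖ * ‖v n - v₀‖ ≤ ε / 2 := by
      calc _ ≤ ε / (2 * (B + ‖v₀‖ + 1)) * (B + ‖v₀‖ + 1) := by gcongr
        _ = ε / 2 := by field_simp
    exact (abs_add_le _ _).trans_lt (by linarith)
  set p := v₀ - Z.starProjection v₀ with hp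
  have hpZ : p ∈ Zᗮ := Z.sub_starProjection_mem_orthogonal v₀
  have h0 : inner ℝ p v₀ = 0 := by
    refine tendsto_nhds_unique (hweak p) ?_
    have : (fun n => inner ℝ p (v n)) = fun _ => (0 : ℝ) := by
      funext n
      rw [real_inner_comm]
      exact hpZ _ (hv n)
    rw [this]
    exact tendsto_const_nhds
  have h1 : inner ℝ p (Z.starProjection v₀) = 0 := by
    rw [real_inner_comm]
    exact hpZ _ (Z.starProjection_apply_mem v₀)
  have h2 : inner ℝ p p = 0 := by
    conv_lhs => rw [hp]
    rw [← hp, inner_sub_right, h0, h1, sub_zero]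
  have h3 : p = 0 := inner_self_eq_zero.1 h2
  have h4 : v₀ = Z.starProjection v₀ := sub_eq_zero.1 (hp.symm.trans h3)
  rw [h4]
  exact Z.starProjection_apply_mem v₀

theorem norm_Lp_le {d : ℕ} {ι : Type*} [Fintype ι]
    {f : Lp (EuclideanSpace ℝ ι) 2 (cellMeasure d)} {C : ℝ} (hC : 0 ≤ C)
    (h : ∀ᵐ y ∂cellMeasure d, ‖f y‖ ≤ C) :
    ‖f‖ ≤ measureUnivNNReal (cellMeasure d) ^ (2 : ℝ)⁻¹ * C := by
  simpa using Lp.norm_le_of_ae_bound hC h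

theorem H1.norm_gradL_ofLipschitz_le {d m : ℕ} {f : E d → E m} {C : ℝ≥0} (hf : LipschitzWith C f)
    (hK : HasCompactSupport f) (hs : tsupport f ⊆ unitCell d) :
    ‖H1.gradL (H1.ofLipschitz f ⟨C, hf⟩ hK hs)‖ ≤
      measureUnivNNReal (cellMeasure d) ^ (2 : ℝ)⁻¹ * Real.sqrt ((d * m : ℕ) * C ^ 2) := by
  refine norm_Lp_le (by positivity) ?_
  filter_upwards [H1.grad_ofLipschitz ⟨C, hf⟩ hK hs] with y hy
  rw [H1.coe_gradL, hy]
  refine Real.le_sqrt_of_sq_le ((norm_gradOf_le f y).trans ?_)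
  have := norm_fderiv_le_of_lipschitz ℝ (x₀ := y) hf
  gcongr

/-- A closed subspace of `H¹` contains the uniform limits of its equi-Lipschitz sequences. -/
theorem ofLipschitz_mem_of_tendsto {d m : ℕ} {Z : Submodule ℝ (H1 d m)}
    (hZ : IsClosed (Z : Set (H1 d m))) {f : E d → E m} (hf : ∃ C, LipschitzWith C f)
    (hK : HasCompactSupport f) (hs : tsupport f ⊆ unitCell d) {g : ℕ → E d → E m} {C : ℝ≥0}
    (hg : ∀ n, LipschitzWith C (g n)) (hgK : ∀ n, HasCompactSupport (g n))
    (hgs : ∀ n, tsupport (g n) ⊆ unitCell d)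
    (hgZ : ∀ n, H1.ofLipschitz (g n) ⟨C, hg n⟩ (hgK n) (hgs n) ∈ Z) {ε : ℕ → ℝ}
    (hε : Tendsto ε atTop (𝓝 0)) (h : ∀ n y, ‖g n y - f y‖ ≤ ε n) :
    H1.ofLipschitz f hf hK hs ∈ Z := by
  set κ : ℝ := measureUnivNNReal (cellMeasure d) ^ (2 : ℝ)⁻¹ with hκ
  have hε0 : ∀ n, 0 ≤ ε n := fun n => (norm_nonneg _).trans (h n 0)
  have hdiff : ∀ n, ‖H1.fnL (H1.ofLipschitz (g n) ⟨C, hg n⟩ (hgK n) (hgs n)) -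
      H1.fnL (H1.ofLipschitz f hf hK hs)‖ ≤ κ * ε n := by
    intro n
    refine norm_Lp_le (hε0 n) ?_
    filter_upwards [H1.fn_ofLipschitz ⟨C, hg n⟩ (hgK n) (hgs n), H1.fn_ofLipschitz hf hK hs,
      Lp.coeFn_sub (H1.fnL (H1.ofLipschitz (g n) ⟨C, hg n⟩ (hgK n) (hgs n)))
        (H1.fnL (H1.ofLipschitz f hf hK hs))] with y h1 h2 h3
    rw [h3, Pi.sub_apply, H1.coe_fnL, H1.coe_fnL, h1, h2]
    exact h n y
  obtain ⟨M, hM⟩ := hε.bddAbove_range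
  have hM' : ∀ n, ε n ≤ M := fun n => hM ⟨n, rfl⟩
  refine mem_of_tendsto_fnL hZ hgZ (B := κ * M + ‖H1.fnL (H1.ofLipschitz f hf hK hs)‖ +
    κ * Real.sqrt ((d * m : ℕ) * C ^ 2)) (fun n => ?_) ?_
  · refine (H1.norm_le _).trans (add_le_add ?_ (H1.norm_gradL_ofLipschitz_le (hg n) (hgK n) (hgs n)))
    have h1 := norm_le_norm_sub_add (H1.fnL (H1.ofLipschitz (g n) ⟨C, hg n⟩ (hgK n) (hgs n)))
      (H1.fnL (H1.ofLipschitz f hf hK hs))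
    have h2 : κ * ε n ≤ κ * M := mul_le_mul_of_nonneg_left (hM' n) (by positivity)
    linarith [hdiff n]
  · rw [tendsto_iff_norm_sub_tendsto_zero]
    refine squeeze_zero (fun n => norm_nonneg _) hdiff ?_
    simpa using hε.const_mul κ

theorem isClosed_zeroTrace {d : ℕ} (m : ℕ) (ω : Set (E d)) :
    IsClosed (zeroTrace m ω : Set (H1 d m)) := Submodule.isClosed_topologicalClosure _

theorem mem_zeroTrace_of_isTestOff {d m : ℕ} {ω : Set (E d)} {v : H1 d m} {ϕ : E d → E m}
    (h : IsTestOff ω ϕ) (hv : v.fn =ᵐ[cellMeasure d] ϕ) : v ∈ zeroTrace m ω :=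
  Submodule.le_topologicalClosure _ (Submodule.subset_span ⟨ϕ, h, hv⟩)

theorem isTestOff_periodize {d m : ℕ} {ω : Set (E d)} (hω : frontier ω ⊆ unitCell d)
    {f : E d → E m} (hf : ContDiff ℝ ((⊤ : ℕ∞) : WithTop ℕ∞) f) (hK : HasCompactSupport f)
    (hs : tsupport f ⊆ unitCell d) (hd : Disjoint (tsupport f) (frontier ω)) :
    IsTestOff ω (periodize f) := by
  refine ⟨contDiff_periodize hf hK hs, isPeriodic_periodize f, ?_⟩
  rw [Set.disjoint_right] at hd ⊢
  intro y hy
  have h1 := notMem_tsupport_iff_eventuallyEq.1 (hd hy)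
  refine notMem_tsupport_iff_eventuallyEq.2 ?_
  filter_upwards [h1, (isOpen_unitCell d).mem_nhds (hω hy)] with z hz hzY
  rw [periodize_eq f hzY, hz]

/-- Smooth functions with compact support in the cell and off `∂ω` have zero trace. -/
theorem ofLipschitz_mem_zeroTrace_of_contDiff {d m : ℕ} {ω : Set (E d)}
    (hω : frontier ω ⊆ unitCell d) {f : E d → E m} (hf : ContDiff ℝ ((⊤ : ℕ∞) : WithTop ℕ∞) f)
    (hL : ∃ C, LipschitzWith C f) (hK : HasCompactSupport f) (hs : tsupport f ⊆ unitCell d)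
    (hd : Disjoint (tsupport f) (frontier ω)) : H1.ofLipschitz f hL hK hs ∈ zeroTrace m ω := by
  refine mem_zeroTrace_of_isTestOff (isTestOff_periodize hω hf hK hs hd)
    ((H1.fn_ofLipschitz hL hK hs).trans ?_)
  filter_upwards [ae_restrict_mem (measurableSet_unitCell d)] with y hy
  rw [periodize_eq f hy]

theorem lipschitzWith_mollify {d m : ℕ} {f : E d → E m} {C : ℝ≥0} (hf : LipschitzWith C f)
    (φ : ContDiffBump (0 : E d)) :
    LipschitzWith C (φ.normed volume ⋆[ContinuousLinearMap.lsmul ℝ ℝ, volume] f) := by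
  refine LipschitzWith.of_dist_le_mul fun x y => ?_
  have hex : ∀ z, Integrable (fun t => φ.normed volume t • f (z - t)) volume := fun z =>
    φ.hasCompactSupport_normed.convolutionExists_left (ContinuousLinearMap.lsmul ℝ ℝ)
      φ.continuous_normed hf.continuous.locallyIntegrable z
  rw [dist_eq_norm, convolution_def, convolution_def]
  simp only [ContinuousLinearMap.lsmul_apply]
  rw [← integral_sub (hex x) (hex y)]
  calc _ ≤ ∫ t, φ.normed volume t * (C * dist x y) := by
        refine norm_integral_le_of_norm_le (φ.integrable_normed.mul_const _)
          (Eventually.of_forall fun t => ?_)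
        rw [← smul_sub, norm_smul, Real.norm_of_nonneg (φ.nonneg_normed t)]
        refine mul_le_mul_of_nonneg_left ?_ (φ.nonneg_normed t)
        rw [← dist_eq_norm]
        exact (hf.dist_le_mul _ _).trans (by simp)
    _ = C * dist x y := by rw [integral_mul_const, φ.integral_normed, one_mul]

theorem tsupport_mollify_subset {d m : ℕ} {f : E d → E m} (φ : ContDiffBump (0 : E d)) :
    tsupport (φ.normed volume ⋆[ContinuousLinearMap.lsmul ℝ ℝ, volume] f) ⊆
      Metric.cthickening φ.rOut (tsupport f) := by
  refine closure_minimal ?_ Metric.isClosed_cthickening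
  refine (support_convolution_subset _).trans ?_
  rintro _ ⟨a, ha, b, hb, rfl⟩
  rw [φ.support_normed_eq, mem_ball_zero_iff] at ha
  refine Metric.mem_cthickening_of_dist_le _ b _ _ (subset_tsupport f hb) ?_
  simp only [dist_eq_norm, add_sub_cancel_right]
  exact ha.le

/-- Lipschitz functions with compact support in the cell and off `∂ω` have zero trace. -/
theorem ofLipschitz_mem_zeroTrace_of_disjoint {d m : ℕ} {ω : Set (E d)}
    (hω : frontier ω ⊆ unitCell d) {f : E d → E m} (hL : ∃ C, LipschitzWith C f)
    (hK : HasCompactSupport f) (hs : tsupport f ⊆ unitCell d)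
    (hd : Disjoint (tsupport f) (frontier ω)) : H1.ofLipschitz f hL hK hs ∈ zeroTrace m ω := by
  obtain ⟨C, hC⟩ := hL
  have hopen : IsOpen (unitCell d ∩ (frontier ω)ᶜ) :=
    (isOpen_unitCell d).inter isClosed_frontier.isOpen_compl
  obtain ⟨δ, hδ, hδs⟩ := IsCompact.exists_cthickening_subset_open hK hopen
    (subset_inter hs (disjoint_left.1 hd))
  have hthick : ∀ n, tsupport ((mollifier d hδ n).normed volume
      ⋆[ContinuousLinearMap.lsmul ℝ ℝ, volume] f) ⊆ Metric.cthickening δ (tsupport f) := fun n =>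
    (tsupport_mollify_subset _).trans (Metric.cthickening_mono (mollifier_rOut_le d hδ n) _)
  have hgK : ∀ n, HasCompactSupport ((mollifier d hδ n).normed volume
      ⋆[ContinuousLinearMap.lsmul ℝ ℝ, volume] f) := fun n =>
    IsCompact.of_isClosed_subset (IsCompact.cthickening hK) (isClosed_tsupport _) (hthick n)
  have hgs : ∀ n, tsupport ((mollifier d hδ n).normed volume
      ⋆[ContinuousLinearMap.lsmul ℝ ℝ, volume] f) ⊆ unitCell d := fun n y hy =>
    (hδs (hthick n hy)).1
  refine ofLipschitz_mem_of_tendsto (isClosed_zeroTrace m ω) ⟨C, hC⟩ hK hs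
    (fun n => lipschitzWith_mollify hC (mollifier d hδ n)) hgK hgs (fun n => ?_)
    (ε := fun n => C * (mollifier d hδ n).rOut) ?_ (fun n y => ?_)
  · exact ofLipschitz_mem_zeroTrace_of_contDiff hω
      ((mollifier d hδ n).hasCompactSupport_normed.contDiff_convolution_left _
        (mollifier d hδ n).contDiff_normed hC.continuous.locallyIntegrable) _ _ _
      (disjoint_left.2 fun y hy => (hδs (hthick n hy)).2)
  · simpa using (tendsto_mollifier_rOut d hδ).const_mul (C : ℝ)
  · rw [← dist_eq_norm]
    refine ContDiffBump.dist_normed_convolution_le hC.continuous.aestronglyMeasurable fun z hz => ?_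
    exact (hC.dist_le_mul _ _).trans (mul_le_mul_of_nonneg_left (Metric.mem_ball.1 hz).le C.2)

/-- The soft threshold at level `ε`, applied to each coordinate. -/
noncomputable def softThreshold {m : ℕ} (ε : ℝ) (z : E m) : E m :=
  toLp 2 fun β => z β - max (-ε) (min ε (z β))

theorem lipschitzWith_softThreshold {m : ℕ} (ε : ℝ) :
    LipschitzWith 1 (softThreshold ε : E m → E m) := by
  refine LipschitzWith.of_dist_le_mul fun x y => ?_
  rw [NNReal.coe_one, one_mul, EuclideanSpace.dist_eq, EuclideanSpace.dist_eq]
  refine Real.sqrt_le_sqrt (Finset.sum_le_sum fun β _ => pow_le_pow_left₀ dist_nonneg ?_ 2)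
  have key : ∀ a b : ℝ, a ≤ b → |(a - max (-ε) (min ε a)) - (b - max (-ε) (min ε b))| ≤ b - a := by
    intro a b hab
    rw [abs_le]
    rcases max_cases (-ε) (min ε a) with h1 | h1 <;> rcases max_cases (-ε) (min ε b) with h2 | h2 <;>
    rcases min_cases ε a with h3 | h3 <;> rcases min_cases ε b with h4 | h4 <;>
    constructor <;> linarith
  simp only [softThreshold, Real.dist_eq]
  rcases le_total (x β) (y β) with h | h
  · rw [abs_sub_comm (x β), abs_of_nonneg (sub_nonneg.2 h)]
    exact key _ _ h
  · rw [abs_of_nonneg (sub_nonneg.2 h), abs_sub_comm]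
    exact key _ _ h

theorem softThreshold_eq_zero {m : ℕ} {ε : ℝ} {z : E m} (h : ‖z‖ ≤ ε) : softThreshold ε z = 0 := by
  ext β
  have h1 := abs_le.1 ((PiLp.norm_apply_le z β).trans h)
  simp [softThreshold, min_eq_right h1.2, max_eq_right h1.1]

theorem norm_softThreshold_sub_le {m : ℕ} {ε : ℝ} (hε : 0 ≤ ε) (z : E m) :
    ‖softThreshold ε z - z‖ ≤ Real.sqrt m * ε := by
  rw [EuclideanSpace.norm_eq]
  refine Real.sqrt_le_iff.2 ⟨by positivity, ?_⟩
  rw [mul_pow, Real.sq_sqrt (Nat.cast_nonneg m)]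
  calc _ ≤ ∑ _β : Fin m, ε ^ 2 := by
        refine Finset.sum_le_sum fun β _ => pow_le_pow_left₀ (norm_nonneg _) ?_ 2
        have : (softThreshold ε z - z) β = -max (-ε) (min ε (z β)) := by
          simp [softThreshold]
        rw [this, norm_neg, Real.norm_eq_abs, abs_le]
        exact ⟨le_max_left _ _, max_le (by linarith) (min_le_left _ _)⟩
    _ = _ := by simp

/-- Lipschitz functions with compact support in the cell that vanish on `∂ω` have zero trace. -/
theorem ofLipschitz_mem_zeroTrace {d m : ℕ} {ω : Set (E d)}
    (hω : frontier ω ⊆ unitCell d) {f : E d → E m} (hL : ∃ C, LipschitzWith C f)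
    (hK : HasCompactSupport f) (hs : tsupport f ⊆ unitCell d)
    (hf0 : ∀ y ∈ frontier ω, f y = 0) : H1.ofLipschitz f hL hK hs ∈ zeroTrace m ω := by
  obtain ⟨C, hC⟩ := hL
  have hpos : ∀ n : ℕ, (0 : ℝ) < 1 / (n + 1) := fun n => by positivity
  have hsub : ∀ n : ℕ, tsupport (fun y => softThreshold (1 / (n + 1)) (f y)) ⊆ tsupport f :=
    fun n => closure_mono fun y hy h => hy (by
      simp only
      rw [h]
      exact softThreshold_eq_zero (by simpa using (hpos n).le))
  -- The soft thresholds of `f` vanish near `∂ω`, keep the Lipschitz constant and tend to `f`.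
  refine ofLipschitz_mem_of_tendsto (isClosed_zeroTrace m ω) ⟨C, hC⟩ hK hs
    (g := fun n y => softThreshold (1 / (n + 1)) (f y)) (C := 1 * C)
    (fun n => (lipschitzWith_softThreshold _).comp hC)
    (fun n => IsCompact.of_isClosed_subset hK (isClosed_tsupport _) (hsub n))
    (fun n => (hsub n).trans hs) (fun n => ?_) (ε := fun n => Real.sqrt m * (1 / (n + 1))) ?_
    (fun n y => norm_softThreshold_sub_le (hpos n).le _)
  · refine ofLipschitz_mem_zeroTrace_of_disjoint hω _ _ _ (disjoint_left.2 fun y hy hyf => ?_)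
    have hcl : IsClosed {y | 1 / ((n : ℝ) + 1) ≤ ‖f y‖} :=
      isClosed_le continuous_const hC.continuous.norm
    have h1 : tsupport (fun y => softThreshold (1 / ((n : ℝ) + 1)) (f y)) ⊆
        {y | 1 / ((n : ℝ) + 1) ≤ ‖f y‖} :=
      closure_minimal (fun z hz => by
        by_contra hcon
        exact hz (softThreshold_eq_zero (not_le.1 hcon).le)) hcl
    have h2 : 1 / ((n : ℝ) + 1) ≤ ‖f y‖ := h1 hy
    rw [hf0 y hyf, norm_zero] at h2
    exact absurd (hpos n) (not_lt.2 h2)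
  · simpa using (tendsto_one_div_add_atTop_nhds_zero_nat (𝕜 := ℝ)).const_mul (Real.sqrt m)

/-! ### Lipschitz graphs and reflections -/

/-- A Lipschitz map between Euclidean spaces of the same dimension increases volumes by a bounded
factor. -/
theorem volume_image_le {d : ℕ} {f : E d → E d} {K : ℝ≥0} (hf : LipschitzWith K f) (s : Set (E d)) :
    volume (f '' s) ≤ (K : ℝ≥0∞) ^ d * volume s := by
  have hH : Measure.IsAddHaarMeasure (Measure.hausdorffMeasure d : Measure (E d)) := by
    simpa using isAddHaarMeasure_hausdorffMeasure (E := E d)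
  rw [Measure.isAddLeftInvariant_eq_smul (volume : Measure (E d)) (Measure.hausdorffMeasure d)]
  simp only [Measure.smul_apply]
  have h := hf.hausdorffMeasure_image_le (d := d) (by simp) s
  rw [ENNReal.rpow_natCast] at h
  rw [ENNReal.smul_def, ENNReal.smul_def, smul_eq_mul, smul_eq_mul, mul_left_comm]
  gcongr

/-- Near `x`, in the ball of radius `r`, the set `S` is the region above the graph of a Lipschitz
function; `G` is that function, extended to be constant along the unit vector `n`. -/
structure IsGraphChart {d : ℕ} (S : Set (E d)) (x : E d) (r : ℝ) (n : E d) (G : E d → ℝ) (L : ℝ≥0) :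
    Prop where
  r_pos : 0 < r
  norm_eq : ‖n‖ = 1
  lipschitz : LipschitzWith L G
  invariant : ∀ y (t : ℝ), G (y + t • n) = G y
  mem_iff : ∀ y ∈ Metric.ball x r, y ∈ S ↔ G y < inner ℝ n y

/-- The reflection across the graph of `G` along `n`. -/
noncomputable def reflect {d : ℕ} (n : E d) (G : E d → ℝ) (y : E d) : E d :=
  y + (2 * (G y - inner ℝ n y)) • n

/-- The map that reflects the region below the graph of `G` to the region above it, and fixes the
points above the graph. -/
noncomputable def fold {d : ℕ} (n : E d) (G : E d → ℝ) (y : E d) : E d :=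
  y + (2 * max 0 (G y - inner ℝ n y)) • n

/-- The Lipschitz constant of `reflect` and `fold`. -/
noncomputable def foldConst (L : ℝ≥0) : ℝ≥0 := 1 + 2 * (L + 1)

section Graph

variable {d : ℕ} {n : E d} {G : E d → ℝ} {L : ℝ≥0}

theorem abs_height_sub_le (hn : ‖n‖ = 1) (hG : LipschitzWith L G) (x y : E d) :
    |(G x - inner ℝ n x) - (G y - inner ℝ n y)| ≤ (L + 1) * dist x y := by
  have h1 := hG.dist_le_mul x y
  rw [Real.dist_eq] at h1
  have h2 := abs_real_inner_le_norm n (x - y)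
  rw [hn, one_mul, inner_sub_right, ← dist_eq_norm] at h2
  calc _ = |(G x - G y) - (inner ℝ n x - inner ℝ n y)| := by congr 1; ring
    _ ≤ |G x - G y| + |inner ℝ n x - inner ℝ n y| := abs_sub _ _
    _ ≤ _ := by rw [add_mul, one_mul]; exact add_le_add h1 h2

theorem lipschitzWith_add_smul (hn : ‖n‖ = 1) {h : E d → ℝ}
    (hh : ∀ x y, |h x - h y| ≤ (L + 1) * dist x y) :
    LipschitzWith (foldConst L) fun y => y + (2 * h y) • n := by
  refine LipschitzWith.of_dist_le_mul fun x y => ?_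
  rw [dist_eq_norm]
  have e : x + (2 * h x) • n - (y + (2 * h y) • n) = (x - y) + (2 * (h x - h y)) • n := by
    module
  rw [e]
  refine (norm_add_le _ _).trans ?_
  rw [norm_smul, hn, mul_one, Real.norm_eq_abs, abs_mul, abs_two, ← dist_eq_norm]
  have := hh x y
  simp only [foldConst, NNReal.coe_add, NNReal.coe_one, NNReal.coe_mul, NNReal.coe_ofNat]
  linarith

theorem lipschitzWith_reflect (hn : ‖n‖ = 1) (hG : LipschitzWith L G) :
    LipschitzWith (foldConst L) (reflect n G) :=
  lipschitzWith_add_smul hn (abs_height_sub_le hn hG)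

theorem lipschitzWith_fold (hn : ‖n‖ = 1) (hG : LipschitzWith L G) :
    LipschitzWith (foldConst L) (fold n G) :=
  lipschitzWith_add_smul hn fun x y => by
    have h := abs_max_sub_max_le_abs (G x - inner ℝ n x) (G y - inner ℝ n y) (0 : ℝ)
    rw [max_comm _ (0 : ℝ), max_comm _ (0 : ℝ)] at h
    exact h.trans (abs_height_sub_le hn hG x y)

theorem inner_reflect (hn : ‖n‖ = 1) (y : E d) :
    inner ℝ n (reflect n G y) = 2 * G y - inner ℝ n y := by
  rw [reflect, inner_add_right, inner_smul_right, real_inner_self_eq_norm_sq, hn]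
  ring

theorem reflect_reflect (hn : ‖n‖ = 1) (hinv : ∀ y (t : ℝ), G (y + t • n) = G y) (y : E d) :
    reflect n G (reflect n G y) = y := by
  have h1 : G (reflect n G y) = G y := hinv y _
  conv_lhs => rw [reflect]
  rw [h1, inner_reflect hn, reflect]
  module

theorem fold_of_le {y : E d} (h : G y ≤ inner ℝ n y) : fold n G y = y := by
  rw [fold, max_eq_left (by linarith)]
  simp

theorem fold_of_ge {y : E d} (h : inner ℝ n y ≤ G y) : fold n G y = reflect n G y := by
  rw [fold, max_eq_right (by linarith), reflect]

/-- A Lipschitz graph is a null set, as its translates are disjoint. -/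
theorem volume_graph_eq_zero (hn : ‖n‖ = 1) (hG : LipschitzWith L G)
    (hinv : ∀ y (t : ℝ), G (y + t • n) = G y) :
    volume {y : E d | G y = inner ℝ n y} = 0 := by
  by_contra hne
  have hmeas : Measurable fun y : E d => G y - inner ℝ n y :=
    (hG.continuous.sub (by fun_prop)).measurable
  have hc := Measure.countable_meas_level_set_pos (μ := (volume : Measure (E d))) hmeas
  have huniv : {t : ℝ | 0 < volume {y : E d | G y - inner ℝ n y = t}} = univ := by
    refine eq_univ_of_forall fun t => ?_
    have h1 : {y : E d | G y - inner ℝ n y = t} =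
        (fun y => y + t • n) ⁻¹' {y : E d | G y = inner ℝ n y} := by
      ext y
      simp only [mem_ofPred_eq, mem_preimage, hinv, inner_add_right, inner_smul_right,
        real_inner_self_eq_norm_sq, hn]
      constructor <;> intro h <;> linarith
    change 0 < volume {y : E d | G y - inner ℝ n y = t}
    rw [h1, measure_preimage_add_right]
    exact pos_iff_ne_zero.2 hne
  rw [huniv] at hc
  exact not_countable_univ hc

theorem map_reflect_le (hn : ‖n‖ = 1) (hG : LipschitzWith L G)
    (hinv : ∀ y (t : ℝ), G (y + t • n) = G y) :
    Measure.map (reflect n G) volume ≤ ((foldConst L : ℝ≥0∞) ^ d) • (volume : Measure (E d)) := by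
  have hR := lipschitzWith_reflect hn hG
  refine Measure.le_iff.2 fun s hs => ?_
  rw [Measure.map_apply hR.continuous.measurable hs, Measure.smul_apply, smul_eq_mul]
  have : reflect n G ⁻¹' s = reflect n G '' s :=
    (image_eq_preimage_of_inverse (reflect_reflect hn hinv) (reflect_reflect hn hinv)).symm ▸ rfl
  rw [this]
  exact volume_image_le hR s

/-- Change of variables under the folding map. -/
theorem lintegral_fold_le {S : Set (E d)} (hS : MeasurableSet S) {x : E d} {r : ℝ}
    (hc : IsGraphChart S x r n G L) {B : Set (E d)} (hB : MeasurableSet B)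
    (hBr : ∀ y ∈ B, y ∈ Metric.ball x r ∧ fold n G y ∈ Metric.ball x r) {f : E d → ℝ≥0∞}
    (hf : Measurable f) :
    ∫⁻ y in B, f (fold n G y) ≤ (1 + (foldConst L : ℝ≥0∞) ^ d) * ∫⁻ y in S, f y := by
  have hR := (lipschitzWith_reflect hc.norm_eq hc.lipschitz).continuous.measurable
  have hind : Measurable (S.indicator f) := hf.indicator hS
  calc ∫⁻ y in B, f (fold n G y)
      ≤ ∫⁻ y in B, (S.indicator f y + S.indicator f (reflect n G y)) := by
        refine lintegral_mono_ae ((ae_restrict_iff' hB).2 ?_)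
        filter_upwards [measure_eq_zero_iff_ae_notMem.1
          (volume_graph_eq_zero hc.norm_eq hc.lipschitz hc.invariant)] with y hy hyB
        obtain ⟨h1, h2⟩ := hBr y hyB
        rcases lt_or_gt_of_ne (show G y ≠ inner ℝ n y from hy) with h | h
        · rw [fold_of_le h.le, indicator_of_mem ((hc.mem_iff y h1).2 h)]
          exact le_self_add
        · rw [fold_of_ge h.le] at h2 ⊢
          have : reflect n G y ∈ S := by
            refine (hc.mem_iff _ h2).2 ?_
            rw [inner_reflect hc.norm_eq, show G (reflect n G y) = G y from hc.invariant y _]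
            linarith
          rw [indicator_of_mem this]
          exact le_add_self
    _ ≤ ∫⁻ y, (S.indicator f y + S.indicator f (reflect n G y)) := setLIntegral_le_lintegral _ _
    _ = (∫⁻ y, S.indicator f y) + ∫⁻ y, S.indicator f y ∂(Measure.map (reflect n G) volume) := by
        rw [lintegral_add_left hind, lintegral_map hind hR]
    _ ≤ (∫⁻ y, S.indicator f y) + (foldConst L : ℝ≥0∞) ^ d * ∫⁻ y, S.indicator f y := by
        refine add_le_add le_rfl ?_
        refine (lintegral_mono' (map_reflect_le hc.norm_eq hc.lipschitz hc.invariant)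
          le_rfl).trans ?_
        rw [lintegral_smul_measure, smul_eq_mul]
    _ = _ := by rw [lintegral_indicator hS]; ring

end Graph

/-! ### Local extension across a Lipschitz boundary -/

/-- The squared `H¹` norm of `f` on `U`. -/
noncomputable def energy {d m : ℕ} (U : Set (E d)) (f : E d → E m) : ℝ≥0∞ :=
  ∫⁻ y in U, (‖f y‖ₑ ^ 2 + ‖fderiv ℝ f y‖ₑ ^ 2)

theorem enorm_add_sq_le {V : Type*} [SeminormedAddCommGroup V] (a b : V) :
    ‖a + b‖ₑ ^ 2 ≤ 2 * (‖a‖ₑ ^ 2 + ‖b‖ₑ ^ 2) := by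
  simp only [enorm_eq_nnnorm]
  norm_cast
  have h1 := nnnorm_add_le a b
  have h2 : (‖a + b‖₊ : ℝ) ≤ ‖a‖₊ + ‖b‖₊ := by exact_mod_cast h1
  rw [← NNReal.coe_le_coe]
  push_cast at h2 ⊢
  nlinarith [sq_nonneg (‖a‖ - ‖b‖), norm_nonneg (a + b)]

theorem energy_congr {d m : ℕ} {U : Set (E d)} (hU : IsOpen U) {f g : E d → E m}
    (h : EqOn f g U) : energy U f = energy U g := by
  refine setLIntegral_congr_fun hU.measurableSet fun y hy => ?_
  have : f =ᶠ[𝓝 y] g := by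
    filter_upwards [hU.mem_nhds hy] with z hz using h hz
  simp only [h hy, this.fderiv_eq]

theorem energy_add_le {d m : ℕ} {U : Set (E d)} {f g : E d → E m}
    (hf : ∃ C, LipschitzWith C f) (hg : ∃ C, LipschitzWith C g) :
    energy U (f + g) ≤ 2 * (energy U f + energy U g) := by
  obtain ⟨C, hC⟩ := hf
  obtain ⟨D, hD⟩ := hg
  have hmf : Measurable fun y => ‖f y‖ₑ ^ 2 + ‖fderiv ℝ f y‖ₑ ^ 2 :=
    (hC.continuous.measurable.enorm.pow_const 2).add ((measurable_fderiv ℝ f).enorm.pow_const 2)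
  rw [energy, energy, energy, ← lintegral_add_left hmf, ← lintegral_const_mul' _ _ (by simp)]
  refine lintegral_mono_ae ?_
  filter_upwards [ae_restrict_of_ae hC.ae_differentiableAt, ae_restrict_of_ae hD.ae_differentiableAt]
    with y h1 h2
  rw [fderiv_add h1 h2]
  calc _ ≤ 2 * (‖f y‖ₑ ^ 2 + ‖g y‖ₑ ^ 2) + 2 * (‖fderiv ℝ f y‖ₑ ^ 2 + ‖fderiv ℝ g y‖ₑ ^ 2) :=
        add_le_add (enorm_add_sq_le _ _) (enorm_add_sq_le _ _)
    _ = _ := by ring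

theorem enorm_smul_energy_le {d m : ℕ} {η : E d → ℝ} {f : E d → E m} {M : ℝ≥0} {y : E d}
    (hη : DifferentiableAt ℝ η y) (hf : DifferentiableAt ℝ f y) (h1 : ‖η y‖ₑ ≤ M)
    (h2 : ‖fderiv ℝ η y‖ₑ ≤ M) :
    ‖η y • f y‖ₑ ^ 2 + ‖fderiv ℝ (fun z => η z • f z) y‖ₑ ^ 2 ≤
      4 * M ^ 2 * (‖f y‖ₑ ^ 2 + ‖fderiv ℝ f y‖ₑ ^ 2) := by
  rw [fderiv_fun_smul hη hf]
  have a1 : ‖η y • f y‖ₑ ^ 2 ≤ M ^ 2 * ‖f y‖ₑ ^ 2 := by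
    rw [enorm_smul, mul_pow]; gcongr
  have a2 : ‖η y • fderiv ℝ f y‖ₑ ^ 2 ≤ M ^ 2 * ‖fderiv ℝ f y‖ₑ ^ 2 := by
    rw [enorm_smul, mul_pow]; gcongr
  have a3 : ‖(fderiv ℝ η y).smulRight (f y)‖ₑ ^ 2 ≤ M ^ 2 * ‖f y‖ₑ ^ 2 := by
    have : ‖(fderiv ℝ η y).smulRight (f y)‖ₑ = ‖fderiv ℝ η y‖ₑ * ‖f y‖ₑ := by
      simp only [enorm_eq_nnnorm, ContinuousLinearMap.nnnorm_smulRight_apply, ENNReal.coe_mul]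
    rw [this, mul_pow]; gcongr
  calc _ ≤ M ^ 2 * ‖f y‖ₑ ^ 2 + 2 * (M ^ 2 * ‖fderiv ℝ f y‖ₑ ^ 2 + M ^ 2 * ‖f y‖ₑ ^ 2) :=
        add_le_add a1 ((enorm_add_sq_le _ _).trans (by gcongr))
    _ = M ^ 2 * (3 * ‖f y‖ₑ ^ 2 + 2 * ‖fderiv ℝ f y‖ₑ ^ 2) := by ring
    _ ≤ M ^ 2 * (4 * ‖f y‖ₑ ^ 2 + 4 * ‖fderiv ℝ f y‖ₑ ^ 2) := by
        gcongr <;> norm_num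
    _ = _ := by ring

theorem energy_smul_le {d m : ℕ} {U : Set (E d)} {η : E d → ℝ} {f : E d → E m} {M : ℝ≥0}
    (hη : Differentiable ℝ η) (hf : Differentiable ℝ f) (h1 : ∀ y, ‖η y‖ₑ ≤ M)
    (h2 : ∀ y, ‖fderiv ℝ η y‖ₑ ≤ M) :
    energy U (fun y => η y • f y) ≤ 4 * M ^ 2 * energy U f := by
  rw [energy, energy, ← lintegral_const_mul' _ _ (by
    exact ENNReal.mul_ne_top (by simp) (by simp))]
  exact lintegral_mono fun y => enorm_smul_energy_le (hη y) (hf y) (h1 y) (h2 y)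

/-- A common bound for a compactly supported smooth function and its derivative. -/
theorem exists_enorm_le {d : ℕ} {η : E d → ℝ} (hη : ContDiff ℝ ((⊤ : ℕ∞) : WithTop ℕ∞) η)
    (hK : HasCompactSupport η) :
    ∃ M : ℝ≥0, (∀ y, ‖η y‖ₑ ≤ M) ∧ ∀ y, ‖fderiv ℝ η y‖ₑ ≤ M := by
  obtain ⟨A, hA⟩ := hK.exists_bound_of_continuous hη.continuous
  obtain ⟨B, hB⟩ := (hK.fderiv ℝ).exists_bound_of_continuous (hη.continuous_fderiv (by simp))
  refine ⟨Real.toNNReal (max A B), fun y => ?_, fun y => ?_⟩ <;>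
    rw [← ofReal_norm, ENNReal.ofReal] <;>
    refine ENNReal.coe_le_coe.2 (Real.toNNReal_le_toNNReal ?_)
  · exact (hA y).trans (le_max_left _ _)
  · exact (hB y).trans (le_max_right _ _)

theorem exists_lipschitzWith_smul {d m : ℕ} {η : E d → ℝ} {f : E d → E m}
    (hη : ContDiff ℝ ((⊤ : ℕ∞) : WithTop ℕ∞) η) (hK : HasCompactSupport η)
    (hf : ∃ C, LipschitzWith C f) (hb : ∃ B, ∀ y, ‖f y‖ ≤ B) :
    ∃ C, LipschitzWith C fun y => η y • f y := by
  obtain ⟨C, hC⟩ := hf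
  obtain ⟨B, hB⟩ := hb
  obtain ⟨D, hD⟩ := (hη.of_le (show (1 : WithTop ℕ∞) ≤ ((⊤ : ℕ∞) : WithTop ℕ∞) by
    exact_mod_cast le_top)).lipschitzWith_of_hasCompactSupport hK (by simp)
  obtain ⟨A, hA⟩ := hK.exists_bound_of_continuous hη.continuous
  have hB0 : 0 ≤ B := (norm_nonneg _).trans (hB 0)
  have hA0 : 0 ≤ A := (norm_nonneg _).trans (hA 0)
  refine ⟨⟨A * C + D * B, by positivity⟩, LipschitzWith.of_dist_le_mul fun x y => ?_⟩
  have e : η x • f x - η y • f y = η x • (f x - f y) + (η x - η y) • f y := by module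
  rw [dist_eq_norm, e]
  refine (norm_add_le _ _).trans ?_
  change _ ≤ (A * C + D * B) * dist x y
  rw [norm_smul, norm_smul, add_mul]
  have h1 := hC.dist_le_mul x y
  have h2 := hD.dist_le_mul x y
  rw [dist_eq_norm] at h1 h2
  refine add_le_add ?_ ?_
  · rw [mul_assoc]
    exact mul_le_mul (hA x) h1 (norm_nonneg _) hA0
  · rw [mul_right_comm]
    exact mul_le_mul h2 (hB y) (norm_nonneg _) (by positivity)

/-- Near the compact set `s`, functions can be split as `v = w + (v - w)` with `w` vanishing on `S`
and `v - w` controlled by `v` on `S`; the splitting is localized by a cutoff `θ`. -/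
def HasLocalExtension {d : ℕ} (m : ℕ) (S s : Set (E d)) : Prop :=
  ∃ θ : E d → ℝ, ContDiff ℝ ((⊤ : ℕ∞) : WithTop ℕ∞) θ ∧ HasCompactSupport θ ∧
    tsupport θ ⊆ unitCell d ∧ (∃ U, IsOpen U ∧ s ⊆ U ∧ ∀ y ∈ U, θ y = 1) ∧
    ∃ C : ℝ≥0, ∀ v : E d → E m, ContDiff ℝ ((⊤ : ℕ∞) : WithTop ℕ∞) v → HasCompactSupport v →
      ∃ w : E d → E m, (∃ K, LipschitzWith K w) ∧ HasCompactSupport w ∧ tsupport w ⊆ unitCell d ∧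
        (∀ y ∈ S, w y = 0) ∧ energy (unitCell d) ((fun y => θ y • v y) - w) ≤ C * energy S v

theorem exists_lipschitzWith_of_contDiff {d : ℕ} {V : Type*} [NormedAddCommGroup V]
    [NormedSpace ℝ V] {v : E d → V} (hv : ContDiff ℝ ((⊤ : ℕ∞) : WithTop ℕ∞) v)
    (hK : HasCompactSupport v) : ∃ C, LipschitzWith C v :=
  (hv.of_le (show (1 : WithTop ℕ∞) ≤ ((⊤ : ℕ∞) : WithTop ℕ∞) by
    exact_mod_cast le_top)).lipschitzWith_of_hasCompactSupport hK (by simp)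

theorem hasLocalExtension_empty {d : ℕ} (m : ℕ) (S : Set (E d)) : HasLocalExtension m S ∅ := by
  refine ⟨0, contDiff_const, HasCompactSupport.zero, by simp, ⟨∅, isOpen_empty, subset_rfl, by simp⟩,
    0, fun v _ _ => ⟨0, ⟨0, LipschitzWith.const 0⟩, HasCompactSupport.zero, by simp, by simp, ?_⟩⟩
  have : ((fun y => (0 : E d → ℝ) y • v y) - 0 : E d → E m) = fun _ => 0 := by
    funext y; simp
  rw [this]
  simp [energy, enorm_eq_nnnorm]

/-- Local extensions are glued through the cutoff `θ + η - θη`: the splitting for `η` is applied to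
the part `(1 - θ) v` that the splitting for `θ` leaves over. -/
theorem HasLocalExtension.union {d m : ℕ} {S s t : Set (E d)} (hs : HasLocalExtension m S s)
    (ht : HasLocalExtension m S t) : HasLocalExtension m S (s ∪ t) := by
  obtain ⟨θ, hθ, hθK, hθs, ⟨U, hU, hsU, hθU⟩, C, hC⟩ := hs
  obtain ⟨η, hη, hηK, hηs, ⟨V, hV, htV, hηV⟩, D, hD⟩ := ht
  obtain ⟨M, hM1, hM2⟩ := exists_enorm_le hθ hθK
  have hsub : tsupport (fun y => θ y + η y - θ y * η y) ⊆ tsupport θ ∪ tsupport η := by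
    refine closure_minimal (fun y hy => ?_) ((isClosed_tsupport θ).union (isClosed_tsupport η))
    by_contra hcon
    rw [mem_union, not_or] at hcon
    refine hy ?_
    simp [image_eq_zero_of_notMem_tsupport hcon.1, image_eq_zero_of_notMem_tsupport hcon.2]
  refine ⟨fun y => θ y + η y - θ y * η y, (hθ.add hη).sub (hθ.mul hη),
    IsCompact.of_isClosed_subset (hθK.isCompact.union hηK) (isClosed_tsupport _) hsub,
    hsub.trans (union_subset hθs hηs), ⟨U ∪ V, hU.union hV, union_subset_union hsU htV, ?_⟩,
    2 * (C + D * (4 * (1 + M) ^ 2)), fun v hv hvK => ?_⟩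
  · rintro y (hy | hy)
    · simp only [hθU y hy]; ring
    · simp only [hηV y hy]; ring
  · obtain ⟨w₁, hw1, hw1K, hw1s, hw1S, hw1E⟩ := hC v hv hvK
    have hψ : ContDiff ℝ ((⊤ : ℕ∞) : WithTop ℕ∞) fun y => 1 - θ y := contDiff_const.sub hθ
    have hv2 : ContDiff ℝ ((⊤ : ℕ∞) : WithTop ℕ∞) fun y => (1 - θ y) • v y := hψ.smul hv
    have hv2K : HasCompactSupport fun y => (1 - θ y) • v y :=
      HasCompactSupport.smul_left (f := fun y => 1 - θ y) hvK
    obtain ⟨w₂, hw2, hw2K, hw2s, hw2S, hw2E⟩ := hD _ hv2 hv2K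
    have hE2 : energy S (fun y => (1 - θ y) • v y) ≤ 4 * ((1 + M : ℝ≥0) : ℝ≥0∞) ^ 2 * energy S v := by
      refine energy_smul_le (hψ.differentiable (by simp)) (hv.differentiable (by simp))
        (fun y => ?_) fun y => ?_
      · refine (enorm_sub_le).trans ?_
        push_cast
        exact add_le_add (by simp) (hM1 y)
      · rw [fderiv_const_sub, enorm_neg]
        refine (hM2 y).trans ?_
        push_cast
        exact le_add_self
    obtain ⟨K1, hK1⟩ := hw1
    obtain ⟨K2, hK2⟩ := hw2
    obtain ⟨K3, hK3⟩ := exists_lipschitzWith_of_contDiff (hθ.smul hv) hθK.smul_right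
    obtain ⟨K4, hK4⟩ := exists_lipschitzWith_of_contDiff (hη.smul hv2) hηK.smul_right
    refine ⟨w₁ + w₂, ⟨K1 + K2, hK1.add hK2⟩, hw1K.add hw2K,
      (tsupport_add _ _).trans (union_subset hw1s hw2s),
      fun y hy => by simp [hw1S y hy, hw2S y hy], ?_⟩
    have e : ((fun y => (θ y + η y - θ y * η y) • v y) - (w₁ + w₂)) =
        ((fun y => θ y • v y) - w₁) + ((fun y => η y • (1 - θ y) • v y) - w₂) := by
      funext y
      simp only [Pi.sub_apply, Pi.add_apply]
      module
    rw [e]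
    refine (energy_add_le ⟨_, hK3.sub hK1⟩ ⟨_, hK4.sub hK2⟩).trans ?_
    push_cast
    calc _ ≤ 2 * (C * energy S v + D * (4 * ((1 + M : ℝ≥0) : ℝ≥0∞) ^ 2 * energy S v)) := by
          exact mul_le_mul' le_rfl (add_le_add hw1E (hw2E.trans (mul_le_mul' le_rfl hE2)))
      _ = _ := by push_cast; ring

/-- Local extension across a Lipschitz graph, by reflection. The correction is `η (v - v ∘ fold)`:
it vanishes on `S`, where `fold` is the identity, and leaves `η (v ∘ fold)`, which depends only on
the values of `v` in `S`. -/
theorem IsGraphChart.exists_hasLocalExtension {d m : ℕ} {S : Set (E d)} (hS : MeasurableSet S)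
    {x n : E d} {r : ℝ} {G : E d → ℝ} {L : ℝ≥0} (hc : IsGraphChart S x r n G L)
    (hx : G x = inner ℝ n x) (hr : Metric.ball x r ⊆ unitCell d) :
    ∃ t ∈ 𝓝 x, HasLocalExtension m S t := by
  set K := foldConst L with hK
  have hK1 : (1 : ℝ) ≤ K := by
    have : (1 : ℝ≥0) ≤ K := le_self_add
    exact_mod_cast this
  have hr0 := hc.r_pos
  have hKpos : (0 : ℝ) < K := lt_of_lt_of_le one_pos hK1
  -- As `fold` is `K`-Lipschitz and fixes `x`, it maps the support of `η` into the ball of radius `r`.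
  let η : ContDiffBump x :=
    { rIn := r / (4 * K), rOut := r / (2 * K), rIn_pos := by positivity
      rIn_lt_rOut := by
        apply div_lt_div_of_pos_left hr0 (by positivity)
        linarith }
  have hT := lipschitzWith_fold hc.norm_eq hc.lipschitz
  have hTx : fold n G x = x := fold_of_le hx.le
  have hB : ∀ y ∈ tsupport η, y ∈ Metric.ball x r ∧ fold n G y ∈ Metric.ball x r := by
    intro y hy
    rw [η.tsupport_eq, Metric.mem_closedBall] at hy
    change dist y x ≤ r / (2 * K) at hy
    have h1 : r / (2 * K) ≤ r / 2 := by
      apply div_le_div_of_nonneg_left hr0.le (by norm_num)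
      linarith
    have h2 := hT.dist_le_mul y x
    rw [hTx, ← hK] at h2
    have h3 : (K : ℝ) * (r / (2 * K)) = r / 2 := by field_simp
    refine ⟨Metric.mem_ball.2 (by linarith), Metric.mem_ball.2 ?_⟩
    have h4 := mul_le_mul_of_nonneg_left hy hKpos.le
    linarith
  have hηc : ContDiff ℝ ((⊤ : ℕ∞) : WithTop ℕ∞) η := η.contDiff
  obtain ⟨M, hM1, hM2⟩ := exists_enorm_le hηc η.hasCompactSupport
  refine ⟨Metric.ball x (r / (4 * K)), Metric.ball_mem_nhds x (by positivity), η, hηc,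
    η.hasCompactSupport, fun y hy => hr (hB y hy).1, ⟨_, Metric.isOpen_ball, subset_rfl,
      fun y hy => η.one_of_mem_closedBall (Metric.ball_subset_closedBall hy)⟩,
    4 * M ^ 2 * (1 + K ^ 2) * (1 + K ^ d), fun v hv hvK => ?_⟩
  obtain ⟨Cv, hCv⟩ := exists_lipschitzWith_of_contDiff hv hvK
  obtain ⟨Bv, hBv⟩ := hvK.exists_bound_of_continuous hv.continuous
  have hvT : LipschitzWith (Cv * K) fun y => v (fold n G y) := hCv.comp hT
  have hsub : tsupport (fun y => η y • (v y - v (fold n G y))) ⊆ tsupport η :=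
    closure_mono fun y hy h => hy (by simp [h])
  refine ⟨fun y => η y • (v y - v (fold n G y)),
    exists_lipschitzWith_smul hηc η.hasCompactSupport ⟨_, hCv.sub hvT⟩
      ⟨Bv + Bv, fun y => (norm_sub_le _ _).trans (add_le_add (hBv _) (hBv _))⟩,
    η.hasCompactSupport.smul_right, fun y hy => hr (hB y (hsub hy)).1, fun y hy => ?_, ?_⟩
  · by_cases hyη : y ∈ tsupport η
    · simp only [fold_of_le ((hc.mem_iff y (hB y hyη).1).1 hy).le, sub_self, smul_zero]
    · simp only [image_eq_zero_of_notMem_tsupport hyη, zero_smul]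
  · have e : ((fun y => η y • v y) - fun y => η y • (v y - v (fold n G y))) =
        fun y => η y • v (fold n G y) := by
      funext y
      simp only [Pi.sub_apply]
      module
    rw [e]
    have hmv : Measurable fun y => ‖v y‖ₑ ^ 2 + ‖fderiv ℝ v y‖ₑ ^ 2 :=
      (hv.continuous.measurable.enorm.pow_const 2).add ((measurable_fderiv ℝ v).enorm.pow_const 2)
    have hpt : ∀ᵐ y ∂(volume : Measure (E d)),
        ‖η y • v (fold n G y)‖ₑ ^ 2 + ‖fderiv ℝ (fun y => η y • v (fold n G y)) y‖ₑ ^ 2 ≤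
          (tsupport η).indicator (fun y => (4 * M ^ 2 * (1 + K ^ 2) : ℝ≥0∞) *
            (‖v (fold n G y)‖ₑ ^ 2 + ‖fderiv ℝ v (fold n G y)‖ₑ ^ 2)) y := by
      filter_upwards [hT.ae_differentiableAt] with y hy
      by_cases hyη : y ∈ tsupport η
      · rw [indicator_of_mem hyη]
        have hvd : DifferentiableAt ℝ v (fold n G y) := hv.differentiable (by simp) _
        have hcomp : DifferentiableAt ℝ (fun y => v (fold n G y)) y := hvd.comp y hy
        refine (enorm_smul_energy_le (hηc.differentiable (by simp) y) hcomp (hM1 y)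
          (hM2 y)).trans ?_
        rw [mul_assoc (4 * (M : ℝ≥0∞) ^ 2)]
        gcongr
        have h1 : fderiv ℝ (fun y => v (fold n G y)) y =
            (fderiv ℝ v (fold n G y)).comp (fderiv ℝ (fold n G) y) := fderiv_comp y hvd hy
        have h2 : ‖fderiv ℝ (fold n G) y‖₊ ≤ K := norm_fderiv_le_of_lipschitz ℝ hT
        have h3 : ‖fderiv ℝ (fun y => v (fold n G y)) y‖ₑ ≤ ‖fderiv ℝ v (fold n G y)‖ₑ * K := by
          rw [h1, enorm_eq_nnnorm, enorm_eq_nnnorm, ← ENNReal.coe_mul]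
          exact ENNReal.coe_le_coe.2 ((ContinuousLinearMap.opNNNorm_comp_le _ _).trans
            (by gcongr))
        calc _ ≤ ‖v (fold n G y)‖ₑ ^ 2 + (‖fderiv ℝ v (fold n G y)‖ₑ * K) ^ 2 := by gcongr
          _ = ‖v (fold n G y)‖ₑ ^ 2 + K ^ 2 * ‖fderiv ℝ v (fold n G y)‖ₑ ^ 2 := by ring
          _ ≤ (1 + K ^ 2) * ‖v (fold n G y)‖ₑ ^ 2 +
              (1 + K ^ 2) * ‖fderiv ℝ v (fold n G y)‖ₑ ^ 2 := by
            gcongr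
            · exact le_mul_of_one_le_left zero_le le_self_add
            · exact le_add_self
          _ = _ := by ring
      · have h0 : (fun y => η y • v (fold n G y)) =ᶠ[𝓝 y] fun _ => 0 := by
          filter_upwards [notMem_tsupport_iff_eventuallyEq.1 hyη] with z hz
          rw [hz]
          simp
        rw [indicator_of_notMem hyη, h0.fderiv_eq, image_eq_zero_of_notMem_tsupport hyη, zero_smul]
        simp [enorm_eq_nnnorm]
    calc energy (unitCell d) (fun y => η y • v (fold n G y))
        ≤ ∫⁻ y, (‖η y • v (fold n G y)‖ₑ ^ 2 +
            ‖fderiv ℝ (fun y => η y • v (fold n G y)) y‖ₑ ^ 2) := setLIntegral_le_lintegral _ _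
      _ ≤ _ := lintegral_mono_ae hpt
      _ = (4 * M ^ 2 * (1 + K ^ 2) : ℝ≥0∞) * ∫⁻ y in tsupport η,
            (fun y => ‖v y‖ₑ ^ 2 + ‖fderiv ℝ v y‖ₑ ^ 2) (fold n G y) := by
          rw [lintegral_indicator (isClosed_tsupport η).measurableSet, lintegral_const_mul' _ _ (by
            exact ENNReal.mul_ne_top (ENNReal.mul_ne_top (by simp) (by simp)) (by simp))]
      _ ≤ (4 * M ^ 2 * (1 + K ^ 2) : ℝ≥0∞) * ((1 + (K : ℝ≥0∞) ^ d) * energy S v) := by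
          gcongr
          exact lintegral_fold_le hS hc (isClosed_tsupport η).measurableSet hB hmv
      _ = _ := by push_cast; ring

/-- Local extension near a compact set covered by Lipschitz graphs. -/
theorem hasLocalExtension_of_isCompact {d : ℕ} (m : ℕ) {S s : Set (E d)} (hS : MeasurableSet S)
    (hs : IsCompact s) (h : ∀ x ∈ s, ∃ (n : E d) (r : ℝ) (G : E d → ℝ) (L : ℝ≥0),
      IsGraphChart S x r n G L ∧ G x = inner ℝ n x ∧ Metric.ball x r ⊆ unitCell d) :
    HasLocalExtension m S s := by
  refine hs.induction_on (hasLocalExtension_empty m S) ?_ (fun s t hs ht => hs.union ht) ?_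
  · rintro s t hst ⟨θ, h1, h2, h3, ⟨U, hU, htU, hθU⟩, h4⟩
    exact ⟨θ, h1, h2, h3, ⟨U, hU, hst.trans htU, hθU⟩, h4⟩
  · intro x hx
    obtain ⟨n, r, G, L, hc, hx', hr⟩ := h x hx
    obtain ⟨t, ht, hE⟩ := hc.exists_hasLocalExtension (m := m) hS hx' hr
    exact ⟨t, mem_nhdsWithin_of_mem_nhds ht, hE⟩

/-! ### Geometry of the inclusion -/

namespace IsInclusion

variable {d : ℕ} {ω : Set (E d)}

theorem closure_subset (hω : IsInclusion ω) : closure ω ⊆ unitCell d := by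
  intro z hz
  by_contra hzY
  have hzf : z ∈ frontier (unitCell d) := by
    rw [(isOpen_unitCell d).frontier_eq]
    exact ⟨closure_mono hω.subset hz, hzY⟩
  obtain ⟨r, hr, h⟩ := hω.dist_pos
  obtain ⟨x, hx, hxz⟩ := Metric.mem_closure_iff.1 hz r hr
  have := h x hx z hzf
  rw [dist_comm] at this
  linarith

theorem frontier_subset (hω : IsInclusion ω) : frontier ω ⊆ unitCell d :=
  frontier_subset_closure.trans hω.closure_subset

theorem isCompact_closure (hω : IsInclusion ω) : IsCompact (closure ω) :=
  (isCompact_closedBall (0 : E d) (Real.sqrt d)).of_isClosed_subset isClosed_closure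
    (hω.closure_subset.trans (unitCell_subset_closedBall d))

theorem isCompact_frontier (hω : IsInclusion ω) : IsCompact (frontier ω) :=
  hω.isCompact_closure.of_isClosed_subset isClosed_frontier frontier_subset_closure

theorem isOpen_background (_hω : IsInclusion ω) : IsOpen (unitCell d \ closure ω) :=
  (isOpen_unitCell d).sdiff isClosed_closure

/-- The inclusion has Lipschitz charts, in balls contained in the cell. -/
theorem exists_chart (hω : IsInclusion ω) {x : E d} (hx : x ∈ frontier ω) :
    ∃ (n : E d) (r : ℝ) (G : E d → ℝ) (L : ℝ≥0),
      IsGraphChart ω x r n G L ∧ Metric.ball x r ⊆ unitCell d := by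
  obtain ⟨r, hr, n, hn, L, g, hg, h⟩ := hω.lipschitz x hx
  obtain ⟨r', hr', hr'Y⟩ := Metric.isOpen_iff.1 (isOpen_unitCell d) x (hω.frontier_subset hx)
  set P := (Submodule.span ℝ {n})ᗮ.orthogonalProjectionOnto with hP
  have hPL : LipschitzWith 1 P := by
    refine LipschitzWith.of_dist_le_mul fun y z => ?_
    rw [dist_eq_norm, dist_eq_norm, ← map_sub, NNReal.coe_one, one_mul]
    exact Submodule.norm_orthogonalProjectionOnto_apply_le _ _
  refine ⟨n, min r r', fun y => g (P y), L * 1, ⟨lt_min hr hr', hn, hg.comp hPL, fun y t => ?_,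
    fun y hy => h y (Metric.ball_subset_ball (min_le_left _ _) hy)⟩,
    (Metric.ball_subset_ball (min_le_right _ _)).trans hr'Y⟩
  congr 1
  have hPn : P n = 0 := by
    rw [hP]
    refine Submodule.orthogonalProjectionOnto_apply_of_mem_orthogonal ?_
    exact Submodule.le_orthogonal_orthogonal _ (Submodule.mem_span_singleton_self n)
  rw [map_add, map_smul, hPn, smul_zero, add_zero]

end IsInclusion

section Chart

variable {d : ℕ} {ω : Set (E d)} {x n : E d} {r : ℝ} {G : E d → ℝ} {L : ℝ≥0}

theorem IsGraphChart.mem_closure_iff (hc : IsGraphChart ω x r n G L) {y : E d}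
    (hy : y ∈ Metric.ball x r) : y ∈ closure ω ↔ G y ≤ inner ℝ n y := by
  have hGc := hc.lipschitz.continuous
  constructor
  · intro h
    have h1 : y ∈ closure (Metric.ball x r ∩ ω) :=
      Metric.isOpen_ball.inter_closure ⟨hy, h⟩
    have h2 : IsClosed {z : E d | G z ≤ inner ℝ n z} := isClosed_le hGc (by fun_prop)
    exact closure_minimal (fun z hz => ((hc.mem_iff z hz.1).1 hz.2).le) h2 h1
  · intro h
    have ht : Tendsto (fun t : ℝ => y + t • n) (𝓝[>] 0) (𝓝 y) := by
      have : Continuous fun t : ℝ => y + t • n := by fun_prop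
      have h0 := this.tendsto 0
      simp only [zero_smul, add_zero] at h0
      exact h0.mono_left nhdsWithin_le_nhds
    refine mem_closure_of_tendsto ht ?_
    filter_upwards [ht.eventually (Metric.isOpen_ball.mem_nhds hy), self_mem_nhdsWithin]
      with t htb ht0
    refine (hc.mem_iff _ htb).2 ?_
    rw [hc.invariant, inner_add_right, inner_smul_right, real_inner_self_eq_norm_sq, hc.norm_eq]
    have : (0 : ℝ) < t := ht0
    linarith

theorem IsGraphChart.eq_of_mem_frontier (hc : IsGraphChart ω x r n G L) (hω : IsOpen ω) {y : E d}
    (hy : y ∈ Metric.ball x r) (hyf : y ∈ frontier ω) : G y = inner ℝ n y := by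
  rw [hω.frontier_eq] at hyf
  exact le_antisymm ((hc.mem_closure_iff hy).1 hyf.1)
    (not_lt.1 fun h => hyf.2 ((hc.mem_iff y hy).2 h))

/-- The background lies on the other side of the same graph. -/
theorem IsGraphChart.background (hc : IsGraphChart ω x r n G L)
    (hr : Metric.ball x r ⊆ unitCell d) :
    IsGraphChart (unitCell d \ closure ω) x r (-n) (fun y => -G y) L := by
  refine ⟨hc.r_pos, by rw [norm_neg, hc.norm_eq], hc.lipschitz.neg, fun y t => ?_, fun y hy => ?_⟩
  · rw [smul_neg, ← neg_smul, hc.invariant]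
  · rw [Set.mem_sdiff, hc.mem_closure_iff hy, inner_neg_left, neg_lt_neg_iff, not_le]
    exact ⟨fun h => h.2, fun h => ⟨hr hy, h⟩⟩

end Chart

/-- The boundary of the inclusion is a null set. -/
theorem IsInclusion.volume_frontier {d : ℕ} {ω : Set (E d)} (hω : IsInclusion ω) :
    volume (frontier ω) = 0 := by
  refine measure_null_of_locally_null _ fun x hx => ?_
  obtain ⟨n, r, G, L, hc, -⟩ := hω.exists_chart hx
  refine ⟨Metric.ball x r ∩ frontier ω, inter_mem_nhdsWithin _ (Metric.ball_mem_nhds x hc.r_pos)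
    |> fun h => by rwa [inter_comm] at h, ?_⟩
  exact measure_mono_null (fun y hy => hc.eq_of_mem_frontier hω.isOpen hy.1 hy.2)
    (volume_graph_eq_zero hc.norm_eq hc.lipschitz hc.invariant)

/-- One of the two phases: the inclusion or the background. -/
def IsPhase {d : ℕ} (ω S : Set (E d)) : Prop := S = ω ∨ S = unitCell d \ closure ω

namespace IsPhase

variable {d : ℕ} {ω S : Set (E d)}

theorem isOpen (h : IsPhase ω S) (hω : IsInclusion ω) : IsOpen S := by
  rcases h with rfl | rfl
  · exact hω.isOpen
  · exact hω.isOpen_background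

theorem subset (h : IsPhase ω S) (hω : IsInclusion ω) : S ⊆ unitCell d := by
  rcases h with rfl | rfl
  · exact hω.subset
  · exact sdiff_subset

theorem isConnected (h : IsPhase ω S) (hω : IsInclusion ω) : IsConnected S := by
  rcases h with rfl | rfl
  · exact hω.isConnected
  · exact hω.background_connected

theorem exists_chart (h : IsPhase ω S) (hω : IsInclusion ω) {x : E d} (hx : x ∈ frontier ω) :
    ∃ (n : E d) (r : ℝ) (G : E d → ℝ) (L : ℝ≥0), IsGraphChart S x r n G L ∧ G x = inner ℝ n x ∧
      Metric.ball x r ⊆ unitCell d := by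
  obtain ⟨n, r, G, L, hc, hr⟩ := hω.exists_chart hx
  have hGx := hc.eq_of_mem_frontier hω.isOpen (Metric.mem_ball_self hc.r_pos) hx
  rcases h with rfl | rfl
  · exact ⟨n, r, G, L, hc, hGx, hr⟩
  · exact ⟨-n, r, fun y => -G y, L, hc.background hr, by simp only [inner_neg_left, hGx], hr⟩

theorem frontier_subset_closure (h : IsPhase ω S) (hω : IsInclusion ω) :
    frontier ω ⊆ closure S := by
  intro x hx
  obtain ⟨n, r, G, L, hc, hGx, -⟩ := h.exists_chart hω hx
  exact (hc.mem_closure_iff (Metric.mem_ball_self hc.r_pos)).2 hGx.le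

theorem hasLocalExtension (h : IsPhase ω S) (hω : IsInclusion ω) (m : ℕ) :
    HasLocalExtension m S (frontier ω) :=
  hasLocalExtension_of_isCompact m (h.isOpen hω).measurableSet hω.isCompact_frontier
    fun _ hx => h.exists_chart hω hx

end IsPhase

/-! ### Restriction to a phase and representatives -/

/-- The restriction of an `H¹` function to `S`. -/
noncomputable def resF {d m : ℕ} (S : Set (E d)) :
    H1 d m →L[ℝ] Lp (E m) 2 ((cellMeasure d).restrict S) :=
  (LpToLpRestrictCLM (E d) (E m) ℝ (cellMeasure d) 2 S).comp H1.fnL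

/-- The restriction of the gradient of an `H¹` function to `S`. -/
noncomputable def resG {d m : ℕ} (S : Set (E d)) :
    H1 d m →L[ℝ] Lp (Grad d m) 2 ((cellMeasure d).restrict S) :=
  (LpToLpRestrictCLM (E d) (Grad d m) ℝ (cellMeasure d) 2 S).comp H1.gradL

theorem coeFn_resF {d m : ℕ} (S : Set (E d)) (u : H1 d m) :
    resF S u =ᵐ[(cellMeasure d).restrict S] u.fn := LpToLpRestrictCLM_coeFn ℝ S (H1.fnL u)

theorem coeFn_resG {d m : ℕ} (S : Set (E d)) (u : H1 d m) :
    resG S u =ᵐ[(cellMeasure d).restrict S] u.grad := LpToLpRestrictCLM_coeFn ℝ S (H1.gradL u)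

theorem restrict_cellMeasure {d : ℕ} {S : Set (E d)} (hS : IsOpen S) (hSY : S ⊆ unitCell d) :
    (cellMeasure d).restrict S = volume.restrict S := by
  rw [cellMeasure, Measure.restrict_restrict hS.measurableSet, inter_eq_left.2 hSY]

theorem ofReal_norm_sq_L2 {X V : Type*} [MeasurableSpace X] {μ : Measure X}
    [NormedAddCommGroup V] [InnerProductSpace ℝ V] (f : Lp V 2 μ) :
    ENNReal.ofReal (‖f‖ ^ 2) = ∫⁻ y, ‖f y‖ₑ ^ 2 ∂μ := by
  rw [← real_inner_self_eq_norm_sq, L2.inner_def]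
  simp only [real_inner_self_eq_norm_sq]
  rw [ofReal_integral_eq_lintegral_ofReal ((Lp.memLp f).integrable_norm_pow (by norm_num))
    (Eventually.of_forall fun y => sq_nonneg _)]
  refine lintegral_congr fun y => ?_
  rw [ENNReal.ofReal_pow (norm_nonneg _), ofReal_norm]

/-- The function `f` represents `u`, with `∇u` the pointwise gradient of `f`. -/
structure Represents {d m : ℕ} (f : E d → E m) (u : H1 d m) : Prop where
  differentiable : ∀ᵐ y ∂cellMeasure d, DifferentiableAt ℝ f y
  fn_eq : u.fn =ᵐ[cellMeasure d] f
  grad_eq : u.grad =ᵐ[cellMeasure d] gradOf f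

theorem gradOf_add {d m : ℕ} {f g : E d → E m} {y : E d} (hf : DifferentiableAt ℝ f y)
    (hg : DifferentiableAt ℝ g y) : gradOf (f + g) y = gradOf f y + gradOf g y := by
  ext p
  simp [gradOf, fderiv_add hf hg]

theorem gradOf_sub {d m : ℕ} {f g : E d → E m} {y : E d} (hf : DifferentiableAt ℝ f y)
    (hg : DifferentiableAt ℝ g y) : gradOf (f - g) y = gradOf f y - gradOf g y := by
  ext p
  simp [gradOf, fderiv_sub hf hg]

theorem gradOf_congr {d m : ℕ} {f g : E d → E m} {U : Set (E d)} (hU : IsOpen U) (h : EqOn f g U)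
    {y : E d} (hy : y ∈ U) : gradOf f y = gradOf g y := by
  have : f =ᶠ[𝓝 y] g := by
    filter_upwards [hU.mem_nhds hy] with z hz using h hz
  simp only [gradOf, this.fderiv_eq]

namespace Represents

variable {d m : ℕ} {f g : E d → E m} {u v : H1 d m}

theorem add (hf : Represents f u) (hg : Represents g v) : Represents (f + g) (u + v) := by
  refine ⟨?_, ?_, ?_⟩
  · filter_upwards [hf.differentiable, hg.differentiable] with y h1 h2 using h1.add h2
  · exact (H1.fn_add u v).trans (hf.fn_eq.add hg.fn_eq)
  · refine (H1.grad_add u v).trans ((hf.grad_eq.add hg.grad_eq).trans ?_)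
    filter_upwards [hf.differentiable, hg.differentiable] with y h1 h2
      using (gradOf_add h1 h2).symm

theorem sub (hf : Represents f u) (hg : Represents g v) : Represents (f - g) (u - v) := by
  refine ⟨?_, ?_, ?_⟩
  · filter_upwards [hf.differentiable, hg.differentiable] with y h1 h2 using h1.sub h2
  · exact (H1.fn_sub u v).trans (hf.fn_eq.sub hg.fn_eq)
  · refine (H1.grad_sub u v).trans ((hf.grad_eq.sub hg.grad_eq).trans ?_)
    filter_upwards [hf.differentiable, hg.differentiable] with y h1 h2
      using (gradOf_sub h1 h2).symm

theorem congr (hf : Represents f u) (h : EqOn f g (unitCell d)) : Represents g u := by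
  have hY := isOpen_unitCell d
  refine ⟨?_, hf.fn_eq.trans ?_, hf.grad_eq.trans ?_⟩
  · filter_upwards [hf.differentiable, ae_restrict_mem (measurableSet_unitCell d)] with y h1 hy
    refine h1.congr_of_eventuallyEq ?_
    filter_upwards [hY.mem_nhds hy] with z hz using (h hz).symm
  · filter_upwards [ae_restrict_mem (measurableSet_unitCell d)] with y hy using h hy
  · filter_upwards [ae_restrict_mem (measurableSet_unitCell d)] with y hy using gradOf_congr hY h hy

theorem ofLipschitz (hL : ∃ C, LipschitzWith C f) (hK : HasCompactSupport f)
    (hs : tsupport f ⊆ unitCell d) : Represents f (H1.ofLipschitz f hL hK hs) :=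
  ⟨ae_restrict_of_ae hL.choose_spec.ae_differentiableAt, H1.fn_ofLipschitz _ _ _,
    H1.grad_ofLipschitz _ _ _⟩

theorem of_contDiff (hc : ContDiff ℝ 1 f) (hp : IsPeriodic f) (h : u.fn =ᵐ[cellMeasure d] f) :
    Represents f u := by
  have : u = H1.ofPeriodic f hp hc := H1.ext_fn (h.trans (H1.fn_ofPeriodic hp hc).symm)
  exact ⟨Eventually.of_forall fun y => hc.differentiable (by simp) y, h,
    this ▸ H1.grad_ofPeriodic hp hc⟩

theorem norm_sq_le (hf : Represents f u) :
    ENNReal.ofReal (‖u‖ ^ 2) ≤ ((1 + d * m : ℕ) : ℝ≥0∞) * energy (unitCell d) f := by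
  rw [H1.norm_sq_eq, ENNReal.ofReal_add (sq_nonneg _) (sq_nonneg _), ofReal_norm_sq_L2,
    ofReal_norm_sq_L2, ← lintegral_add_left' (by
      exact (Lp.aestronglyMeasurable (H1.fnL u)).enorm.pow_const 2), energy,
    ← lintegral_const_mul' _ _ (ENNReal.natCast_ne_top _)]
  refine lintegral_mono_ae ?_
  filter_upwards [hf.fn_eq, hf.grad_eq] with y h1 h2
  rw [H1.coe_fnL, H1.coe_gradL, h1, h2, mul_add]
  refine add_le_add ?_ ?_
  · refine le_mul_of_one_le_left zero_le ?_
    exact_mod_cast Nat.le_add_right 1 _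
  · rw [← ofReal_norm, ← ofReal_norm, ← ENNReal.ofReal_pow (norm_nonneg _),
      ← ENNReal.ofReal_pow (norm_nonneg _), ← ENNReal.ofReal_natCast,
      ← ENNReal.ofReal_mul (Nat.cast_nonneg _)]
    refine ENNReal.ofReal_le_ofReal ((norm_gradOf_le f y).trans ?_)
    gcongr
    omega

theorem energy_le (hf : Represents f u) {S : Set (E d)} (hS : IsOpen S) (hSY : S ⊆ unitCell d) :
    energy S f ≤ ENNReal.ofReal (‖resF S u‖ ^ 2 + ‖resG S u‖ ^ 2) := by
  rw [ENNReal.ofReal_add (sq_nonneg _) (sq_nonneg _), ofReal_norm_sq_L2,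
    ofReal_norm_sq_L2, ← lintegral_add_left' (by
      exact (Lp.aestronglyMeasurable (resF S u)).enorm.pow_const 2),
    energy, ← restrict_cellMeasure hS hSY]
  refine lintegral_mono_ae ?_
  filter_upwards [ae_restrict_of_ae hf.fn_eq, ae_restrict_of_ae hf.grad_eq, coeFn_resF S u,
    coeFn_resG S u] with y h1 h2 h3 h4
  rw [h3, h4, h1, h2]
  gcongr
  rw [← ofReal_norm, ← ofReal_norm]
  exact ENNReal.ofReal_le_ofReal (norm_fderiv_le_gradOf f y)

theorem res_eq_zero (hf : Represents f u) {S : Set (E d)} (hS : IsOpen S) (hSY : S ⊆ unitCell d)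
    (h0 : ∀ y ∈ S, f y = 0) : resF S u = 0 ∧ resG S u = 0 := by
  have h : energy S f = 0 := by
    rw [energy_congr hS (g := fun _ => 0) h0]
    simp [energy, enorm_eq_nnnorm]
  have hle : volume.restrict S ≪ cellMeasure d :=
    (Measure.restrict_mono hSY le_rfl).absolutelyContinuous
  have h3 := coeFn_resF S u
  have h4 := coeFn_resG S u
  constructor
  · refine Lp.ext (h3.trans (EventuallyEq.trans ?_ (Lp.coeFn_zero _ _ _).symm))
    rw [restrict_cellMeasure hS hSY]
    filter_upwards [hle.ae_le hf.fn_eq, ae_restrict_mem hS.measurableSet] with y h1 hy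
    rw [h1, h0 y hy]
    rfl
  · refine Lp.ext (h4.trans (EventuallyEq.trans ?_ (Lp.coeFn_zero _ _ _).symm))
    rw [restrict_cellMeasure hS hSY]
    filter_upwards [hle.ae_le hf.grad_eq, ae_restrict_mem hS.measurableSet] with y h1 hy
    rw [h1, gradOf_congr hS (g := fun _ => 0) h0 hy]
    ext p
    simp [gradOf]

end Represents

/-! ### Extension from one phase -/

theorem contDiff_indicator {d : ℕ} {V : Type*} [NormedAddCommGroup V] [NormedSpace ℝ V]
    {ω U : Set (E d)} (hω : IsOpen ω) (hU : IsOpen U) (hfU : frontier ω ⊆ U) {f : E d → V}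
    {k : WithTop ℕ∞} (hf : ContDiff ℝ k f) (h0 : ∀ y ∈ U, f y = 0) :
    ContDiff ℝ k (ω.indicator f) := by
  rw [contDiff_iff_contDiffAt]
  intro y
  by_cases hy : y ∈ ω
  · refine hf.contDiffAt.congr_of_eventuallyEq ?_
    filter_upwards [hω.mem_nhds hy] with z hz using indicator_of_mem hz f
  · refine contDiffAt_const (c := (0 : V)) |>.congr_of_eventuallyEq ?_
    by_cases hyf : y ∈ frontier ω
    · filter_upwards [hU.mem_nhds (hfU hyf)] with z hz
      by_cases hzω : z ∈ ω
      · rw [indicator_of_mem hzω, h0 z hz]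
      · rw [indicator_of_notMem hzω]
    · have hyc : y ∉ closure ω := fun h => hyf (by rw [hω.frontier_eq]; exact ⟨h, hy⟩)
      filter_upwards [isClosed_closure.isOpen_compl.mem_nhds hyc] with z hz
      exact indicator_of_notMem (fun h => hz (subset_closure h)) f

theorem tsupport_indicator_subset {d : ℕ} {V : Type*} [Zero V]
    {ω U : Set (E d)} (hω : IsOpen ω) (hU : IsOpen U) (hfU : frontier ω ⊆ U) {f : E d → V}
    (h0 : ∀ y ∈ U, f y = 0) : tsupport (ω.indicator f) ⊆ ω := by
  intro y hy
  by_contra hyω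
  have hyc : y ∈ closure ω := closure_mono (support_indicator_subset) hy
  have hyf : y ∈ frontier ω := by rw [hω.frontier_eq]; exact ⟨hyc, hyω⟩
  refine notMem_tsupport_iff_eventuallyEq.2 ?_ hy
  filter_upwards [hU.mem_nhds (hfU hyf)] with z hz
  by_cases hzω : z ∈ ω
  · rw [indicator_of_mem hzω, h0 z hz]; rfl
  · rw [indicator_of_notMem hzω]; rfl

theorem energy_le_of_eqOn {d m : ℕ} {ω S : Set (E d)} (hω : IsInclusion ω) (h : IsPhase ω S)
    {f g : E d → E m} (hS : EqOn f g S) (h0 : ∀ y ∈ unitCell d, y ∉ closure S → f y = 0) :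
    energy (unitCell d) f ≤ energy S g := by
  have hnull : ∀ᵐ y ∂(volume : Measure (E d)), y ∈ unitCell d → y ∈ S ∨ y ∉ closure S := by
    filter_upwards [measure_eq_zero_iff_ae_notMem.1 hω.volume_frontier] with y hy hyY
    by_cases hyS : y ∈ S
    · exact Or.inl hyS
    · refine Or.inr fun hyc => ?_
      rcases h with rfl | rfl
      · exact hy (by rw [hω.isOpen.frontier_eq]; exact ⟨hyc, hyS⟩)
      · have hy1 : y ∈ closure ω := by
          by_contra hcon
          exact hyS ⟨hyY, hcon⟩
        rw [hω.isOpen.frontier_eq] at hy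
        have hyω : y ∈ ω := by
          by_contra hcon
          exact hy ⟨hy1, hcon⟩
        obtain ⟨z, hz1, hz2⟩ := mem_closure_iff.1 hyc ω hω.isOpen hyω
        exact hz2.2 (subset_closure hz1)
  have hSo := h.isOpen hω
  rw [← energy_congr hSo hS, energy, energy, ← lintegral_indicator hSo.measurableSet,
    ← lintegral_indicator (measurableSet_unitCell d)]
  refine lintegral_mono_ae ?_
  filter_upwards [hnull] with y hy
  by_cases hyY : y ∈ unitCell d
  · rw [indicator_of_mem hyY]
    rcases hy hyY with hyS | hyS
    · rw [indicator_of_mem hyS]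
    · have : f =ᶠ[𝓝 y] fun _ => 0 := by
        filter_upwards [(isOpen_unitCell d).mem_nhds hyY,
          isClosed_closure.isOpen_compl.mem_nhds hyS] with z h1 h2 using h0 z h1 h2
      rw [this.fderiv_eq, this.eq_of_nhds]
      simp [enorm_eq_nnnorm]
  · rw [indicator_of_notMem hyY]
    exact zero_le

/-- A smooth periodic function can be changed by a function of zero trace, vanishing on the
phase `S`, so that its `H¹` norm is controlled by its norm on `S`. -/
theorem exists_extension_of_smooth {d m : ℕ} {ω S : Set (E d)} (hω : IsInclusion ω)
    (h : IsPhase ω S) : ∃ C : ℝ, 0 ≤ C ∧ ∀ u ∈ smoothH1 d m, ∃ W ∈ zeroTrace m ω,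
      resF S W = 0 ∧ resG S W = 0 ∧ ‖u - W‖ ^ 2 ≤ C * (‖resF S u‖ ^ 2 + ‖resG S u‖ ^ 2) := by
  obtain ⟨θ, hθ, hθK, hθs, ⟨U, hU, hfU, hθU⟩, C, hC⟩ := h.hasLocalExtension hω m
  obtain ⟨M, hM1, hM2⟩ := exists_enorm_le hθ hθK
  have hSo := h.isOpen hω
  have hSY := h.subset hω
  have hfY := hω.frontier_subset
  -- A cutoff that is one on the cell makes the periodic function compactly supported in `ℝ^d`.
  let Θ : ContDiffBump (0 : E d) := ⟨Real.sqrt d + 1, Real.sqrt d + 2, by positivity, by linarith⟩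
  have hΘ : ∀ y ∈ unitCell d, Θ y = 1 := fun y hy =>
    Θ.one_of_mem_closedBall (Metric.closedBall_subset_closedBall (by simp [Θ])
      (unitCell_subset_closedBall d hy))
  let D : ℝ≥0 := (1 + d * m : ℕ) * (2 * (4 * (1 + M) ^ 2 + C))
  refine ⟨D, D.2, ?_⟩
  rintro u ⟨f, hf, hfp, huf⟩
  have hf1 : ContDiff ℝ 1 f := hf.of_le (by exact_mod_cast le_top)
  set v : E d → E m := fun y => Θ y • f y with hv
  have hvc : ContDiff ℝ ((⊤ : ℕ∞) : WithTop ℕ∞) v := Θ.contDiff.smul hf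
  have hvK : HasCompactSupport v := Θ.hasCompactSupport.smul_right
  have hvf : ∀ y ∈ unitCell d, v y = f y := fun y hy => by simp only [hv, hΘ y hy, one_smul]
  obtain ⟨w, hwL, hwK, hws, hwS, hwE⟩ := hC v hvc hvK
  have hψ : ContDiff ℝ ((⊤ : ℕ∞) : WithTop ℕ∞) fun y => 1 - θ y := contDiff_const.sub hθ
  set z : E d → E m := fun y => (1 - θ y) • v y with hz
  have hzc : ContDiff ℝ ((⊤ : ℕ∞) : WithTop ℕ∞) z := ContDiff.smul hψ hvc
  have hz0 : ∀ y ∈ U, z y = 0 := fun y hy => by simp only [hz, hθU y hy, sub_self, zero_smul]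
  -- `1 - θ` vanishes near `∂ω`, so the part `q` of `(1 - θ) v` in `ω` is smooth.
  set q : E d → E m := ω.indicator z with hq
  have hqc : ContDiff ℝ ((⊤ : ℕ∞) : WithTop ℕ∞) q := contDiff_indicator hω.isOpen hU hfU hzc hz0
  have hqs : tsupport q ⊆ ω := tsupport_indicator_subset hω.isOpen hU hfU hz0
  have hqK : HasCompactSupport q := hω.isCompact_closure.of_isClosed_subset (isClosed_tsupport _)
    (hqs.trans subset_closure)
  set t : E d → E m := fun y => θ y • v y with ht
  have htc : ContDiff ℝ ((⊤ : ℕ∞) : WithTop ℕ∞) t := ContDiff.smul hθ hvc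
  have htK : HasCompactSupport t := hθK.smul_right
  have hts : tsupport t ⊆ unitCell d :=
    (closure_mono (show Function.support t ⊆ Function.support θ from
      fun y hy h => hy (by simp [ht, h]))).trans hθs
  have htL := exists_lipschitzWith_of_contDiff htc htK
  have hqL := exists_lipschitzWith_of_contDiff hqc hqK
  set R := H1.ofLipschitz t htL htK hts
  set Q := H1.ofLipschitz q hqL hqK (hqs.trans hω.subset)
  set V := H1.ofLipschitz w hwL hwK hws
  have hRr : Represents t R := Represents.ofLipschitz _ _ _
  have hQr : Represents q Q := Represents.ofLipschitz _ _ _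
  have hVr : Represents w V := Represents.ofLipschitz _ _ _
  have hur : Represents f u := Represents.of_contDiff hf1 hfp huf
  have hPr : Represents (z - q) (u - R - Q) := by
    refine ((hur.sub hRr).sub hQr).congr fun y hy => ?_
    simp only [Pi.sub_apply, ht, hz, hvf y hy]
    module
  have hQZ : Q ∈ zeroTrace m ω := by
    refine ofLipschitz_mem_zeroTrace_of_contDiff hfY hqc _ _ _ (disjoint_left.2 fun y hy hyf => ?_)
    rw [hω.isOpen.frontier_eq] at hyf
    exact hyf.2 (hqs hy)
  have hVZ : V ∈ zeroTrace m ω := by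
    refine ofLipschitz_mem_zeroTrace hfY _ _ _ fun y hy => ?_
    obtain ⟨K, hK⟩ := hwL
    have hcl : IsClosed {y | w y = 0} := isClosed_eq hK.continuous continuous_const
    exact closure_minimal hwS hcl (h.frontier_subset_closure hω hy)
  have hPZ : u - R - Q ∈ zeroTrace m ω := by
    have htqs : tsupport (t + q) ⊆ unitCell d :=
      (tsupport_add t q).trans (union_subset hts (hqs.trans hω.subset))
    have hper := contDiff_periodize (htc.add hqc) (htK.add hqK) htqs
    refine mem_zeroTrace_of_isTestOff (ϕ := f - periodize (t + q)) ⟨hf.sub hper, fun n y => ?_, ?_⟩ ?_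
    · simp only [Pi.sub_apply, hfp n y, isPeriodic_periodize (t + q) n y]
    · rw [disjoint_right]
      intro y hy
      refine notMem_tsupport_iff_eventuallyEq.2 ?_
      filter_upwards [hU.mem_nhds (hfU hy), (isOpen_unitCell d).mem_nhds (hfY hy)] with x hxU hxY
      have hqx : q x = 0 := by
        by_cases hxω : x ∈ ω
        · rw [hq, indicator_of_mem hxω, hz0 x hxU]
        · rw [hq, indicator_of_notMem hxω]
      simp only [Pi.sub_apply, periodize_eq _ hxY, Pi.add_apply, hqx, ht, hθU x hxU, hvf x hxY]
      simp
    · refine hPr.fn_eq.trans ?_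
      filter_upwards [ae_restrict_mem (measurableSet_unitCell d)] with y hy
      simp only [Pi.sub_apply, periodize_eq _ hy, Pi.add_apply, ht, hz, hvf y hy]
      module
  have hzE : energy S z ≤ 4 * ((1 + M : ℝ≥0) : ℝ≥0∞) ^ 2 * energy S v := by
    refine energy_smul_le (hψ.differentiable (by simp)) (hvc.differentiable (by simp))
      (fun y => ?_) fun y => ?_
    · refine (enorm_sub_le).trans ?_
      push_cast
      exact add_le_add (by simp) (hM1 y)
    · rw [fderiv_const_sub, enorm_neg]
      refine (hM2 y).trans ?_
      push_cast
      exact le_add_self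
  have hvE : energy S v ≤ ENNReal.ofReal (‖resF S u‖ ^ 2 + ‖resG S u‖ ^ 2) := by
    refine Represents.energy_le (hur.congr fun y hy => (hvf y hy).symm) hSo hSY
  -- `a` is the part of `(1 - θ) v` on the opposite phase and `b` the part on `S`.
  have hmain : ∀ (A B : H1 d m) (a b : E d → E m), A ∈ zeroTrace m ω → Represents a A →
      Represents b B → u = A + B + R → (∀ y ∈ S, a y = 0) → EqOn b z S →
      (∀ y ∈ unitCell d, y ∉ closure S → b y = 0) → (∃ K, LipschitzWith K b) →
      ∃ W ∈ zeroTrace m ω, resF S W = 0 ∧ resG S W = 0 ∧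
        ‖u - W‖ ^ 2 ≤ D * (‖resF S u‖ ^ 2 + ‖resG S u‖ ^ 2) := by
    intro A B a b hAZ hA hB hu ha hbz hb0 hbL
    have hW := hA.add hVr
    obtain ⟨h1, h2⟩ := hW.res_eq_zero hSo hSY fun y hy => by simp [ha y hy, hwS y hy]
    refine ⟨A + V, Submodule.add_mem _ hAZ hVZ, h1, h2, ?_⟩
    have hdiff : u - (A + V) = B + (R - V) := by rw [hu]; abel
    have hrep : Represents (b + (t - w)) (u - (A + V)) := hdiff ▸ hB.add (hRr.sub hVr)
    obtain ⟨K1, hK1⟩ := htL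
    obtain ⟨K2, hK2⟩ := hwL
    have hfin : ENNReal.ofReal (‖u - (A + V)‖ ^ 2) ≤
        D * ENNReal.ofReal (‖resF S u‖ ^ 2 + ‖resG S u‖ ^ 2) := by
      refine hrep.norm_sq_le.trans ?_
      have e1 : energy (unitCell d) b ≤ 4 * ((1 + M : ℝ≥0) : ℝ≥0∞) ^ 2 * energy S v :=
        (energy_le_of_eqOn hω h hbz hb0).trans hzE
      have e2 := energy_add_le (U := unitCell d) hbL ⟨_, hK1.sub hK2⟩
      have e3 : energy (unitCell d) (b + (t - w)) ≤
          2 * (4 * ((1 + M : ℝ≥0) : ℝ≥0∞) ^ 2 * energy S v + C * energy S v) :=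
        e2.trans (mul_le_mul' le_rfl (add_le_add e1 hwE))
      calc _ ≤ ((1 + d * m : ℕ) : ℝ≥0∞) *
            (2 * (4 * ((1 + M : ℝ≥0) : ℝ≥0∞) ^ 2 * energy S v + C * energy S v)) :=
            mul_le_mul' le_rfl e3
        _ = (D : ℝ≥0∞) * energy S v := by simp only [D]; push_cast; ring
        _ ≤ _ := mul_le_mul' le_rfl hvE
    rw [← ENNReal.ofReal_coe_nnreal, ← ENNReal.ofReal_mul (NNReal.coe_nonneg D)] at hfin
    exact (ENNReal.ofReal_le_ofReal_iff (by positivity)).1 hfin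
  have hzqL : ∃ K, LipschitzWith K (z - q) := by
    obtain ⟨K1, hK1⟩ := exists_lipschitzWith_of_contDiff hzc
      (HasCompactSupport.smul_left (f := fun y => 1 - θ y) hvK)
    obtain ⟨K2, hK2⟩ := hqL
    exact ⟨_, hK1.sub hK2⟩
  rcases h with rfl | rfl
  · refine hmain (u - R - Q) Q (z - q) q hPZ hPr hQr (by abel) (fun y hy => ?_) (fun y hy => ?_)
      (fun y _ hy => ?_) hqL
    · simp [hq, hy]
    · simp [hq, hy]
    · exact indicator_of_notMem (fun h => hy (subset_closure h)) _
  · refine hmain Q (u - R - Q) q (z - q) hQZ hQr hPr (by abel) (fun y hy => ?_) (fun y hy => ?_)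
      (fun y hyY hy => ?_) hzqL
    · exact indicator_of_notMem (fun h => hy.2 (subset_closure h)) _
    · have : y ∉ ω := fun h => hy.2 (subset_closure h)
      simp [hq, this]
    · have hyc : y ∈ closure ω := by
        by_contra hcon
        exact hy (subset_closure ⟨hyY, hcon⟩)
      have hyω : y ∈ ω := by
        by_contra hcon
        refine hy (IsPhase.frontier_subset_closure (Or.inr rfl) hω ?_)
        rw [hω.isOpen.frontier_eq]
        exact ⟨hyc, hcon⟩
      simp [hq, hyω]

/-! ### Distance to the functions that are constant on a phase -/

section Abstract

variable {H F₁ F₂ : Type*} [NormedAddCommGroup H] [InnerProductSpace ℝ H]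
  [NormedAddCommGroup F₁] [NormedSpace ℝ F₁] [NormedAddCommGroup F₂] [NormedSpace ℝ F₂]

/-- An estimate of the distance to a subspace extends from a dense subspace. -/
theorem norm_sub_starProjection_sq_le_of_dense {D N : Submodule ℝ H} [N.HasOrthogonalProjection]
    (hD : D.topologicalClosure = ⊤) {T₁ : H →L[ℝ] F₁} {T₂ : H →L[ℝ] F₂} {C : ℝ}
    (h : ∀ u ∈ D, ∃ w ∈ N, ‖u - w‖ ^ 2 ≤ C * (‖T₁ u‖ ^ 2 + ‖T₂ u‖ ^ 2)) (u : H) :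
    ‖u - N.starProjection u‖ ^ 2 ≤ C * (‖T₁ u‖ ^ 2 + ‖T₂ u‖ ^ 2) := by
  have hcl : IsClosed {u | ‖u - N.starProjection u‖ ^ 2 ≤ C * (‖T₁ u‖ ^ 2 + ‖T₂ u‖ ^ 2)} :=
    isClosed_le (by fun_prop) (by fun_prop)
  have hsub : (D : Set H) ⊆ {u | ‖u - N.starProjection u‖ ^ 2 ≤
      C * (‖T₁ u‖ ^ 2 + ‖T₂ u‖ ^ 2)} := by
    intro v hv
    obtain ⟨w, hw, hvw⟩ := h v hv
    refine le_trans ?_ hvw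
    have : ‖v - N.starProjection v‖ ≤ ‖v - w‖ := by
      rw [Submodule.starProjection_minimal]
      exact ciInf_le ⟨0, by rintro _ ⟨x, rfl⟩; exact norm_nonneg _⟩ (⟨w, hw⟩ : N)
    gcongr
  have hu : u ∈ D.topologicalClosure := hD ▸ Submodule.mem_top
  exact closure_minimal hsub hcl hu

variable [CompleteSpace H]

/-- If, up to finitely many linear functionals, the norm is controlled by `T`, then the distance to
the kernel of `T` is controlled by `T`. -/
theorem exists_norm_le_of_finite_functionals {M : Submodule ℝ H} (hM : IsClosed (M : Set H))
    {T : H →L[ℝ] F₂} (hT : ∀ x ∈ M, T x = 0 → x = 0) {n : ℕ}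
    {l : H →L[ℝ] EuclideanSpace ℝ (Fin n)} {C : ℝ}
    (h : ∀ x ∈ M, ‖x‖ ^ 2 ≤ C * (‖l x‖ ^ 2 + ‖T x‖ ^ 2)) :
    ∃ C', 0 ≤ C' ∧ ∀ x ∈ M, ‖x‖ ≤ C' * ‖T x‖ := by
  by_contra! hcon
  have hx : ∀ k : ℕ, ∃ x ∈ M, ‖x‖ = 1 ∧ ‖T x‖ < 1 / ((k : ℝ) + 1) := by
    intro k
    obtain ⟨x, hxM, hx⟩ := hcon (k + 1) (by positivity)
    have hx0 : 0 < ‖x‖ := lt_of_le_of_lt (by positivity) hx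
    refine ⟨‖x‖⁻¹ • x, M.smul_mem _ hxM, ?_, ?_⟩
    · rw [norm_smul, norm_inv, norm_norm, inv_mul_cancel₀ hx0.ne']
    · rw [map_smul, norm_smul, norm_inv, norm_norm, inv_mul_eq_div, div_lt_div_iff₀ hx0 (by positivity)]
      linarith
  choose x hxM hx1 hxT using hx
  obtain ⟨L, -, φ, hφ, hL⟩ := tendsto_subseq_of_bounded
    (Metric.isBounded_closedBall (x := (0 : EuclideanSpace ℝ (Fin n))) (r := ‖l‖))
    (x := fun k => l (x k)) fun k => by
      rw [mem_closedBall_zero_iff]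
      simpa [hx1 k] using l.le_opNorm (x k)
  have hT0 : Tendsto (fun k => T (x (φ k))) atTop (𝓝 0) := by
    have : Tendsto (fun k => T (x k)) atTop (𝓝 0) :=
      squeeze_zero_norm (fun k => (hxT k).le) tendsto_one_div_add_atTop_nhds_zero_nat
    exact this.comp hφ.tendsto_atTop
  have hcau : CauchySeq fun k => x (φ k) := by
    have h1 : Tendsto (fun p : ℕ × ℕ => C * (‖l (x (φ p.1)) - l (x (φ p.2))‖ ^ 2 +
        ‖T (x (φ p.1)) - T (x (φ p.2))‖ ^ 2)) (atTop ×ˢ atTop) (𝓝 (C * (‖L - L‖ ^ 2 +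
          ‖(0 : F₂) - 0‖ ^ 2))) :=
      ((((hL.comp tendsto_fst).sub (hL.comp tendsto_snd)).norm.pow 2).add
        (((hT0.comp tendsto_fst).sub (hT0.comp tendsto_snd)).norm.pow 2)).const_mul C
    simp only [sub_self, norm_zero, ne_eq, OfNat.ofNat_ne_zero, not_false_eq_true, zero_pow,
      add_zero, mul_zero] at h1
    have h2 : Tendsto (fun p : ℕ × ℕ => ‖x (φ p.1) - x (φ p.2)‖ ^ 2) (atTop ×ˢ atTop) (𝓝 0) := by
      refine squeeze_zero (fun p => sq_nonneg _) (fun p => ?_) h1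
      rw [← map_sub, ← map_sub]
      exact h _ (M.sub_mem (hxM _) (hxM _))
    rw [prod_atTop_atTop_eq] at h2
    refine cauchySeq_iff_tendsto_dist_atTop_0.2 ?_
    have h3 := h2.sqrt
    simpa [Real.sqrt_sq, dist_eq_norm] using h3
  obtain ⟨y, hy⟩ := cauchySeq_tendsto_of_complete hcau
  have hyM : y ∈ M := hM.mem_of_tendsto hy (Eventually.of_forall fun k => hxM _)
  have hTy : T y = 0 := tendsto_nhds_unique ((T.continuous.tendsto y).comp hy) hT0
  have hy1 : ‖y‖ = 1 := tendsto_nhds_unique hy.norm (by simp [hx1])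
  rw [hT y hyM hTy, norm_zero] at hy1
  exact zero_ne_one hy1

/-- A closed range theorem: `T₂` controls the distance to its kernel if `T₁` and `T₂` control the
distance to a subspace of the common kernel, and `T₁` is small up to finitely many functionals. -/
theorem exists_norm_sub_le_of_ker {N : Submodule ℝ H} [N.HasOrthogonalProjection]
    {T₁ : H →L[ℝ] F₁} {T₂ : H →L[ℝ] F₂} {C : ℝ} (hC : 0 ≤ C) (hN : ∀ u ∈ N, T₂ u = 0)
    (h : ∀ u, ‖u - N.starProjection u‖ ^ 2 ≤ C * (‖T₁ u‖ ^ 2 + ‖T₂ u‖ ^ 2))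
    (hcpt : ∀ ε > 0, ∃ (n : ℕ) (l : H →L[ℝ] EuclideanSpace ℝ (Fin n)),
      ∀ u, ‖T₁ u‖ ^ 2 ≤ ε * ‖u‖ ^ 2 + ‖l u‖ ^ 2) :
    ∃ C', 0 ≤ C' ∧ ∀ u, ∃ k, T₂ k = 0 ∧ ‖u - k‖ ≤ C' * ‖T₂ u‖ := by
  set K : Submodule ℝ H := LinearMap.ker T₂.toLinearMap with hK
  have hKc : IsClosed (K : Set H) := T₂.isClosed_ker
  have : CompleteSpace K := hKc.completeSpace_coe
  have hmem : ∀ {u}, u ∈ K ↔ T₂ u = 0 := Iff.rfl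
  obtain ⟨n, l, hl⟩ := hcpt (1 / (2 * (C + 1))) (by positivity)
  obtain ⟨C', hC', hx⟩ := exists_norm_le_of_finite_functionals (M := Kᗮ) (T := T₂) (l := l)
    (C := 2 * C) K.isClosed_orthogonal (fun x hx hTx => by
      have := K.mem_orthogonal x |>.1 hx x hTx
      exact inner_self_eq_zero.1 this) fun x hx => by
      have hxN : N.starProjection x = 0 := by
        refine (Submodule.starProjection_apply_eq_zero_iff _).2 ?_
        exact Submodule.orthogonal_le (fun u hu => hN u hu) hx
      have h1 := h x
      rw [hxN, sub_zero] at h1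
      have h2 := hl x
      have h3 : C * ‖T₁ x‖ ^ 2 ≤ 1 / 2 * ‖x‖ ^ 2 + C * ‖l x‖ ^ 2 := by
        refine (mul_le_mul_of_nonneg_left h2 hC).trans ?_
        rw [mul_add, ← mul_assoc]
        gcongr
        rw [mul_one_div, div_le_div_iff₀ (by positivity) (by norm_num)]
        linarith
      nlinarith
  refine ⟨C', hC', fun u => ⟨K.starProjection u, hmem.1 (K.starProjection_apply_mem u), ?_⟩⟩
  have h0 : T₂ (K.starProjection u) = 0 := hmem.1 (K.starProjection_apply_mem u)
  have := hx _ (K.sub_starProjection_mem_orthogonal u)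
  rwa [map_sub, h0, sub_zero] at this

end Abstract

section Phase

variable {d m : ℕ} {ω S : Set (E d)}

theorem norm_resF_le (S : Set (E d)) (u : H1 d m) : ‖resF S u‖ ≤ ‖H1.fnL u‖ :=
  norm_Lp_toLp_restrict_le S (H1.fnL u)

theorem norm_resG_le (S : Set (E d)) (u : H1 d m) : ‖resG S u‖ ≤ ‖H1.gradL u‖ :=
  norm_Lp_toLp_restrict_le S (H1.gradL u)

/-- The functions of zero trace that vanish on `S`. -/
noncomputable def zeroOn (m : ℕ) (ω S : Set (E d)) : Submodule ℝ (H1 d m) :=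
  zeroTrace m ω ⊓ (LinearMap.ker (resF (m := m) S).toLinearMap ⊓
    LinearMap.ker (resG (m := m) S).toLinearMap)

theorem mem_zeroOn {u : H1 d m} :
    u ∈ zeroOn m ω S ↔ u ∈ zeroTrace m ω ∧ resF S u = 0 ∧ resG S u = 0 := Iff.rfl

theorem isClosed_zeroOn (m : ℕ) (ω S : Set (E d)) : IsClosed (zeroOn m ω S : Set (H1 d m)) :=
  (isClosed_zeroTrace m ω).inter ((resF S).isClosed_ker.inter (resG S).isClosed_ker)

instance completeSpace_zeroOn (m : ℕ) (ω S : Set (E d)) : CompleteSpace (zeroOn m ω S) :=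
  (isClosed_zeroOn m ω S).completeSpace_coe

/-- The `H¹` norm modulo functions of zero trace vanishing on a phase is the `H¹` norm on that
phase. -/
theorem exists_norm_sub_zeroOn_le (m : ℕ) (hω : IsInclusion ω) (h : IsPhase ω S) :
    ∃ C : ℝ, 0 ≤ C ∧ ∀ u : H1 d m, ‖u - (zeroOn m ω S).starProjection u‖ ^ 2 ≤
      C * (‖resF S u‖ ^ 2 + ‖resG S u‖ ^ 2) := by
  obtain ⟨C, hC, hext⟩ := exists_extension_of_smooth (m := m) hω h
  refine ⟨C, hC, norm_sub_starProjection_sq_le_of_dense (topologicalClosure_smoothH1 d m)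
    fun u hu => ?_⟩
  obtain ⟨W, hW, h1, h2, h3⟩ := hext u hu
  exact ⟨W, ⟨hW, h1, h2⟩, h3⟩

/-- A function vanishing on one phase has zero trace. -/
theorem mem_zeroTrace_of_res_eq_zero (hω : IsInclusion ω) (h : IsPhase ω S) {u : H1 d m}
    (h1 : resF S u = 0) (h2 : resG S u = 0) : u ∈ zeroTrace m ω := by
  obtain ⟨C, -, hC⟩ := exists_norm_sub_zeroOn_le m hω h
  have h3 := hC u
  rw [h1, h2] at h3
  have h4 : ‖u - (zeroOn m ω S).starProjection u‖ = 0 := by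
    refine pow_eq_zero_iff (two_ne_zero) |>.1 (le_antisymm ?_ (sq_nonneg _))
    simpa using h3
  rw [norm_eq_zero, sub_eq_zero] at h4
  rw [h4]
  exact (mem_zeroOn.1 ((zeroOn m ω S).starProjection_apply_mem u)).1

/-- The Poincaré inequality on a phase `S`: the gradient on `S` controls the distance in `H¹` of the
torus to the functions whose gradient vanishes on `S`. -/
theorem exists_norm_sub_le_resG (m : ℕ) (hω : IsInclusion ω) (h : IsPhase ω S) :
    ∃ C : ℝ, 0 ≤ C ∧ ∀ u : H1 d m, ∃ k, resG S k = 0 ∧ ‖u - k‖ ≤ C * ‖resG S u‖ := by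
  obtain ⟨C, hC, hN⟩ := exists_norm_sub_zeroOn_le m hω h
  refine exists_norm_sub_le_of_ker hC (fun u hu => (mem_zeroOn.1 hu).2.2) hN fun ε hε => ?_
  obtain ⟨n, l, hl⟩ := exists_finite_functionals d m hε
  refine ⟨n, l, fun u => le_trans ?_ (hl u)⟩
  gcongr
  exact norm_resF_le S u

/-- The constant function `c`. -/
noncomputable def H1.const (c : E m) : H1 d m :=
  H1.ofPeriodic (fun _ => c) (fun _ _ => rfl) contDiff_const

theorem H1.fn_const (c : E m) : (H1.const c : H1 d m).fn =ᵐ[cellMeasure d] fun _ => c :=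
  H1.fn_ofPeriodic _ _

theorem H1.grad_const (c : E m) : (H1.const c : H1 d m).grad =ᵐ[cellMeasure d] 0 := by
  refine (H1.grad_ofPeriodic _ _).trans (Eventually.of_forall fun y => ?_)
  ext p
  simp [gradOf]

theorem H1.gradL_const (c : E m) : H1.gradL (H1.const c : H1 d m) = 0 :=
  Lp.ext ((H1.grad_const c).trans (Lp.coeFn_zero _ _ _).symm)

/-- A function whose gradient vanishes on a phase has constant trace. -/
theorem exists_sub_const_mem_zeroTrace (hω : IsInclusion ω) (h : IsPhase ω S) {u : H1 d m}
    (hu : resG S u = 0) : ∃ c : E m, u - H1.const c ∈ zeroTrace m ω := by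
  have hSo := h.isOpen hω
  have hSY := h.subset hω
  have hr := restrict_cellMeasure hSo hSY
  have h1 : ∀ᵐ y ∂volume, y ∈ S → u.grad y = 0 := by
    rw [← ae_restrict_iff' hSo.measurableSet, ← hr]
    filter_upwards [coeFn_resG S u, Lp.coeFn_zero (Grad d m) 2 ((cellMeasure d).restrict S)]
      with y hy h0
    rw [← hy, hu, h0]
    rfl
  obtain ⟨c, hc⟩ := H1.exists_eq_const_of_grad_eq_zero u hSo hSY (h.isConnected hω) h1
  rw [← ae_restrict_iff' hSo.measurableSet, ← hr] at hc
  refine ⟨c, mem_zeroTrace_of_res_eq_zero hω h ?_ ?_⟩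
  · refine Lp.ext ((coeFn_resF S _).trans ?_)
    filter_upwards [hc, ae_restrict_of_ae (H1.fn_sub u (H1.const c)),
      ae_restrict_of_ae (H1.fn_const (d := d) c),
      Lp.coeFn_zero (E m) 2 ((cellMeasure d).restrict S)] with y e1 e2 e3 e4
    rw [e2, e4, Pi.sub_apply, e1, e3, sub_self]
    rfl
  · rw [map_sub, hu, zero_sub, neg_eq_zero]
    exact norm_le_zero_iff.1 ((norm_resG_le S _).trans (by rw [H1.gradL_const, norm_zero]))

end Phase

/-! ### An abstract two-phase problem -/

/-- The data of a high contrast problem on the Hilbert space `V`: the energies `B₁` and `B₂` of the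
two phases, loads `f₁` and `f₂`, and the space `K` of the functions that the energy of the first
phase does not see. -/
structure IsTwoPhase {V : Type*} [NormedAddCommGroup V] [InnerProductSpace ℝ V]
    (K : Submodule ℝ V) (B₁ B₂ : V →L[ℝ] V →L[ℝ] ℝ) (f₁ f₂ : V →L[ℝ] ℝ) (c M M' : ℝ) : Prop where
  c_pos : 0 < c
  M_nonneg : 0 ≤ M
  load_nonneg : 0 ≤ M'
  isClosed : IsClosed (K : Set V)
  coercive : ∀ u, c * ‖u‖ ^ 2 ≤ B₁ u u + B₂ u u
  nonneg₁ : ∀ u, 0 ≤ B₁ u u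
  nonneg₂ : ∀ u, 0 ≤ B₂ u u
  exists_dist_le : ∀ u, ∃ k ∈ K, c * ‖u - k‖ ^ 2 ≤ B₁ u u
  eq_zero_left : ∀ k ∈ K, ∀ v, B₁ k v = 0
  eq_zero_right : ∀ k ∈ K, ∀ v, B₁ v k = 0
  load_eq_zero : ∀ k ∈ K, f₁ k = 0
  bound₁ : ∀ u v, |B₁ u v| ≤ M * ‖u‖ * ‖v‖
  bound₂ : ∀ u v, |B₂ u v| ≤ M * ‖u‖ * ‖v‖
  load_bound₁ : ∀ v, |f₁ v| ≤ M' * ‖v‖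
  load_bound₂ : ∀ v, |f₂ v| ≤ M' * ‖v‖

/-- The limit of the two-phase problem `B₁ χ + f₁ + s (B₂ χ + f₂) = 0` as `s → 0`. -/
def IsLimitSolution {V : Type*} [NormedAddCommGroup V] [InnerProductSpace ℝ V]
    (K : Submodule ℝ V) (B₁ B₂ : V →L[ℝ] V →L[ℝ] ℝ) (f₁ f₂ : V →L[ℝ] ℝ) (χ : V) : Prop :=
  (∀ v, B₁ χ v + f₁ v = 0) ∧ ∀ k ∈ K, B₂ χ k + f₂ k = 0

/-- The bilinear form `B (g u) (g v)`. -/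
noncomputable def pullbackForm {V G : Type*} [NormedAddCommGroup V] [NormedSpace ℝ V]
    [NormedAddCommGroup G] [NormedSpace ℝ G] (B : G →L[ℝ] G →L[ℝ] ℝ) (g : V →L[ℝ] G) :
    V →L[ℝ] V →L[ℝ] ℝ := B.bilinearComp g g

section LaxMilgram

variable {V : Type*} [NormedAddCommGroup V] [InnerProductSpace ℝ V] [CompleteSpace V]

/-- The Lax–Milgram theorem on a closed subspace. -/
theorem exists_forall_bilin_eq {N : Submodule ℝ V} (hN : IsClosed (N : Set V))
    (B : V →L[ℝ] V →L[ℝ] ℝ) (f : V →L[ℝ] ℝ) {c : ℝ} (hc : 0 < c)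
    (hB : ∀ u ∈ N, c * ‖u‖ ^ 2 ≤ B u u) : ∃ u ∈ N, ∀ v ∈ N, B u v + f v = 0 := by
  have : CompleteSpace N := hN.completeSpace_coe
  let B' : N →L[ℝ] N →L[ℝ] ℝ := B.bilinearComp N.subtypeL N.subtypeL
  have hB' : IsCoercive B' := ⟨c, hc, fun u => by
    have := hB u u.2
    rw [pow_two, ← mul_assoc] at this
    exact this⟩
  let e := hB'.continuousLinearEquivOfBilin
  let F := (InnerProductSpace.toDual ℝ N).symm (-(f.comp N.subtypeL))
  refine ⟨e.symm F, (e.symm F).2, fun v hv => ?_⟩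
  have h1 := hB'.continuousLinearEquivOfBilin_apply (e.symm F) ⟨v, hv⟩
  have h2 : hB'.continuousLinearEquivOfBilin (e.symm F) = F := e.apply_symm_apply F
  rw [h2, InnerProductSpace.toDual_symm_apply] at h1
  have h3 : -f v = B (e.symm F) v := h1
  linarith

end LaxMilgram

namespace IsTwoPhase

variable {V : Type*} [NormedAddCommGroup V] [InnerProductSpace ℝ V]
  {K : Submodule ℝ V} {B₁ B₂ : V →L[ℝ] V →L[ℝ] ℝ} {f₁ f₂ : V →L[ℝ] ℝ} {c M M' : ℝ}

theorem coercive_smul (h : IsTwoPhase K B₁ B₂ f₁ f₂ c M M') {s : ℝ} (hs : 0 < s) (u : V) :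
    min s 1 * c * ‖u‖ ^ 2 ≤ B₁ u u + s * B₂ u u := by
  have h1 := mul_le_mul_of_nonneg_left (h.coercive u) (le_min hs.le zero_le_one)
  have h2 := mul_le_mul_of_nonneg_right (min_le_right s 1) (h.nonneg₁ u)
  have h3 := mul_le_mul_of_nonneg_right (min_le_left s 1) (h.nonneg₂ u)
  linarith

theorem existsUnique_solution [CompleteSpace V] (h : IsTwoPhase K B₁ B₂ f₁ f₂ c M M') {s : ℝ}
    (hs : 0 < s) : ∃! χ, ∀ v, B₁ χ v + f₁ v + s * (B₂ χ v + f₂ v) = 0 := by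
  have hc : 0 < min s 1 * c := mul_pos (lt_min hs one_pos) h.c_pos
  obtain ⟨χ, -, hχ⟩ := exists_forall_bilin_eq (N := (⊤ : Submodule ℝ V)) isClosed_univ
    (B₁ + s • B₂) (f₁ + s • f₂) hc fun u _ => h.coercive_smul hs u
  have hχ' : ∀ v, B₁ χ v + f₁ v + s * (B₂ χ v + f₂ v) = 0 := fun v => by
    have h1 := hχ v trivial
    simp only [add_apply, smul_apply, smul_eq_mul] at h1
    linarith
  refine ⟨χ, hχ', fun χ' h' => ?_⟩
  have h1 := h.coercive_smul hs (χ' - χ)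
  have h2 : B₁ (χ' - χ) (χ' - χ) + s * B₂ (χ' - χ) (χ' - χ) = 0 := by
    have e1 := hχ' (χ' - χ)
    have e2 := h' (χ' - χ)
    simp only [map_sub, sub_apply] at e1 e2 ⊢
    linarith
  rw [h2] at h1
  have h3 : ‖χ' - χ‖ ^ 2 ≤ 0 := by
    by_contra! hcon
    nlinarith [mul_pos hc hcon]
  have h4 : ‖χ' - χ‖ = 0 := pow_eq_zero_iff two_ne_zero |>.1 (le_antisymm h3 (sq_nonneg _))
  exact sub_eq_zero.1 (norm_eq_zero.1 h4)

/-- The limit problem is solved in two steps: the first equation on `Kᗮ`, then the second one for a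
correction in `K`, which the first equation does not see. -/
theorem exists_isLimitSolution [CompleteSpace V] (h : IsTwoPhase K B₁ B₂ f₁ f₂ c M M') :
    ∃ χ, IsLimitSolution K B₁ B₂ f₁ f₂ χ := by
  have : CompleteSpace K := h.isClosed.completeSpace_coe
  obtain ⟨χ, -, hχ⟩ := exists_forall_bilin_eq K.isClosed_orthogonal B₁ f₁ h.c_pos fun u hu => by
    obtain ⟨k, hk, hku⟩ := h.exists_dist_le u
    refine le_trans ?_ hku
    have h0 : inner ℝ u k = 0 := by
      rw [real_inner_comm]
      exact K.mem_orthogonal u |>.1 hu k hk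
    have : ‖u - k‖ ^ 2 = ‖u‖ ^ 2 + ‖k‖ ^ 2 := by
      rw [norm_sub_sq_real, h0]
      ring
    rw [this]
    exact mul_le_mul_of_nonneg_left (by linarith [sq_nonneg ‖k‖]) h.c_pos.le
  obtain ⟨k₀, hk₀, hk⟩ := exists_forall_bilin_eq h.isClosed B₂ (f₂ + B₂ χ) h.c_pos fun u hu => by
    have := h.coercive u
    rwa [h.eq_zero_left u hu, zero_add] at this
  refine ⟨χ + k₀, fun v => ?_, fun k hkK => ?_⟩
  · have hv := hχ _ (K.sub_starProjection_mem_orthogonal v)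
    have hP := K.starProjection_apply_mem v
    rw [map_sub, map_sub, h.eq_zero_right _ hP, h.load_eq_zero _ hP, sub_zero, sub_zero] at hv
    rw [map_add, add_apply, h.eq_zero_left _ hk₀, add_zero, hv]
  · have := hk k hkK
    simp only [map_add, add_apply] at this ⊢
    linarith

theorem norm_le_of_isLimitSolution (h : IsTwoPhase K B₁ B₂ f₁ f₂ c M M') {χ : V}
    (hχ : IsLimitSolution K B₁ B₂ f₁ f₂ χ) : c ^ 2 * ‖χ‖ ≤ (2 * c + M) * M' := by
  have hc := h.c_pos
  have hM := h.M_nonneg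
  obtain ⟨k, hk, hkχ⟩ := h.exists_dist_le χ
  have hM' := h.load_nonneg
  have h1 : c * ‖χ - k‖ ≤ M' := by
    rcases (norm_nonneg (χ - k)).eq_or_lt with h0 | h0
    · rw [← h0, mul_zero]
      exact hM'
    · have e1 : B₁ χ χ = -f₁ (χ - k) := by
        rw [map_sub, h.load_eq_zero k hk]
        linarith [hχ.1 χ]
      have e2 := (neg_le_abs _).trans (h.load_bound₁ (χ - k))
      rw [e1] at hkχ
      have e3 : (c * ‖χ - k‖) * ‖χ - k‖ ≤ M' * ‖χ - k‖ := by nlinarith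
      exact le_of_mul_le_mul_right e3 h0
  have h2 : c * ‖k‖ ≤ M' + M * ‖χ - k‖ := by
    rcases (norm_nonneg k).eq_or_lt with h0 | h0
    · rw [← h0, mul_zero]
      positivity
    · have e1 := h.coercive k
      rw [h.eq_zero_left k hk, zero_add] at e1
      have e2 : B₂ k k = -f₂ k - B₂ (χ - k) k := by
        rw [map_sub, sub_apply]
        linarith [hχ.2 k hk]
      have e3 := (neg_le_abs _).trans (h.load_bound₂ k)
      have e4 := (neg_le_abs _).trans (h.bound₂ (χ - k) k)
      have e5 : (c * ‖k‖) * ‖k‖ ≤ (M' + M * ‖χ - k‖) * ‖k‖ := by nlinarith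
      exact le_of_mul_le_mul_right e5 h0
  have h3 : ‖χ‖ ≤ ‖χ - k‖ + ‖k‖ := by simpa using norm_add_le (χ - k) k
  calc c ^ 2 * ‖χ‖ ≤ c ^ 2 * (‖χ - k‖ + ‖k‖) := by gcongr
    _ = c * (c * ‖χ - k‖) + c * (c * ‖k‖) := by ring
    _ ≤ c * M' + c * (M' + M * ‖χ - k‖) := by gcongr
    _ = 2 * c * M' + M * (c * ‖χ - k‖) := by ring
    _ ≤ 2 * c * M' + M * M' := by gcongr
    _ = _ := by ring

theorem isLimitSolution_unique (h : IsTwoPhase K B₁ B₂ f₁ f₂ c M M') {χ χ' : V}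
    (hχ : IsLimitSolution K B₁ B₂ f₁ f₂ χ) (hχ' : IsLimitSolution K B₁ B₂ f₁ f₂ χ') : χ = χ' := by
  -- The difference solves the problem without loads, where the bound above reads `c² ‖χ‖ ≤ 0`.
  have h0 : IsTwoPhase K B₁ B₂ 0 0 c M 0 :=
    { h with
      load_nonneg := le_rfl
      load_eq_zero := fun _ _ => rfl
      load_bound₁ := fun v => by simp
      load_bound₂ := fun v => by simp }
  have hd : IsLimitSolution K B₁ B₂ 0 0 (χ - χ') := by
    refine ⟨fun v => ?_, fun k hk => ?_⟩
    · have e1 := hχ.1 v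
      have e2 := hχ'.1 v
      simp only [map_sub, sub_apply, zero_apply]
      linarith
    · have e1 := hχ.2 k hk
      have e2 := hχ'.2 k hk
      simp only [map_sub, sub_apply, zero_apply]
      linarith
  have h1 := h0.norm_le_of_isLimitSolution hd
  rw [mul_zero] at h1
  have h2 : ‖χ - χ'‖ ≤ 0 := by
    by_contra! hcon
    exact absurd h1 (not_le.2 (mul_pos (pow_pos h.c_pos 2) hcon))
  exact sub_eq_zero.1 (norm_le_zero_iff.1 h2)

/-- The solution with contrast `s` is at distance `O(s)` from the limit. -/
theorem norm_sub_le_of_isLimitSolution (h : IsTwoPhase K B₁ B₂ f₁ f₂ c M M') {χ χs : V} {s : ℝ}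
    (hs : 0 < s) (hχ : IsLimitSolution K B₁ B₂ f₁ f₂ χ)
    (hχs : ∀ v, B₁ χs v + f₁ v + s * (B₂ χs v + f₂ v) = 0) :
    c ^ 3 * ‖χs - χ‖ ≤ 4 * M ^ 2 * (M * ‖χ‖ + M') * s := by
  have hc := h.c_pos
  have hM := h.M_nonneg
  set w := χs - χ with hw
  obtain ⟨k, hk, hkw⟩ := h.exists_dist_le w
  have hwv : ∀ v, B₁ w v + s * B₂ w v = -(s * (B₂ χ v + f₂ v)) := fun v => by
    have e1 := hχ.1 v
    have e2 := hχs v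
    simp only [hw, map_sub, sub_apply]
    linarith
  -- Both solutions satisfy the second equation against `K`.
  have hwk : B₂ w k = 0 := by
    have := hwv k
    rw [h.eq_zero_right k hk, hχ.2 k hk, mul_zero, neg_zero, zero_add] at this
    exact (mul_eq_zero.1 this).resolve_left hs.ne'
  rcases (norm_nonneg w).eq_or_lt with h0 | h0
  · have hM' := h.load_nonneg
    rw [← h0, mul_zero]
    positivity
  have h1 : c * ‖w‖ ≤ 2 * M * ‖w - k‖ := by
    have e1 := h.coercive w
    have e2 : B₁ w w + B₂ w w = B₁ w (w - k) + B₂ w (w - k) := by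
      rw [map_sub (B₁ w) w k, map_sub (B₂ w) w k, hwk, h.eq_zero_right k hk, sub_zero, sub_zero]
    have e3 := (le_abs_self _).trans (h.bound₁ w (w - k))
    have e4 := (le_abs_self _).trans (h.bound₂ w (w - k))
    have e5 : (c * ‖w‖) * ‖w‖ ≤ (2 * M * ‖w - k‖) * ‖w‖ := by nlinarith
    exact le_of_mul_le_mul_right e5 h0
  have h2 : B₁ w w ≤ s * ((M * ‖χ‖ + M') * ‖w‖) := by
    have e1 := hwv w
    have e2 := mul_nonneg hs.le (h.nonneg₂ w)
    have e3 := (neg_le_abs _).trans (h.bound₂ χ w)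
    have e4 := (neg_le_abs _).trans (h.load_bound₂ w)
    nlinarith
  have h3 : c ^ 2 * ‖w‖ ^ 2 ≤ 4 * M ^ 2 * ‖w - k‖ ^ 2 := by
    have := pow_le_pow_left₀ (by positivity) h1 2
    nlinarith
  have h4 : c ^ 3 * ‖w‖ ^ 2 ≤ 4 * M ^ 2 * B₁ w w := by
    nlinarith [mul_le_mul_of_nonneg_left hkw (by positivity : 0 ≤ 4 * M ^ 2)]
  have h5 : (c ^ 3 * ‖w‖) * ‖w‖ ≤ (4 * M ^ 2 * (M * ‖χ‖ + M') * s) * ‖w‖ := by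
    have := mul_le_mul_of_nonneg_left h2 (by positivity : 0 ≤ 4 * M ^ 2)
    nlinarith
  exact le_of_mul_le_mul_right h5 h0

end IsTwoPhase

/-! ### The bilinear form of a phase -/

section Pairing

variable {d m : ℕ} {A : Coeff d m} {μ : ℝ}

theorem pairing_add_left (y : E d) (P P' Q : Grad d m) :
    pairing A y (P + P') Q = pairing A y P Q + pairing A y P' Q := by
  simp only [pairing, PiLp.add_apply, mul_add, add_mul, Finset.sum_add_distrib]

theorem pairing_smul_left (y : E d) (c : ℝ) (P Q : Grad d m) :
    pairing A y (c • P) Q = c * pairing A y P Q := by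
  simp only [pairing, PiLp.smul_apply, smul_eq_mul, Finset.mul_sum]
  refine Finset.sum_congr rfl fun i _ => Finset.sum_congr rfl fun j _ =>
    Finset.sum_congr rfl fun α _ => Finset.sum_congr rfl fun β _ => by ring

theorem IsAdmissible.pairing_comm (hA : IsAdmissible μ A) (y : E d) (P Q : Grad d m) :
    pairing A y P Q = pairing A y Q P := by
  simp only [pairing]
  rw [Finset.sum_comm]
  refine Finset.sum_congr rfl fun i _ => Finset.sum_congr rfl fun j _ => ?_
  rw [Finset.sum_comm]
  refine Finset.sum_congr rfl fun α _ => Finset.sum_congr rfl fun β _ => ?_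
  rw [hA.symm]
  ring

theorem IsAdmissible.pairing_add_right (hA : IsAdmissible μ A) (y : E d) (P Q Q' : Grad d m) :
    pairing A y P (Q + Q') = pairing A y P Q + pairing A y P Q' := by
  rw [hA.pairing_comm, pairing_add_left, hA.pairing_comm y Q, hA.pairing_comm y Q']

theorem IsAdmissible.pairing_smul_right (hA : IsAdmissible μ A) (y : E d) (c : ℝ)
    (P Q : Grad d m) : pairing A y P (c • Q) = c * pairing A y P Q := by
  rw [hA.pairing_comm, pairing_smul_left, hA.pairing_comm]

theorem norm_sq_grad (P : Grad d m) : ‖P‖ ^ 2 = ∑ i, ∑ α, P (i, α) ^ 2 := by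
  rw [EuclideanSpace.norm_sq_eq, Fintype.sum_prod_type]
  simp

theorem pairing_self (y : E d) (P : Grad d m) :
    pairing A y P P = ∑ i, ∑ j, ∑ α, ∑ β, A y i j α β * P (i, α) * P (j, β) := by
  simp only [pairing]
  refine Finset.sum_congr rfl fun i _ => Finset.sum_congr rfl fun j _ =>
    Finset.sum_congr rfl fun α _ => Finset.sum_congr rfl fun β _ => by ring

theorem IsAdmissible.le_pairing_self (hA : IsAdmissible μ A) (y : E d) (P : Grad d m) :
    μ * ‖P‖ ^ 2 ≤ pairing A y P P := by
  rw [norm_sq_grad, pairing_self]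
  exact hA.elliptic_lower y fun i α => P (i, α)

theorem IsAdmissible.pairing_self_le (hA : IsAdmissible μ A) (y : E d) (P : Grad d m) :
    pairing A y P P ≤ μ⁻¹ * ‖P‖ ^ 2 := by
  rw [norm_sq_grad, pairing_self]
  exact hA.elliptic_upper y fun i α => P (i, α)

/-- By symmetry, the upper ellipticity bound controls the off-diagonal values. -/
theorem IsAdmissible.abs_pairing_le (hA : IsAdmissible μ A) (hμ : 0 < μ) (y : E d)
    (P Q : Grad d m) : |pairing A y P Q| ≤ μ⁻¹ * ‖P‖ * ‖Q‖ := by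
  have key : ∀ P Q : Grad d m, pairing A y P Q ≤ μ⁻¹ * ‖P‖ * ‖Q‖ := by
    intro P Q
    -- Polarization gives the sum of squares; rescaling `P` and `Q` turns it into the product.
    have h0 : ∀ P Q : Grad d m, 4 * pairing A y P Q ≤ μ⁻¹ * (2 * (‖P‖ ^ 2 + ‖Q‖ ^ 2)) := by
      intro P Q
      have h1 := hA.pairing_self_le y (P + Q)
      have h2 := hA.le_pairing_self y (P + (-1 : ℝ) • Q)
      have h3 : ‖P + Q‖ ^ 2 ≤ 2 * (‖P‖ ^ 2 + ‖Q‖ ^ 2) := by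
        have := pow_le_pow_left₀ (norm_nonneg _) (norm_add_le P Q) 2
        nlinarith [sq_nonneg (‖P‖ - ‖Q‖)]
      have h4 : 0 ≤ pairing A y (P + (-1 : ℝ) • Q) (P + (-1 : ℝ) • Q) :=
        le_trans (by positivity) h2
      have h5 := mul_le_mul_of_nonneg_left h3 (inv_nonneg.2 hμ.le)
      simp only [pairing_add_left, pairing_smul_left, hA.pairing_add_right,
        hA.pairing_smul_right] at h1 h4
      rw [hA.pairing_comm y Q P] at h1 h4
      linarith
    rcases (norm_nonneg P).eq_or_lt with hP | hP
    · rw [norm_eq_zero.1 hP.symm]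
      have := pairing_smul_left (A := A) y 0 P Q
      rw [zero_smul, zero_mul] at this
      simp [this]
    rcases (norm_nonneg Q).eq_or_lt with hQ | hQ
    · rw [norm_eq_zero.1 hQ.symm]
      have := hA.pairing_smul_right y 0 P Q
      rw [zero_smul, zero_mul] at this
      simp [this]
    have h1 := h0 (‖Q‖ • P) (‖P‖ • Q)
    rw [pairing_smul_left, hA.pairing_smul_right, norm_smul, norm_smul, norm_norm, norm_norm] at h1
    have hPQ : 0 < ‖P‖ * ‖Q‖ := mul_pos hP hQ
    have h2 : ‖P‖ * ‖Q‖ * pairing A y P Q ≤ ‖P‖ * ‖Q‖ * (μ⁻¹ * ‖P‖ * ‖Q‖) := by nlinarith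
    exact le_of_mul_le_mul_left h2 hPQ
  refine abs_le.2 ⟨?_, key P Q⟩
  have h1 := key ((-1 : ℝ) • P) Q
  rw [pairing_smul_left, norm_smul, norm_neg, norm_one, one_mul] at h1
  linarith

theorem IsAdmissible.integrable_pairing (hA : IsAdmissible μ A) (hμ : 0 < μ) (P Q : L2Grad d m) :
    Integrable (fun y => pairing A y (P y) (Q y)) (cellMeasure d) := by
  have hP := Lp.memLp P
  have hQ := Lp.memLp Q
  have hdom : Integrable (fun y => μ⁻¹ * (‖P y‖ * ‖Q y‖)) (cellMeasure d) :=
    (hP.norm.integrable_mul hQ.norm).const_mul _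
  refine hdom.mono' ?_ (Eventually.of_forall fun y => ?_)
  · have hc : ∀ (R : L2Grad d m) p, AEStronglyMeasurable (fun y => R y p) (cellMeasure d) :=
      fun R p => (EuclideanSpace.proj p : Grad d m →L[ℝ] ℝ).continuous.comp_aestronglyMeasurable
        (Lp.aestronglyMeasurable R)
    simp only [pairing]
    refine Finset.aestronglyMeasurable_fun_sum _ fun i _ =>
      Finset.aestronglyMeasurable_fun_sum _ fun j _ =>
      Finset.aestronglyMeasurable_fun_sum _ fun α _ =>
      Finset.aestronglyMeasurable_fun_sum _ fun β _ => ?_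
    exact ((hA.measurable i j α β).aestronglyMeasurable.mul (hc P _)).mul (hc Q _)
  · rw [Real.norm_eq_abs, ← mul_assoc]
    exact hA.abs_pairing_le hμ y _ _

end Pairing

section Form

variable {d m : ℕ} {A : Coeff d m} {μ : ℝ}

/-- The bilinear form `∫_{S ∩ Y} A P · Q` on `L²(Y; ℝ^{d × m})`. -/
noncomputable def form (hA : IsAdmissible μ A) (hμ : 0 < μ) (S : Set (E d)) :
    L2Grad d m →L[ℝ] L2Grad d m →L[ℝ] ℝ :=
  LinearMap.mkContinuous₂
    (LinearMap.mk₂ ℝ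
      (fun P Q : L2Grad d m => ∫ y in S, pairing A y (P y) (Q y) ∂cellMeasure d)
      (fun P P' Q => by
        rw [← integral_add (hA.integrable_pairing hμ P Q).restrict
          (hA.integrable_pairing hμ P' Q).restrict]
        refine integral_congr_ae ?_
        filter_upwards [ae_restrict_of_ae (Lp.coeFn_add P P')] with y hy
        rw [hy, Pi.add_apply, pairing_add_left])
      (fun c P Q => by
        rw [smul_eq_mul, ← integral_const_mul]
        refine integral_congr_ae ?_
        filter_upwards [ae_restrict_of_ae (Lp.coeFn_smul c P)] with y hy
        rw [hy, Pi.smul_apply, pairing_smul_left])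
      (fun P Q Q' => by
        rw [← integral_add (hA.integrable_pairing hμ P Q).restrict
          (hA.integrable_pairing hμ P Q').restrict]
        refine integral_congr_ae ?_
        filter_upwards [ae_restrict_of_ae (Lp.coeFn_add Q Q')] with y hy
        rw [hy, Pi.add_apply, hA.pairing_add_right])
      (fun c P Q => by
        rw [smul_eq_mul, ← integral_const_mul]
        refine integral_congr_ae ?_
        filter_upwards [ae_restrict_of_ae (Lp.coeFn_smul c Q)] with y hy
        rw [hy, Pi.smul_apply, hA.pairing_smul_right]))
    μ⁻¹ (fun P Q => by
      have h1 : Integrable (fun y => ‖P y‖ * ‖Q y‖) (cellMeasure d) :=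
        (Lp.memLp P).norm.integrable_mul (Lp.memLp Q).norm
      have h2 : ∫ y, ‖P y‖ * ‖Q y‖ ∂cellMeasure d ≤ ‖P‖ * ‖Q‖ := by
        have h3 := real_inner_le_norm ((Lp.memLp P).norm.toLp _) ((Lp.memLp Q).norm.toLp _)
        rw [Lp.norm_toLp, Lp.norm_toLp, eLpNorm_norm, eLpNorm_norm, L2.inner_def] at h3
        refine le_trans (le_of_eq ?_) h3
        refine integral_congr_ae ?_
        filter_upwards [(Lp.memLp P).norm.coeFn_toLp, (Lp.memLp Q).norm.coeFn_toLp] with y e1 e2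
        rw [e1, e2]
        simp [mul_comm]
      calc ‖∫ y in S, pairing A y (P y) (Q y) ∂cellMeasure d‖
          ≤ ∫ y in S, μ⁻¹ * (‖P y‖ * ‖Q y‖) ∂cellMeasure d :=
            norm_integral_le_of_norm_le (h1.restrict.const_mul _) (Eventually.of_forall fun y => by
              rw [Real.norm_eq_abs, ← mul_assoc]
              exact hA.abs_pairing_le hμ y _ _)
        _ ≤ ∫ y, μ⁻¹ * (‖P y‖ * ‖Q y‖) ∂cellMeasure d :=
            setIntegral_le_integral (h1.const_mul _) (Eventually.of_forall fun y => by positivity)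
        _ ≤ μ⁻¹ * (‖P‖ * ‖Q‖) := by
            rw [integral_const_mul]
            exact mul_le_mul_of_nonneg_left h2 (inv_nonneg.2 hμ.le)
        _ = _ := by ring)

variable (hA : IsAdmissible μ A) (hμ : 0 < μ)

theorem form_apply (S : Set (E d)) (P Q : L2Grad d m) :
    form hA hμ S P Q = ∫ y in S, pairing A y (P y) (Q y) ∂cellMeasure d := rfl

theorem abs_form_le (S : Set (E d)) (P Q : L2Grad d m) :
    |form hA hμ S P Q| ≤ μ⁻¹ * ‖P‖ * ‖Q‖ := by
  refine (((form hA hμ S).le_opNorm₂ P Q)).trans ?_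
  gcongr
  exact LinearMap.mkContinuous₂_norm_le _ (inv_nonneg.2 hμ.le) _

theorem form_comm (S : Set (E d)) (P Q : L2Grad d m) :
    form hA hμ S P Q = form hA hμ S Q P := by
  simp only [form_apply, hA.pairing_comm]

theorem le_form_self (S : Set (E d)) (u : H1 d m) :
    μ * ‖resG S u‖ ^ 2 ≤ form hA hμ S (H1.gradL u) (H1.gradL u) := by
  rw [← real_inner_self_eq_norm_sq, L2.inner_def, form_apply, ← integral_const_mul]
  refine integral_mono_ae ?_ (hA.integrable_pairing hμ _ _).restrict ?_
  · simp only [real_inner_self_eq_norm_sq]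
    exact ((Lp.memLp (resG S u)).integrable_norm_pow (by norm_num)).const_mul _
  · filter_upwards [coeFn_resG S u] with y hy
    rw [hy, H1.coe_gradL]
    simp only [real_inner_self_eq_norm_sq]
    exact hA.le_pairing_self y _

theorem form_self_nonneg (S : Set (E d)) (u : H1 d m) :
    0 ≤ form hA hμ S (H1.gradL u) (H1.gradL u) :=
  le_trans (by positivity) (le_form_self hA hμ S u)

theorem form_eq_zero_right {S : Set (E d)} (P : L2Grad d m) {v : H1 d m} (hv : resG S v = 0) :
    form hA hμ S P (H1.gradL v) = 0 := by
  rw [form_apply]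
  refine integral_eq_zero_of_ae ?_
  filter_upwards [coeFn_resG S v, Lp.coeFn_zero (Grad d m) 2 ((cellMeasure d).restrict S)]
    with y h1 h2
  rw [hv, h2] at h1
  rw [H1.coe_gradL, ← h1]
  simp [pairing]

theorem form_eq_zero_left {S : Set (E d)} {u : H1 d m} (hu : resG S u = 0) (Q : L2Grad d m) :
    form hA hμ S (H1.gradL u) Q = 0 := by
  rw [form_comm, form_eq_zero_right hA hμ Q hu]

/-- The constant gradient of `y_i e^α`. -/
noncomputable def unitGrad (i : Fin d) (α : Fin m) : L2Grad d m :=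
  MemLp.toLp (fun _ => EuclideanSpace.single (i, α) (1 : ℝ)) (memLp_const _)

theorem coeFn_correctedGrad (i : Fin d) (α : Fin m) (χ : H1 d m) :
    (H1.gradL χ + unitGrad i α : L2Grad d m) =ᵐ[cellMeasure d] correctedGrad i α χ := by
  filter_upwards [Lp.coeFn_add (H1.gradL χ) (unitGrad i α),
    MemLp.coeFn_toLp (μ := cellMeasure d) (p := 2)
      (f := fun _ : E d => (EuclideanSpace.single (i, α) (1 : ℝ) : Grad d m)) (memLp_const _)]
    with y h1 h2
  rw [h1, Pi.add_apply, unitGrad, h2]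
  rfl

variable {ω S : Set (E d)}

theorem setIntegral_pairing_eq_form (hS : IsOpen S) (hSY : S ⊆ unitCell d) {F : E d → Grad d m}
    {P : L2Grad d m} (hF : P =ᵐ[cellMeasure d] F) (v : H1 d m) :
    ∫ y in S, pairing A y (F y) (v.grad y) = form hA hμ S P (H1.gradL v) := by
  rw [form_apply, restrict_cellMeasure hS hSY]
  refine integral_congr_ae ?_
  rw [← restrict_cellMeasure hS hSY]
  filter_upwards [ae_restrict_of_ae hF] with y hy
  rw [hy, H1.coe_gradL]

theorem setIntegral_phases (hω : IsInclusion ω) {f : E d → ℝ}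
    (hf : Integrable f (cellMeasure d)) :
    ∫ y in unitCell d, f y = (∫ y in ω, f y) + ∫ y in unitCell d \ closure ω, f y := by
  rw [← setIntegral_union (disjoint_left.2 fun y hy h => h.2 (subset_closure hy))
    hω.isOpen_background.measurableSet (IntegrableOn.mono_set hf hω.subset)
    (IntegrableOn.mono_set hf sdiff_subset)]
  refine setIntegral_congr_set ?_
  have hsub : ω ∪ unitCell d \ closure ω ⊆ unitCell d := union_subset hω.subset sdiff_subset
  filter_upwards [measure_eq_zero_iff_ae_notMem.1 hω.volume_frontier] with y hy
  refine propext ⟨fun hyY => ?_, fun h => hsub h⟩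
  by_cases hyω : y ∈ ω
  · exact Or.inl hyω
  · refine Or.inr ⟨hyY, fun hyc => hy ?_⟩
    rw [hω.isOpen.frontier_eq]
    exact ⟨hyc, hyω⟩

theorem integral_pairing_eq_form (hω : IsInclusion ω) {F : E d → Grad d m}
    {P : L2Grad d m} (hF : P =ᵐ[cellMeasure d] F) (v : H1 d m) :
    ∫ y in unitCell d, pairing A y (F y) (v.grad y) = form hA hμ ω P (H1.gradL v) +
      form hA hμ (unitCell d \ closure ω) P (H1.gradL v) := by
  rw [← setIntegral_pairing_eq_form hA hμ hω.isOpen hω.subset hF,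
    ← setIntegral_pairing_eq_form hA hμ hω.isOpen_background sdiff_subset hF]
  refine setIntegral_phases hω ((hA.integrable_pairing hμ P (H1.gradL v)).congr ?_)
  filter_upwards [hF] with y hy
  rw [hy, H1.coe_gradL]

theorem integral_contrast_pairing_eq_form (hω : IsInclusion ω) (δ : ℝ) {F : E d → Grad d m}
    {P : L2Grad d m} (hF : P =ᵐ[cellMeasure d] F) (v : H1 d m) :
    ∫ y in unitCell d, contrast ω δ y * pairing A y (F y) (v.grad y) =
      δ * form hA hμ ω P (H1.gradL v) +
        form hA hμ (unitCell d \ closure ω) P (H1.gradL v) := by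
  have hint : Integrable (fun y => pairing A y (F y) (v.grad y)) (cellMeasure d) := by
    refine (hA.integrable_pairing hμ P (H1.gradL v)).congr ?_
    filter_upwards [hF] with y hy
    rw [hy, H1.coe_gradL]
  have hm := hω.isOpen.measurableSet
  have hm' := hω.isOpen_background.measurableSet
  rw [← setIntegral_pairing_eq_form hA hμ hω.isOpen hω.subset hF,
    ← setIntegral_pairing_eq_form hA hμ hω.isOpen_background sdiff_subset hF,
    ← integral_const_mul, ← restrict_cellMeasure hω.isOpen hω.subset,
    ← restrict_cellMeasure hω.isOpen_background sdiff_subset, ← integral_indicator hm,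
    ← integral_indicator hm', ← integral_add ((hint.const_mul δ).indicator hm)
      (hint.indicator hm')]
  refine integral_congr_ae (Eventually.of_forall fun y => ?_)
  simp only [contrast, add_mul]
  congr 1
  · by_cases hy : y ∈ ω <;> simp [hy]
  · by_cases hy : y ∈ unitCell d \ closure ω
    · rw [indicator_of_mem hy, indicator_of_mem hy, one_mul]
    · rw [indicator_of_notMem hy, indicator_of_notMem hy, zero_mul]

end Form

/-! ### Functions of mean zero -/

section MeanZero

variable {d m : ℕ}

theorem H1.integrable_fn (u : H1 d m) : Integrable u.fn (cellMeasure d) :=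
  u.memLp_fn.integrable (by norm_num)

variable (d m) in
/-- The mean-zero functions in `H¹`. -/
noncomputable def meanZero : Submodule ℝ (H1 d m) where
  carrier := {u | u.MeanZero}
  zero_mem' := integral_eq_zero_of_ae H1.fn_zero
  add_mem' := fun {u v} hu hv => by
    have h1 : ∫ y in unitCell d, u.fn y = 0 := hu
    have h2 : ∫ y in unitCell d, v.fn y = 0 := hv
    change ∫ y in unitCell d, (u + v).fn y = 0
    rw [integral_congr_ae (H1.fn_add u v)]
    simp only [Pi.add_apply]
    rw [integral_add u.integrable_fn v.integrable_fn, h1, h2, add_zero]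
  smul_mem' := fun c u hu => by
    have h1 : ∫ y in unitCell d, u.fn y = 0 := hu
    change ∫ y in unitCell d, (c • u).fn y = 0
    rw [integral_congr_ae (H1.fn_smul c u)]
    simp only [Pi.smul_apply]
    rw [integral_smul, h1, smul_zero]

theorem isClosed_meanZero : IsClosed (meanZero d m : Set (H1 d m)) := by
  have : (meanZero d m : Set (H1 d m)) = ⋂ β : Fin m,
      {u | inner ℝ (testElem (fun _ => (1 : ℝ)) continuous_const β) (H1.fnL u) = 0} := by
    ext u
    have h1 : ∀ β, (∫ y in unitCell d, u.fn y) β = ∫ y in unitCell d, u.fn y β := fun β =>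
      ((EuclideanSpace.proj (𝕜 := ℝ) β).integral_comp_comm u.integrable_fn).symm
    simp only [mem_iInter, mem_ofPred_eq, inner_testElem, mul_one]
    change (∫ y in unitCell d, u.fn y = 0) ↔ ∀ β, ∫ y in unitCell d, u.fn y β = 0
    simp only [← h1]
    exact ⟨fun h β => by rw [h]; rfl, fun h => PiLp.ext h⟩
  rw [this]
  exact isClosed_iInter fun β => isClosed_eq (continuous_const.inner H1.fnL.continuous)
    continuous_const

instance completeSpace_meanZero : CompleteSpace (meanZero d m) :=
  isClosed_meanZero.completeSpace_coe

theorem exists_sub_const_mem_meanZero (u : H1 d m) : ∃ c : E m, u - H1.const c ∈ meanZero d m := by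
  have hpos : (cellMeasure d).real univ ≠ 0 := by
    rw [measureReal_def, Measure.restrict_apply_univ]
    refine ENNReal.toReal_ne_zero.2 ⟨?_, ?_⟩
    · refine ((isOpen_unitCell d).measure_pos _ ⟨0, fun i => ?_⟩).ne'
      simp
    · exact ((measure_mono (unitCell_subset_closedBall d)).trans_lt measure_closedBall_lt_top).ne
  refine ⟨((cellMeasure d).real univ)⁻¹ • ∫ y in unitCell d, u.fn y, ?_⟩
  change ∫ y in unitCell d, H1.fn (u - _) y = 0
  rw [integral_congr_ae (H1.fn_sub u _)]
  simp only [Pi.sub_apply]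
  rw [integral_sub u.integrable_fn (H1.integrable_fn _), integral_congr_ae (H1.fn_const _),
    integral_const, smul_inv_smul₀ hpos, sub_self]

theorem norm_sq_le_of_mem_meanZero {u : H1 d m} (hu : u ∈ meanZero d m) :
    ‖u‖ ^ 2 ≤ 2 * ‖H1.gradL u‖ ^ 2 := by
  rw [H1.norm_sq_eq]
  linarith [norm_fnL_le_of_meanZero u hu]

end MeanZero

/-! ### The two phases -/

/-- `S₁` and `S₂` are the inclusion and the background, in one of the two orders. -/
def ArePhases {d : ℕ} (ω S₁ S₂ : Set (E d)) : Prop :=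
  (S₁ = ω ∧ S₂ = unitCell d \ closure ω) ∨ (S₁ = unitCell d \ closure ω ∧ S₂ = ω)

section Phases

variable {d m : ℕ} {ω S₁ S₂ : Set (E d)}

theorem ArePhases.isPhase_left (h : ArePhases ω S₁ S₂) : IsPhase ω S₁ := h.imp And.left And.left

theorem ArePhases.symm (h : ArePhases ω S₁ S₂) : ArePhases ω S₂ S₁ :=
  Or.symm (h.imp And.symm And.symm)

theorem ArePhases.norm_gradL_sq (h : ArePhases ω S₁ S₂) (hω : IsInclusion ω) (u : H1 d m) :
    ‖H1.gradL u‖ ^ 2 = ‖resG S₁ u‖ ^ 2 + ‖resG S₂ u‖ ^ 2 := by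
  have key : ‖H1.gradL u‖ ^ 2 = ‖resG ω u‖ ^ 2 + ‖resG (unitCell d \ closure ω) u‖ ^ 2 := by
    have h1 : ∀ S, IsOpen S → S ⊆ unitCell d → ‖resG S u‖ ^ 2 = ∫ y in S, ‖u.grad y‖ ^ 2 := by
      intro S hS hSY
      rw [← real_inner_self_eq_norm_sq, L2.inner_def, ← restrict_cellMeasure hS hSY]
      refine integral_congr_ae ?_
      filter_upwards [coeFn_resG S u] with y hy
      rw [hy, real_inner_self_eq_norm_sq]
    rw [h1 _ hω.isOpen hω.subset, h1 _ hω.isOpen_background sdiff_subset, ← setIntegral_phases hω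
      (u.memLp_grad.integrable_norm_pow (by norm_num)), ← real_inner_self_eq_norm_sq, L2.inner_def]
    simp only [real_inner_self_eq_norm_sq, H1.coe_gradL]
  rcases h with ⟨rfl, rfl⟩ | ⟨rfl, rfl⟩
  · exact key
  · rw [key, add_comm]

/-- A functional that vanishes on the functions of zero trace supported in the background, and on
those supported in the inclusion, vanishes on all functions of zero trace: a test function off
`∂ω` is the sum of its parts in the two phases. -/
theorem ArePhases.eq_zero_of_mem_zeroTrace (h : ArePhases ω S₁ S₂) (hω : IsInclusion ω)
    {l : H1 d m →L[ℝ] ℝ} (h₁ : ∀ z ∈ zeroOn m ω S₁, l z = 0) (h₂ : ∀ z ∈ zeroOn m ω S₂, l z = 0)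
    {z : H1 d m} (hz : z ∈ zeroTrace m ω) : l z = 0 := by
  have key : (∀ z ∈ zeroOn m ω ω, l z = 0) → (∀ z ∈ zeroOn m ω (unitCell d \ closure ω), l z = 0) →
      l z = 0 := by
    intro hω₁ hω₂
    have hle : zeroTrace m ω ≤ LinearMap.ker l.toLinearMap := by
      refine Submodule.topologicalClosure_minimal _ (Submodule.span_le.2 ?_) l.isClosed_ker
      rintro v ⟨ϕ, hϕ, hv⟩
      have hU : IsOpen (tsupport ϕ)ᶜ := (isClosed_tsupport ϕ).isOpen_compl
      have hfU : frontier ω ⊆ (tsupport ϕ)ᶜ := fun y hy h => disjoint_left.1 hϕ.2.2 h hy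
      have h0 : ∀ y ∈ (tsupport ϕ)ᶜ, ϕ y = 0 := fun y hy => image_eq_zero_of_notMem_tsupport hy
      have hqc := contDiff_indicator hω.isOpen hU hfU hϕ.1 h0
      have hqs := tsupport_indicator_subset hω.isOpen hU hfU h0
      have hqK : HasCompactSupport (ω.indicator ϕ) :=
        hω.isCompact_closure.of_isClosed_subset (isClosed_tsupport _) (hqs.trans subset_closure)
      have hqL := exists_lipschitzWith_of_contDiff hqc hqK
      set Q := H1.ofLipschitz (ω.indicator ϕ) hqL hqK (hqs.trans hω.subset)
      have hQr : Represents (ω.indicator ϕ) Q := Represents.ofLipschitz _ _ _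
      have hvr : Represents ϕ v :=
        Represents.of_contDiff (hϕ.1.of_le (by exact_mod_cast le_top)) hϕ.2.1 hv
      have hQZ : Q ∈ zeroTrace m ω := by
        refine ofLipschitz_mem_zeroTrace_of_contDiff hω.frontier_subset hqc _ _ _
          (disjoint_left.2 fun y hy hyf => ?_)
        rw [hω.isOpen.frontier_eq] at hyf
        exact hyf.2 (hqs hy)
      have hvZ : v ∈ zeroTrace m ω := mem_zeroTrace_of_isTestOff hϕ hv
      have e1 : l Q = 0 := hω₂ Q ⟨hQZ, hQr.res_eq_zero hω.isOpen_background sdiff_subset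
        fun y hy => indicator_of_notMem (fun h => hy.2 (subset_closure h)) _⟩
      have e2 : l (v - Q) = 0 := hω₁ _ ⟨Submodule.sub_mem _ hvZ hQZ,
        (hvr.sub hQr).res_eq_zero hω.isOpen hω.subset fun y hy => by simp [hy]⟩
      rw [map_sub, e1, sub_zero] at e2
      exact e2
    exact hle hz
  rcases h with ⟨rfl, rfl⟩ | ⟨rfl, rfl⟩
  · exact key h₁ h₂
  · exact key h₂ h₁

variable {A : Coeff d m} {μ : ℝ} (hA : IsAdmissible μ A) (hμ : 0 < μ)

/-- The gradient of `χ + y_i e^α`. -/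
noncomputable def corrL (i : Fin d) (α : Fin m) (χ : H1 d m) : L2Grad d m :=
  H1.gradL χ + unitGrad i α

theorem coeFn_corrL (i : Fin d) (α : Fin m) (χ : H1 d m) :
    corrL i α χ =ᵐ[cellMeasure d] correctedGrad i α χ := coeFn_correctedGrad i α χ

theorem form_corrL (S : Set (E d)) (i : Fin d) (α : Fin m) (χ : H1 d m) (Q : L2Grad d m) :
    form hA hμ S (corrL i α χ) Q = form hA hμ S (H1.gradL χ) Q + form hA hμ S (unitGrad i α) Q := by
  rw [corrL, map_add, add_apply]

/-- If a flux has no divergence off `∂ω`, then it has none in each phase. -/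
theorem ArePhases.form_eq_zero (h : ArePhases ω S₁ S₂) (hω : IsInclusion ω) {P : L2Grad d m}
    (hP : ∀ z ∈ zeroTrace m ω,
      form hA hμ S₁ P (H1.gradL z) + form hA hμ S₂ P (H1.gradL z) = 0)
    {z : H1 d m} (hz : z ∈ zeroTrace m ω) : form hA hμ S₁ P (H1.gradL z) = 0 := by
  refine h.eq_zero_of_mem_zeroTrace hω (l := (form hA hμ S₁ P).comp H1.gradL) (fun w hw => ?_)
    (fun w hw => ?_) hz
  · exact form_eq_zero_right hA hμ P hw.2.2
  · have := hP w hw.1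
    rwa [form_eq_zero_right hA hμ P hw.2.2, add_zero] at this

/-- The cell problem with coefficient `1` in `S₁` and `s` in `S₂`. -/
def IsPhaseSolution (S₁ S₂ : Set (E d)) (s : ℝ) (i : Fin d) (α : Fin m) (χ : H1 d m) : Prop :=
  (∀ v : H1 d m, form hA hμ S₁ (corrL i α χ) (H1.gradL v) +
    s * form hA hμ S₂ (corrL i α χ) (H1.gradL v) = 0) ∧ χ.MeanZero

/-- The limit cell problem as the coefficient in `S₂` tends to zero: no flux leaves `S₁`, and the
flux has no divergence off `∂ω`. -/
def IsPhaseLimit (ω S₁ S₂ : Set (E d)) (i : Fin d) (α : Fin m) (χ : H1 d m) : Prop :=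
  (∀ v : H1 d m, form hA hμ S₁ (corrL i α χ) (H1.gradL v) = 0) ∧
  (∀ z ∈ zeroTrace m ω, form hA hμ S₁ (corrL i α χ) (H1.gradL z) +
    form hA hμ S₂ (corrL i α χ) (H1.gradL z) = 0) ∧ χ.MeanZero

/-- The energy of the phase `S` on mean-zero functions. -/
noncomputable def energyForm (S : Set (E d)) : meanZero d m →L[ℝ] meanZero d m →L[ℝ] ℝ :=
  pullbackForm (V := meanZero d m) (form hA hμ S) (H1.gradL.comp (meanZero d m).subtypeL)

/-- The load of `y_i e^α` in the phase `S`. -/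
noncomputable def load (S : Set (E d)) (i : Fin d) (α : Fin m) : meanZero d m →L[ℝ] ℝ :=
  (form hA hμ S (unitGrad i α)).comp (H1.gradL.comp (meanZero d m).subtypeL)

variable (m) in
/-- The mean-zero functions with vanishing gradient on `S`. -/
noncomputable def flatOn (S : Set (E d)) : Submodule ℝ (meanZero d m) :=
  LinearMap.ker ((resG (m := m) S).comp (meanZero d m).subtypeL).toLinearMap

theorem mem_flatOn {S : Set (E d)} {u : meanZero d m} : u ∈ flatOn m S ↔ resG S (u : H1 d m) = 0 :=
  Iff.rfl

theorem energyForm_apply (S : Set (E d)) (u v : meanZero d m) :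
    energyForm hA hμ S u v = form hA hμ S (H1.gradL u.1) (H1.gradL v.1) := rfl

theorem load_apply (S : Set (E d)) (i : Fin d) (α : Fin m) (v : meanZero d m) :
    load hA hμ S i α v = form hA hμ S (unitGrad i α) (H1.gradL v.1) := rfl

/-- A periodic mean-zero function is controlled by the energy of the two phases. -/
theorem ArePhases.le_form_add_form (h : ArePhases ω S₁ S₂) (hω : IsInclusion ω) {u : H1 d m}
    (hu : u ∈ meanZero d m) : μ / 2 * ‖u‖ ^ 2 ≤
      form hA hμ S₁ (H1.gradL u) (H1.gradL u) + form hA hμ S₂ (H1.gradL u) (H1.gradL u) := by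
  have h1 := norm_sq_le_of_mem_meanZero hu
  rw [h.norm_gradL_sq hω] at h1
  have h2 := le_form_self hA hμ S₁ u
  have h3 := le_form_self hA hμ S₂ u
  nlinarith

theorem ArePhases.exists_isTwoPhase (m : ℕ) (h : ArePhases ω S₁ S₂) (hω : IsInclusion ω)
    (hμ : 0 < μ) : ∃ c M' : ℝ, ∀ (A : Coeff d m) (hA : IsAdmissible μ A) (i : Fin d) (α : Fin m),
      IsTwoPhase (V := meanZero d m) (flatOn m S₁) (energyForm hA hμ S₁) (energyForm hA hμ S₂) (load hA hμ S₁ i α)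
        (load hA hμ S₂ i α) c μ⁻¹ M' := by
  obtain ⟨C, hC, hdist⟩ := exists_norm_sub_le_resG m hω h.isPhase_left
  have hμ' := inv_pos.2 hμ
  refine ⟨μ / (2 * (1 + C ^ 2)), μ⁻¹ * ∑ i, ∑ α, ‖(unitGrad i α : L2Grad d m)‖,
    fun A hA i α => ?_⟩
  have hgrad : ∀ u : meanZero d m, ‖H1.gradL (u : H1 d m)‖ ≤ ‖u‖ := fun u => H1.norm_gradL_le u.1
  have hform : ∀ S (u v : meanZero d m), |energyForm hA hμ S u v| ≤ μ⁻¹ * ‖u‖ * ‖v‖ :=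
    fun S u v => (abs_form_le hA hμ S _ _).trans (by gcongr <;> exact hgrad _)
  have hunit : ‖(unitGrad i α : L2Grad d m)‖ ≤ ∑ i, ∑ α, ‖(unitGrad i α : L2Grad d m)‖ :=
    (Finset.single_le_sum (f := fun α => ‖(unitGrad i α : L2Grad d m)‖)
      (fun _ _ => norm_nonneg _) (Finset.mem_univ α)).trans
    (Finset.single_le_sum (f := fun i => ∑ α, ‖(unitGrad i α : L2Grad d m)‖)
      (fun _ _ => Finset.sum_nonneg fun _ _ => norm_nonneg _) (Finset.mem_univ i))
  have hload : ∀ S (v : meanZero d m), |load hA hμ S i α v| ≤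
      μ⁻¹ * (∑ i, ∑ α, ‖(unitGrad i α : L2Grad d m)‖) * ‖v‖ :=
    fun S v => (abs_form_le hA hμ S _ _).trans (by gcongr; exact hgrad v)
  refine ⟨by positivity, hμ'.le, by positivity, ?_, fun u => ?_, fun u => form_self_nonneg hA hμ _ _,
    fun u => form_self_nonneg hA hμ _ _, fun u => ?_, fun k hk v => form_eq_zero_left hA hμ hk _,
    fun k hk v => form_eq_zero_right hA hμ _ hk, fun k hk => form_eq_zero_right hA hμ _ hk,
    hform _, hform _, hload _, hload _⟩
  · exact ((resG S₁).comp (meanZero d m).subtypeL).isClosed_ker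
  · refine le_trans ?_ (h.le_form_add_form hA hμ hω u.2)
    change _ ≤ μ / 2 * ‖u‖ ^ 2
    gcongr
    nlinarith [sq_nonneg C]
  · obtain ⟨k, hk, huk⟩ := hdist u
    obtain ⟨b, hb⟩ := exists_sub_const_mem_meanZero k
    have hconst : resG S₁ (H1.const b : H1 d m) = 0 :=
      norm_le_zero_iff.1 ((norm_resG_le S₁ _).trans (by rw [H1.gradL_const, norm_zero]))
    refine ⟨⟨k - H1.const b, hb⟩, ?_, ?_⟩
    · rw [mem_flatOn, map_sub, hk, hconst, sub_zero]
    · have h1 := norm_sq_le_of_mem_meanZero (u - ⟨k - H1.const b, hb⟩ : meanZero d m).2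
      have h2 : H1.gradL ((u : H1 d m) - (k - H1.const b)) = H1.gradL ((u : H1 d m) - k) := by
        rw [map_sub, map_sub _ k, H1.gradL_const, sub_zero, map_sub]
      have h3 := H1.norm_gradL_le ((u : H1 d m) - k)
      have h4 : ‖u - ⟨k - H1.const b, hb⟩‖ ^ 2 ≤ 2 * (C * ‖resG S₁ (u : H1 d m)‖) ^ 2 := by
        refine h1.trans ?_
        rw [AddSubgroupClass.coe_sub, h2]
        gcongr
        exact h3.trans huk
      have h5 := le_form_self hA hμ S₁ (u : H1 d m)
      rw [energyForm_apply]
      refine le_trans ?_ h5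
      rw [div_mul_eq_mul_div, div_le_iff₀ (by positivity)]
      have h6 := mul_le_mul_of_nonneg_left h4 hμ.le
      nlinarith [mul_nonneg hμ.le (sq_nonneg ‖resG S₁ (u : H1 d m)‖)]

/-- On mean-zero functions the limit problem only has to be tested with functions with vanishing
gradient on `S₁`, since these have constant trace on `∂ω`. -/
theorem ArePhases.isPhaseLimit_iff (h : ArePhases ω S₁ S₂) (hω : IsInclusion ω) {i : Fin d}
    {α : Fin m} (χ : meanZero d m) : IsPhaseLimit hA hμ ω S₁ S₂ i α χ.1 ↔
      IsLimitSolution (V := meanZero d m) (flatOn m S₁) (energyForm hA hμ S₁) (energyForm hA hμ S₂)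
        (load hA hμ S₁ i α) (load hA hμ S₂ i α) χ := by
  have hzero : ∀ S (P : L2Grad d m) (c : E m), form hA hμ S P (H1.gradL (H1.const c)) = 0 :=
    fun S P c => by rw [H1.gradL_const, map_zero]
  constructor
  · rintro ⟨h1, h2, -⟩
    refine ⟨fun v => ?_, fun k hk => ?_⟩
    · rw [energyForm_apply, load_apply, ← form_corrL]
      exact h1 v
    · rw [energyForm_apply, load_apply, ← form_corrL]
      obtain ⟨c, hc⟩ := exists_sub_const_mem_zeroTrace hω h.isPhase_left (mem_flatOn.1 hk)
      have := h2 _ hc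
      rwa [h1, zero_add, map_sub, map_sub, hzero, sub_zero] at this
  · rintro ⟨h1, h2⟩
    have h1' : ∀ v : H1 d m, form hA hμ S₁ (corrL i α χ.1) (H1.gradL v) = 0 := by
      intro v
      obtain ⟨c, hc⟩ := exists_sub_const_mem_meanZero v
      have := h1 ⟨_, hc⟩
      rwa [energyForm_apply, load_apply, ← form_corrL, map_sub, map_sub, hzero, sub_zero] at this
    refine ⟨h1', fun z hz => ?_, χ.2⟩
    rw [h1', zero_add]
    refine h.eq_zero_of_mem_zeroTrace hω
      (l := (form hA hμ S₂ (corrL i α χ.1)).comp H1.gradL) (fun w hw => ?_) (fun w hw => ?_) hz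
    · obtain ⟨c, hc⟩ := exists_sub_const_mem_meanZero w
      have hflat : (⟨_, hc⟩ : meanZero d m) ∈ flatOn m S₁ := by
        rw [mem_flatOn, map_sub, (mem_zeroOn.1 hw).2.2, zero_sub, neg_eq_zero]
        exact norm_le_zero_iff.1 ((norm_resG_le S₁ _).trans (by rw [H1.gradL_const, norm_zero]))
      have := h2 _ hflat
      rwa [energyForm_apply, load_apply, ← form_corrL, map_sub, map_sub, hzero, sub_zero] at this
    · exact form_eq_zero_right hA hμ _ hw.2.2

theorem isPhaseSolution_iff {s : ℝ} {i : Fin d} {α : Fin m} (χ : meanZero d m) :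
    IsPhaseSolution hA hμ S₁ S₂ s i α χ.1 ↔ ∀ v, energyForm hA hμ S₁ χ v + load hA hμ S₁ i α v +
      s * (energyForm hA hμ S₂ χ v + load hA hμ S₂ i α v) = 0 := by
  simp only [energyForm_apply, load_apply, ← form_corrL]
  constructor
  · rintro ⟨h, -⟩ v
    exact h v
  · refine fun h => ⟨fun v => ?_, χ.2⟩
    obtain ⟨c, hc⟩ := exists_sub_const_mem_meanZero v
    have := h ⟨_, hc⟩
    simpa only [map_sub, H1.gradL_const, map_zero, sub_zero] using this

theorem ArePhases.existsUnique_isPhaseSolution (h : ArePhases ω S₁ S₂) (hω : IsInclusion ω) {s : ℝ}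
    (hs : 0 < s) (i : Fin d) (α : Fin m) : ∃! χ, IsPhaseSolution hA hμ S₁ S₂ s i α χ := by
  obtain ⟨c, M', hT⟩ := h.exists_isTwoPhase m hω hμ
  obtain ⟨χ, hχ, huniq⟩ := (hT A hA i α).existsUnique_solution hs
  refine ⟨χ.1, (isPhaseSolution_iff hA hμ χ).2 hχ, fun χ' h' => ?_⟩
  have := huniq ⟨χ', h'.2⟩ ((isPhaseSolution_iff hA hμ ⟨χ', h'.2⟩).1 h')
  exact congrArg Subtype.val this

theorem ArePhases.existsUnique_isPhaseLimit (h : ArePhases ω S₁ S₂) (hω : IsInclusion ω)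
    (i : Fin d) (α : Fin m) : ∃! χ, IsPhaseLimit hA hμ ω S₁ S₂ i α χ := by
  obtain ⟨c, M', hT⟩ := h.exists_isTwoPhase m hω hμ
  obtain ⟨χ, hχ⟩ := (hT A hA i α).exists_isLimitSolution
  refine ⟨χ.1, (h.isPhaseLimit_iff hA hμ hω χ).2 hχ, fun χ' h' => ?_⟩
  have h1 := (h.isPhaseLimit_iff hA hμ hω ⟨χ', h'.2.2⟩).1 h'
  exact congrArg Subtype.val ((hT A hA i α).isLimitSolution_unique h1 hχ)

/-- The solutions converge to the limit at a linear rate, uniformly in the coefficients. -/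
theorem ArePhases.exists_norm_sub_le (m : ℕ) (h : ArePhases ω S₁ S₂) (hω : IsInclusion ω)
    (hμ : 0 < μ) : ∃ C : ℝ, 0 ≤ C ∧ ∀ (A : Coeff d m) (hA : IsAdmissible μ A) (i : Fin d)
      (α : Fin m) (χ : H1 d m), IsPhaseLimit hA hμ ω S₁ S₂ i α χ → ‖χ‖ ≤ C ∧ ∀ s : ℝ, 0 < s →
        ∀ χs : H1 d m, IsPhaseSolution hA hμ S₁ S₂ s i α χs → ‖χs - χ‖ ≤ C * s := by
  obtain ⟨c, M', hT⟩ := h.exists_isTwoPhase m hω hμ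
  set M := μ⁻¹ with hM
  have hM0 : 0 < M := inv_pos.2 hμ
  set C₁ := |(2 * c + M) * M' / c ^ 2| with hC₁
  set C₂ := |4 * M ^ 2 * (M * C₁ + M') / c ^ 3| with hC₂
  refine ⟨C₁ + C₂, by positivity, fun A hA i α χ hχ => ?_⟩
  have ht := hT A hA i α
  have hc := ht.c_pos
  have hM' := ht.load_nonneg
  have hχ' := (h.isPhaseLimit_iff hA hμ hω ⟨χ, hχ.2.2⟩).1 hχ
  have h1 : ‖χ‖ ≤ C₁ := by
    have := ht.norm_le_of_isLimitSolution hχ'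
    refine le_trans ?_ (le_abs_self _)
    rw [le_div_iff₀ (by positivity), mul_comm]
    exact this
  refine ⟨h1.trans (le_add_of_nonneg_right (abs_nonneg _)), fun s hs χs hχs => ?_⟩
  have h2 := ht.norm_sub_le_of_isLimitSolution hs hχ'
    ((isPhaseSolution_iff hA hμ ⟨χs, hχs.2⟩).1 hχs)
  have h3 : ‖χs - χ‖ ≤ C₂ * s := by
    have h4 : c ^ 3 * ‖χs - χ‖ ≤ 4 * M ^ 2 * (M * C₁ + M') * s := by
      refine (h2 : c ^ 3 * ‖χs - χ‖ ≤ 4 * M ^ 2 * (M * ‖χ‖ + M') * s).trans ?_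
      gcongr
      exact h1
    have h5 : ‖χs - χ‖ ≤ 4 * M ^ 2 * (M * C₁ + M') / c ^ 3 * s := by
      rw [div_mul_eq_mul_div, le_div_iff₀ (by positivity), mul_comm]
      exact h4
    exact h5.trans (mul_le_mul_of_nonneg_right (le_abs_self _) hs.le)
  exact h3.trans (mul_le_mul_of_nonneg_right (le_add_of_nonneg_left (abs_nonneg _)) hs.le)

end Phases

/-! ### The cell problems and the layer potentials in terms of the two phases -/

section Equivalences

variable {d m : ℕ} {ω : Set (E d)} {A : Coeff d m} {μ : ℝ} (hA : IsAdmissible μ A) (hμ : 0 < μ)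
  {i : Fin d} {α : Fin m} {χ : H1 d m}

theorem isCellSolution_iff (hω : IsInclusion ω) {δ : ℝ} : IsCellSolution A ω δ i α χ ↔
    IsPhaseSolution hA hμ (unitCell d \ closure ω) ω δ i α χ := by
  simp only [IsCellSolution, IsPhaseSolution,
    integral_contrast_pairing_eq_form hA hμ hω δ (coeFn_corrL i α χ)]
  exact and_congr (forall_congr' fun v => by rw [add_comm]) Iff.rfl

/-- Dividing the equation by `δ` turns the stiff problem into a soft one, with the phases
exchanged. -/
theorem isCellSolution_iff_inv (hω : IsInclusion ω) {δ : ℝ} (hδ : 0 < δ) :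
    IsCellSolution A ω δ i α χ ↔
      IsPhaseSolution hA hμ ω (unitCell d \ closure ω) δ⁻¹ i α χ := by
  simp only [IsCellSolution, IsPhaseSolution,
    integral_contrast_pairing_eq_form hA hμ hω δ (coeFn_corrL i α χ)]
  refine and_congr (forall_congr' fun v => ?_) Iff.rfl
  constructor
  · intro h
    field_simp
    linarith
  · intro h
    field_simp at h
    linarith

theorem solvesOff_iff (hω : IsInclusion ω) : SolvesOff A ω i α χ ↔ ∀ z ∈ zeroTrace m ω,
    form hA hμ ω (corrL i α χ) (H1.gradL z) +
      form hA hμ (unitCell d \ closure ω) (corrL i α χ) (H1.gradL z) = 0 := by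
  have key : ∀ (ϕ : E d → E m) (v : H1 d m), IsTestOff ω ϕ → v.fn =ᵐ[cellMeasure d] ϕ →
      ∫ y in unitCell d, pairing A y (correctedGrad i α χ y)
        (WithLp.toLp 2 fun p : Fin d × Fin m =>
          fderiv ℝ ϕ y (EuclideanSpace.single p.1 1) p.2) =
      form hA hμ ω (corrL i α χ) (H1.gradL v) +
        form hA hμ (unitCell d \ closure ω) (corrL i α χ) (H1.gradL v) := by
    intro ϕ v hϕ hv
    rw [← integral_pairing_eq_form hA hμ hω (coeFn_corrL i α χ)]
    refine integral_congr_ae ?_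
    have hr : Represents ϕ v :=
      Represents.of_contDiff (hϕ.1.of_le (by exact_mod_cast le_top)) hϕ.2.1 hv
    filter_upwards [hr.grad_eq] with y hy
    rw [hy]
    rfl
  constructor
  · intro h z hz
    let l : H1 d m →L[ℝ] ℝ := (form hA hμ ω (corrL i α χ) +
      form hA hμ (unitCell d \ closure ω) (corrL i α χ)).comp H1.gradL
    have hle : zeroTrace m ω ≤ LinearMap.ker l.toLinearMap := by
      refine Submodule.topologicalClosure_minimal _ (Submodule.span_le.2 ?_) l.isClosed_ker
      rintro v ⟨ϕ, hϕ, hv⟩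
      exact (key ϕ v hϕ hv).symm.trans (h ϕ hϕ)
    exact hle hz
  · intro h ϕ hϕ
    have hc : ContDiff ℝ 1 ϕ := hϕ.1.of_le (by exact_mod_cast le_top)
    have hv := H1.fn_ofPeriodic hϕ.2.1 hc
    rw [key ϕ _ hϕ hv]
    exact h _ (mem_zeroTrace_of_isTestOff hϕ hv)

theorem isSoftSolution_iff (hω : IsInclusion ω) : IsSoftSolution A ω i α χ ↔
    IsPhaseLimit hA hμ ω (unitCell d \ closure ω) ω i α χ := by
  have h : IsConormalPlus A ω (correctedGrad i α χ) (0 : HNegHalf m ω) ↔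
      ∀ v, form hA hμ (unitCell d \ closure ω) (corrL i α χ) (H1.gradL v) = 0 := by
    simp only [IsConormalPlus, setIntegral_pairing_eq_form hA hμ hω.isOpen_background sdiff_subset
      (coeFn_corrL i α χ)]
    exact forall_congr' fun v => by rw [zero_apply, eq_comm, neg_eq_zero]
  have hc : ∀ Q, form hA hμ ω (corrL i α χ) Q + form hA hμ (unitCell d \ closure ω) (corrL i α χ) Q =
      form hA hμ (unitCell d \ closure ω) (corrL i α χ) Q + form hA hμ ω (corrL i α χ) Q :=
    fun Q => add_comm _ _
  rw [IsSoftSolution, IsPhaseLimit, h, solvesOff_iff hA hμ hω]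
  simp only [hc]
  tauto

theorem isStiffSolution_iff (hω : IsInclusion ω) : IsStiffSolution A ω i α χ ↔
    IsPhaseLimit hA hμ ω ω (unitCell d \ closure ω) i α χ := by
  have h : IsConormalMinus A ω (correctedGrad i α χ) (0 : HNegHalf m ω) ↔
      ∀ v, form hA hμ ω (corrL i α χ) (H1.gradL v) = 0 := by
    simp only [IsConormalMinus, setIntegral_pairing_eq_form hA hμ hω.isOpen hω.subset
      (coeFn_corrL i α χ)]
    exact forall_congr' fun v => by rw [zero_apply, eq_comm]
  rw [IsStiffSolution, IsPhaseLimit, h, solvesOff_iff hA hμ hω]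
  tauto

theorem isSingleLayer_iff (hω : IsInclusion ω) {ψ : HNegHalf m ω} {u : H1 d m} :
    IsSingleLayer A ω ψ u ↔ (∀ v, form hA hμ ω (H1.gradL u) (H1.gradL v) +
      form hA hμ (unitCell d \ closure ω) (H1.gradL u) (H1.gradL v) + ψ (trace ω v) = 0) ∧
        u.MeanZero := by
  have h : H1.gradL u =ᵐ[cellMeasure d] u.grad := Filter.EventuallyEq.rfl
  simp only [IsSingleLayer, integral_pairing_eq_form hA hμ hω h]

theorem isSingleLayer_unique (hA : IsAdmissible μ A) (hμ : 0 < μ) (hω : IsInclusion ω)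
    {ψ : HNegHalf m ω} {u u' : H1 d m} (hu : IsSingleLayer A ω ψ u)
    (hu' : IsSingleLayer A ω ψ u') : u = u' := by
  rw [isSingleLayer_iff hA hμ hω] at hu hu'
  have hw : u - u' ∈ meanZero d m := Submodule.sub_mem _ hu.2 hu'.2
  have h1 := ArePhases.le_form_add_form hA hμ (Or.inl ⟨rfl, rfl⟩) hω hw
  have h2 : form hA hμ ω (H1.gradL (u - u')) (H1.gradL (u - u')) +
      form hA hμ (unitCell d \ closure ω) (H1.gradL (u - u')) (H1.gradL (u - u')) = 0 := by
    have e1 := hu.1 (u - u')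
    have e2 := hu'.1 (u - u')
    rw [map_sub H1.gradL u u'] at e1 e2 ⊢
    rw [map_sub (form hA hμ ω), map_sub (form hA hμ (unitCell d \ closure ω)), sub_apply, sub_apply]
    linarith
  rw [h2] at h1
  have h3 : ‖u - u'‖ ^ 2 ≤ 0 := by
    by_contra! hcon
    nlinarith [mul_pos hμ hcon]
  have h4 : ‖u - u'‖ = 0 := pow_eq_zero_iff two_ne_zero |>.1 (le_antisymm h3 (sq_nonneg _))
  exact sub_eq_zero.1 (norm_eq_zero.1 h4)

/-- The functional on the trace space induced by a functional that vanishes on the functions of zero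
trace. -/
theorem exists_forall_trace_eq (l : H1 d m →L[ℝ] ℝ) (hl : ∀ z ∈ zeroTrace m ω, l z = 0) :
    ∃ ψ : HNegHalf m ω, ∀ v, ψ (trace ω v) = l v :=
  ⟨(zeroTrace m ω).liftQL l hl, fun _ => rfl⟩

theorem trace_eq_zero {z : H1 d m} (hz : z ∈ zeroTrace m ω) : trace ω z = 0 :=
  (Submodule.Quotient.mk_eq_zero _).2 hz

theorem gradL_eq_zero_of_const {v : H1 d m} {c : E m} (hv : v.fn =ᵐ[cellMeasure d] fun _ => c) :
    H1.gradL v = 0 := by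
  rw [H1.ext_fn (hv.trans (H1.fn_const c).symm), H1.gradL_const]

/-- The flux identity satisfied by a layer corrector: with `χ = χ₁ + 𝒮ψ`, the equation
`(t - 𝒦*) ψ = φ` says that the exterior conormal derivative of `χ + y_i e^α` is
`(t + 1/2) ψ`, and `ψ` is minus the energy functional of `χ + y_i e^α` on the whole cell. -/
theorem isLayerCorrector_iff (hω : IsInclusion ω) {t : ℝ} : IsLayerCorrector A ω t i α χ ↔
    (∀ v : H1 d m, form hA hμ (unitCell d \ closure ω) (corrL i α χ) (H1.gradL v) =
      (t + 1 / 2) * (form hA hμ ω (corrL i α χ) (H1.gradL v) +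
        form hA hμ (unitCell d \ closure ω) (corrL i α χ) (H1.gradL v))) ∧
    (∀ z ∈ zeroTrace m ω, form hA hμ ω (corrL i α χ) (H1.gradL z) +
      form hA hμ (unitCell d \ closure ω) (corrL i α χ) (H1.gradL z) = 0) ∧ χ.MeanZero := by
  set B := unitCell d \ closure ω with hB
  have hph : ArePhases ω ω B := Or.inl ⟨rfl, rfl⟩
  have hplus : ∀ (χ : H1 d m) (φ : HNegHalf m ω), IsConormalPlus A ω (correctedGrad i α χ) φ ↔
      ∀ v, φ (trace ω v) = -form hA hμ B (corrL i α χ) (H1.gradL v) := fun χ φ => by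
    simp only [IsConormalPlus, setIntegral_pairing_eq_form hA hμ hω.isOpen_background sdiff_subset
      (coeFn_corrL i α χ), hB]
  have hplus' : ∀ (u : H1 d m) (φ : HNegHalf m ω), IsConormalPlus A ω u.grad φ ↔
      ∀ v, φ (trace ω v) = -form hA hμ B (H1.gradL u) (H1.gradL v) := fun u φ => by
    have h : H1.gradL u =ᵐ[cellMeasure d] u.grad := Filter.EventuallyEq.rfl
    simp only [IsConormalPlus, setIntegral_pairing_eq_form hA hμ hω.isOpen_background sdiff_subset
      h, hB]
  have hminus : ∀ (χ : H1 d m) (φ : HNegHalf m ω), IsConormalMinus A ω (correctedGrad i α χ) φ ↔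
      ∀ v, φ (trace ω v) = form hA hμ ω (corrL i α χ) (H1.gradL v) := fun χ φ => by
    simp only [IsConormalMinus, setIntegral_pairing_eq_form hA hμ hω.isOpen hω.subset
      (coeFn_corrL i α χ)]
  have hadd : ∀ S (χ₁ u : H1 d m) Q, form hA hμ S (corrL i α (χ₁ + u)) Q =
      form hA hμ S (corrL i α χ₁) Q + form hA hμ S (H1.gradL u) Q := fun S χ₁ u Q => by
    rw [form_corrL, form_corrL, map_add, map_add, add_apply]
    ring
  constructor
  · rintro ⟨χ₁, φ, ψ, u, hχ₁, -, hφp, hφm, ⟨-, κ, ⟨u', hu', hκ⟩, hres⟩, hu, hχ⟩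
    obtain rfl := isSingleLayer_unique hA hμ hω hu hu'
    rw [isSingleLayer_iff hA hμ hω] at hu
    rw [isCellSolution_iff hA hμ hω] at hχ₁
    rw [hplus] at hφp
    rw [hminus] at hφm
    rw [hplus'] at hκ
    have hmean : ∫ z in unitCell d, u.fn z = 0 := hu.2
    have hχu : χ = χ₁ + u := by
      refine H1.ext_fn (hχ.trans (EventuallyEq.trans ?_ (H1.fn_add χ₁ u).symm))
      filter_upwards with y
      rw [hmean, sub_zero, Pi.add_apply]
    subst hχu
    simp only [hadd]
    refine ⟨fun v => ?_, fun z hz => ?_, Submodule.add_mem (meanZero d m) hχ₁.2 hu.2⟩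
    · have e1 := hφp v
      have e2 := hφm v
      have e3 := hκ v
      have e4 := congrArg (fun f : HNegHalf m ω => f (trace ω v)) hres
      have e5 := hu.1 v
      simp only [add_apply, sub_apply, smul_apply, smul_eq_mul] at e3 e4
      linear_combination -(t + 1 / 2) * e5 + e3 + e4 + e1 + (t + 1 / 2) * (e2 - e1)
    · have e1 := hφp z
      have e2 := hφm z
      have e3 := hu.1 z
      rw [trace_eq_zero hz, map_zero] at e1 e2 e3
      linarith
  · rintro ⟨h1, h2, h3⟩
    obtain ⟨χ₁, hχ₁, -⟩ := (hph.symm).existsUnique_isPhaseSolution hA hμ hω one_pos i α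
    have hχ₁' := (isCellSolution_iff hA hμ hω).2 hχ₁
    have htot : ∀ v : H1 d m, form hA hμ ω (corrL i α χ₁) (H1.gradL v) =
        -form hA hμ B (corrL i α χ₁) (H1.gradL v) := fun v => by
      have := hχ₁.1 v
      linarith
    obtain ⟨φ, hφ⟩ := exists_forall_trace_eq ((form hA hμ ω (corrL i α χ₁)).comp H1.gradL)
      fun z hz => hph.form_eq_zero hA hμ hω (fun z _ => by rw [htot]; ring) hz
    obtain ⟨ψ, hψ⟩ := exists_forall_trace_eq
      (-((form hA hμ ω (corrL i α χ)) + form hA hμ B (corrL i α χ)).comp H1.gradL)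
      fun z hz => by
        have := h2 z hz
        simp only [neg_apply, ContinuousLinearMap.comp_apply, add_apply]
        linarith
    simp only [neg_apply, ContinuousLinearMap.comp_apply, add_apply] at hφ hψ
    have hχu : χ = χ₁ + (χ - χ₁) := by abel
    have hadd' : ∀ S Q, form hA hμ S (corrL i α χ) Q =
        form hA hμ S (corrL i α χ₁) Q + form hA hμ S (H1.gradL (χ - χ₁)) Q := fun S Q => by
      conv_lhs => rw [hχu]
      exact hadd S χ₁ (χ - χ₁) Q
    have hmean : (χ - χ₁).MeanZero := Submodule.sub_mem (meanZero d m) h3 hχ₁.2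
    have hu : IsSingleLayer A ω ψ (χ - χ₁) := by
      refine (isSingleLayer_iff hA hμ hω).2 ⟨fun v => ?_, hmean⟩
      rw [hψ, hadd', hadd']
      linear_combination -htot v
    refine ⟨χ₁, φ, ψ, χ - χ₁, hχ₁', fun v c hv => ?_, (hplus _ _).2 fun v => ?_,
      (hminus _ _).2 hφ, ⟨fun v c hv => ?_, t • ψ - φ, ⟨χ - χ₁, hu, (hplus' _ _).2 fun v => ?_⟩,
      by abel⟩, hu, ?_⟩
    · rw [hφ, gradL_eq_zero_of_const hv, map_zero]
    · rw [hφ, htot]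
    · rw [hψ, gradL_eq_zero_of_const hv, map_zero, map_zero, add_zero, neg_zero]
    · have e1 := h1 v
      have e2 := htot v
      simp only [add_apply, sub_apply, smul_apply, smul_eq_mul, hφ, hψ]
      rw [hadd', hadd'] at e1 ⊢
      linear_combination e1 - e2
    · have h0 : ∫ z in unitCell d, (χ - χ₁).fn z = 0 := hmean
      filter_upwards [H1.fn_sub χ χ₁] with y hy
      rw [h0, hy, Pi.sub_apply]
      abel

/-- At `t = -1/2` the exterior flux vanishes: the soft problem. -/
theorem isLayerCorrector_neg_half_iff (hω : IsInclusion ω) :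
    IsLayerCorrector A ω (-1 / 2) i α χ ↔
      IsPhaseLimit hA hμ ω (unitCell d \ closure ω) ω i α χ := by
  rw [isLayerCorrector_iff hA hμ hω, IsPhaseLimit]
  refine and_congr (forall_congr' fun v => ?_) (and_congr ?_ Iff.rfl)
  · norm_num
  · exact forall₂_congr fun z _ => by rw [add_comm]

/-- At `t = 1/2` the exterior flux is the total flux, so the interior one vanishes: the stiff
problem. -/
theorem isLayerCorrector_half_iff (hω : IsInclusion ω) :
    IsLayerCorrector A ω (1 / 2) i α χ ↔
      IsPhaseLimit hA hμ ω ω (unitCell d \ closure ω) i α χ := by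
  rw [isLayerCorrector_iff hA hμ hω, IsPhaseLimit]
  refine and_congr (forall_congr' fun v => ?_) Iff.rfl
  constructor <;> intro h <;> linarith

end Equivalences

end HighContrast

theorem theorem3p2 (d m : ℕ) (hd : 2 ≤ d) (hm : 1 ≤ m)
    (ω : Set (HighContrast.E d)) (hω : HighContrast.IsInclusion ω) (μ : ℝ) (hμ : 0 < μ) :
    ∃ C : ℝ, ∀ A : HighContrast.Coeff d m, HighContrast.IsAdmissible μ A →
      ∀ (i : Fin d) (α : Fin m),
        (∀ δ : ℝ, 0 < δ → ∃! χ, HighContrast.IsCellSolution A ω δ i α χ) ∧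
        (∃! χ, HighContrast.IsLayerCorrector A ω (-1 / 2) i α χ) ∧
        (∃! χ, HighContrast.IsLayerCorrector A ω (1 / 2) i α χ) ∧
        ∀ χ₀ χinf : HighContrast.H1 d m,
          HighContrast.IsLayerCorrector A ω (-1 / 2) i α χ₀ →
          HighContrast.IsLayerCorrector A ω (1 / 2) i α χinf →
            (HighContrast.IsSoftSolution A ω i α χ₀ ∧
              ∀ χ, HighContrast.IsSoftSolution A ω i α χ → χ = χ₀) ∧
            (HighContrast.IsStiffSolution A ω i α χinf ∧
              ∀ χ, HighContrast.IsStiffSolution A ω i α χ → χ = χinf) ∧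
            ∀ δ : ℝ, 0 < δ → ∀ χδ : HighContrast.H1 d m,
              HighContrast.IsCellSolution A ω δ i α χδ →
                ‖χδ - χ₀‖ ≤ C * δ ∧ ‖χδ - χinf‖ ≤ C * δ⁻¹ ∧ ‖χδ‖ ≤ C := by
  have hstiff : HighContrast.ArePhases ω ω (HighContrast.unitCell d \ closure ω) :=
    Or.inl ⟨rfl, rfl⟩
  have hsoft := hstiff.symm
  obtain ⟨C₁, hC₁, hsoftC⟩ := hsoft.exists_norm_sub_le m hω hμ
  obtain ⟨C₂, hC₂, hstiffC⟩ := hstiff.exists_norm_sub_le m hω hμ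
  refine ⟨2 * (C₁ + C₂), fun A hA i α => ?_⟩
  have hsoftU := hsoft.existsUnique_isPhaseLimit hA hμ hω i α
  have hstiffU := hstiff.existsUnique_isPhaseLimit hA hμ hω i α
  simp only [HighContrast.isLayerCorrector_neg_half_iff hA hμ hω,
    HighContrast.isLayerCorrector_half_iff hA hμ hω, HighContrast.isSoftSolution_iff hA hμ hω,
    HighContrast.isStiffSolution_iff hA hμ hω]
  refine ⟨fun δ hδ => ?_, hsoftU, hstiffU, fun χ₀ χinf h₀ hinf =>
    ⟨⟨h₀, fun χ hχ => hsoftU.unique hχ h₀⟩, ⟨hinf, fun χ hχ => hstiffU.unique hχ hinf⟩,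
      fun δ hδ χδ hχδ => ?_⟩⟩
  · simp only [HighContrast.isCellSolution_iff hA hμ hω]
    exact hsoft.existsUnique_isPhaseSolution hA hμ hω hδ i α
  · obtain ⟨hb₀, hs₀⟩ := hsoftC A hA i α χ₀ h₀
    obtain ⟨hbi, hsi⟩ := hstiffC A hA i α χinf hinf
    have h1 := hs₀ δ hδ χδ ((HighContrast.isCellSolution_iff hA hμ hω).1 hχδ)
    have h2 := hsi δ⁻¹ (inv_pos.2 hδ) χδ ((HighContrast.isCellSolution_iff_inv hA hμ hω hδ).1 hχδ)
    have hδ' : 0 < δ⁻¹ := inv_pos.2 hδ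
    refine ⟨h1.trans ?_, h2.trans ?_, ?_⟩
    · gcongr
      linarith
    · gcongr
      linarith
    · -- The soft estimate serves for `δ ≤ 1`, the stiff one for `δ ≥ 1`.
      rcases le_total δ 1 with hle | hle
      · have h3 : ‖χδ‖ ≤ ‖χδ - χ₀‖ + ‖χ₀‖ := by simpa using norm_add_le (χδ - χ₀) χ₀
        have h4 := mul_le_mul_of_nonneg_left hle hC₁
        linarith
      · have h3 : ‖χδ‖ ≤ ‖χδ - χinf‖ + ‖χinf‖ := by simpa using norm_add_le (χδ - χinf) χinf
        have h4 := mul_le_mul_of_nonneg_left (inv_le_one_of_one_le₀ hle) hC₂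
        linarith
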